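/- **Setting.** A (weighted) Unique Games instance on a finite vertex set $V$ with alphabet $[q]$ assigns to every ordered pair $(u,v)$ and every permutation $\pi$ of $[q]$ a weight $w_{uv}(\pi)\ge 0$ with $w_{vu}(\pi^{-1})=w_{uv}(\pi)$; a labeling $L:V\to[q]$ satisfies a constraint $\pi$ on $(u,v)$ if $\pi(L(u))=L(v)$, and the fraction of constraints satisfied by $L$ is measured by weight. The instance is $d$-regular if $\sum_v\sum_\pi w_{uv}(\pi)=d$ for every $u$. Its label-extended graph has adjacency matrix $M$ on $V\times[q]$ with $M((u,i),(v,j))=\sum_{\pi(i)=j}w_{uv}(\pi)$. *The algorithm.* Given $M$, $\varepsilon$, $\gamma$ and a constant $K$, the spectral algorithm $\mathcal A_K$ (i) computes by Jacobi rotations an orthonormal eigenbasis of $M$, up to an off-diagonal error of at most $\varepsilon d/4$, and keeps the basis vectors $w_1,\dots,w_D$ with computed eigenvalue greater than $(1-\gamma+\varepsilon/4)d$; (ii) for every $x=\sum_s\alpha_s w_s$ with $\alpha_s\in\sqrt{2\varepsilon/(\gamma D)}\,\mathbb Z$ and $\|x\|\le 1$, reads off the labeling $L_x(u)=\arg\max_i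 x_{ui}$; (iii) returns a labeling $L_x$ that satisfies the largest fraction of constraints if this fraction is at least $1-K\left(\frac{\varepsilon}{\gamma-8\varepsilon}+\varepsilon\right)$, and otherwise rejects. Running time is the number of steps of a real random access machine: one step for each arithmetic operation on reals (including square root), comparison, memory access and round of a loop; integer parts are found by counting upwards. *The instance.* Let $n=2^k$, $N=2^n$ and $0<\varepsilon<1$. Identify $\mathbb F_2^n$ with the functions $\{0,1\}^k\to\mathbb F_2$, and let $H=\{h_S: S\in\{0,1\}^k\}$, $h_S(x)=\langle x,S\rangle$, be the Hadamard code. The Khot–Vishnoi instance has as vertices the cosets of $H$, with arbitrary representatives $p_i$, and the $n$ labels $S\in\{0,1\}^k$. For all $f=p_i+h_S$ and $g=p_j+h_T$ there is an edge of weight $\varepsilon^{|f+g|}(1-\varepsilon)^{n-|f+g|}$ between the cosets of $f$ and $g$, whose constraint matches the label $S+U$ of the first with the label $T+U$ of the second, for all $U$. **Claim.** There is a constant $K>0$ such that the following two statements hold. (1) For every regular instance and all $\varepsilon>0$, $\gamma>8\varepsilon$: if some labeling satisfies at least a fraction $1-\varepsilon$ of the constraints, then $\mathcal A_K$ returns a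 labeling that satisfies at least a fraction $1-K\left(\frac{\varepsilon}{\gamma-8\varepsilon}+\varepsilon\right)$. (So rejection proves that the instance is not $(1-\varepsilon)$-satisfiable.) (2) For every $C>0$ there are $\varepsilon_0,B>0$ such that for every $0<\varepsilon<\varepsilon_0$ (with $\varepsilon\le 1$), with $\gamma=C\sqrt\varepsilon$, one has $\gamma>8\varepsilon$ and there is a $k_0$ such that for all $k\ge 0$, and for every choice of representatives, the Khot–Vishnoi instance has the following properties. - It is $n$-regular. The map $(i,S)\mapsto p_i+h_S$ is a bijection from the vertices of its label-extended graph to $\mathbb F_2^n$, which turns the adjacency matrix $M$ into the matrix $\left(n\,\varepsilon^{|f+g|}(1-\varepsilon)^{n-|f+g|}\right)_{f,g\in\mathbb F_2^n}$ of the $\varepsilon$-noisy hypercube. The characters $\chi_\omega(f)=(-1)^{\langle\omega,f\rangle}$, $\omega\in\mathbb F_2^n$, form a basis of eigenvectors of the latter, with eigenvalues $n(1-2\varepsilon)^{|\omega|}$. - The span $W$ of the eigenvectors of $M$ with eigenvalue at least $(1-\gamma)n$ has dimension at most $\frac1\varepsilon n^{B/\varepsilon}$. - It is highly unsatisfiable: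 every labeling satisfies at most a fraction $n^{-\varepsilon}$ of the constraints. - For every numbering of the vertices and labels, $\mathcal A_K$ with parameters $\varepsilon,\gamma$ runs in at most $N^{\frac B\varepsilon(\log_2 N)^{B/\varepsilon}}$ steps, that is, in time $N^{\mathrm{poly}(\log N)}$ for fixed $\varepsilon$; and if $k\ge k_0$, it rejects. -/

import Mathlib

open scoped BigOperators

noncomputable section

/-! ## Unique Games -/

/-- A weighted instance of Unique Games with vertex set `V` and alphabet `K`.  Between two vertices
there may be several constraints: `weight u v π` is the total weight of the edges from `u` to `v`
that carry the constraint `π (label of u) = label of v`.  Edges are undirected, so every edge is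
seen from both of its endpoints. -/
structure UniqueGame (V K : Type) where
  weight : V → V → Equiv.Perm K → ℝ
  nonneg : ∀ u v π, 0 ≤ weight u v π
  symm : ∀ u v π, weight v u π⁻¹ = weight u v π

namespace UniqueGame

variable {V K : Type} [Fintype V] [Fintype K] [DecidableEq K]

/-- The adjacency matrix `M` of the label-extended graph: the block `(u, v)` is the weighted sum of
the permutation matrices of the constraints between `u` and `v`. -/
def labelExtended (U : UniqueGame V K) : Matrix (V × K) (V × K) ℝ :=
  fun a b => ∑ π : Equiv.Perm K, if π a.2 = b.2 then U.weight a.1 b.1 π else 0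

/-- The constraint graph is `d`-regular (total weight `d` at every vertex). -/
def IsRegular (U : UniqueGame V K) (d : ℝ) : Prop :=
  ∀ u, ∑ v, ∑ π, U.weight u v π = d

/-- Total weight of all constraints (every edge being counted from both ends). -/
def totalWeight (U : UniqueGame V K) : ℝ :=
  ∑ u, ∑ v, ∑ π, U.weight u v π

/-- Total weight of the constraints satisfied by the labeling `L`, counted in the same way. -/
def satisfiedWeight (U : UniqueGame V K) (L : V → K) : ℝ :=
  ∑ u, ∑ v, ∑ π : Equiv.Perm K, if π (L u) = L v then U.weight u v π else 0

/-- `L` satisfies at least a fraction `ρ` of the constraints. -/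
def SatisfiesAtLeast (U : UniqueGame V K) (L : V → K) (ρ : ℝ) : Prop :=
  ρ * U.totalWeight ≤ U.satisfiedWeight L

/-- `L` satisfies at most a fraction `ρ` of the constraints. -/
def SatisfiesAtMost (U : UniqueGame V K) (L : V → K) (ρ : ℝ) : Prop :=
  U.satisfiedWeight L ≤ ρ * U.totalWeight

end UniqueGame

/-- The span of the eigenvectors of `M` whose eigenvalue is at least `t`. -/
def largeEigenspace {ι : Type} [Fintype ι] (M : Matrix ι ι ℝ) (t : ℝ) :
    Submodule ℝ (ι → ℝ) :=
  ⨆ (μ : ℝ) (_ : t ≤ μ), Module.End.eigenspace M.mulVecLin μ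

/-! ## The Khot–Vishnoi instance -/

/-- `{0,1}^k`, used both as the set of the `n = 2^k` coordinates and as the set of labels
(subsets of `[k]`). -/
abbrev KVLabel (k : ℕ) : Type := Fin k → ZMod 2

/-- The group `H_n = F_2^n`, `n = 2^k`, of boolean functions on `{0,1}^k`. -/
abbrev KVCube (k : ℕ) : Type := KVLabel k → ZMod 2

/-- The Hadamard code `y ↦ h_y`, `h_y(x) = ⟨x, y⟩`. -/
def hadamardCode (k : ℕ) : KVLabel k →+ KVCube k :=
  AddMonoidHom.mk' (fun y x => ∑ i, x i * y i) (by
    intro a b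
    funext x
    simp [mul_add, Finset.sum_add_distrib])

/-- The vertices of the constraint graph: the cosets of the Hadamard code. -/
abbrev KVVertex (k : ℕ) : Type := KVCube k ⧸ (hadamardCode k).range

instance (k : ℕ) : Fintype (KVVertex k) := Fintype.ofFinite _

/-- Probability of moving from `f` to `g` by flipping every bit of `f` independently with
probability `ε`: `ε ^ |f + g| * (1 - ε) ^ (n - |f + g|)`. -/
def noiseWeight (k : ℕ) (ε : ℝ) (f g : KVCube k) : ℝ :=
  ε ^ hammingDist f g * (1 - ε) ^ (2 ^ k - hammingDist f g)

theorem noiseWeight_nonneg (k : ℕ) {ε : ℝ} (hε : ε ∈ Set.Icc (0 : ℝ) 1) (f g : KVCube k) :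
    0 ≤ noiseWeight k ε f g :=
  mul_nonneg (pow_nonneg hε.1 _) (pow_nonneg (sub_nonneg.2 hε.2) _)

theorem noiseWeight_comm (k : ℕ) (ε : ℝ) (f g : KVCube k) :
    noiseWeight k ε f g = noiseWeight k ε g f := by
  unfold noiseWeight
  rw [hammingDist_comm]

/-- The Khot–Vishnoi instance with `n = 2^k` labels and noise `ε`.  `rep` picks a representative of
every coset.  For every `f = rep x + h_S` in the coset `x` and every `g = rep y + h_T` in the coset
`y` there is an edge between `x` and `y` of weight `noiseWeight k ε f g`; its constraint
identifies the label `S + U` of `x` with the label `T + U` of `y`, for all `U`, so that it is the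
translation by `S + T`. -/
def khotVishnoi (k : ℕ) (ε : ℝ) (hε : ε ∈ Set.Icc (0 : ℝ) 1) (rep : KVVertex k → KVCube k) :
    UniqueGame (KVVertex k) (KVLabel k) where
  weight x y π := ∑ S : KVLabel k, ∑ T : KVLabel k,
    if π = Equiv.addRight (S + T) then
      noiseWeight k ε (rep x + hadamardCode k S) (rep y + hadamardCode k T)
    else 0
  nonneg x y π := by
    refine Finset.sum_nonneg fun S _ => Finset.sum_nonneg fun T _ => ?_
    split_ifs
    · exact noiseWeight_nonneg k hε _ _
    · exact le_rfl
  symm x y π := by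
    rw [Finset.sum_comm]
    refine Finset.sum_congr rfl fun S _ => Finset.sum_congr rfl fun T _ => ?_
    have h2 : ∀ a : KVLabel k, -a = a := fun a => by
      funext i
      exact ZMod.neg_eq_self_mod_two (a i)
    have h1 : (π⁻¹ = Equiv.addRight (T + S)) ↔ (π = Equiv.addRight (S + T)) := by
      rw [inv_eq_iff_eq_inv]
      have h3 : (Equiv.addRight (T + S) : Equiv.Perm (KVLabel k))⁻¹ = Equiv.addRight (S + T) := by
        ext a
        simp [add_left_comm]
      rw [h3]
    simp only [h1, noiseWeight_comm k ε (rep y + _)]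

/-- The element `rep x + h_S` of the cube that corresponds to the vertex `(x, S)` of the
label-extended graph. -/
def kvPoint {k : ℕ} (rep : KVVertex k → KVCube k) (a : KVVertex k × KVLabel k) : KVCube k :=
  rep a.1 + hadamardCode k a.2

/-- The adjacency matrix of the `ε`-noisy hypercube on `F_2^n`: the entry at `(f, g)` depends only
on `f - g`, and is `n` times the noise probability. -/
def noisyCube (k : ℕ) (ε : ℝ) : Matrix (KVCube k) (KVCube k) ℝ :=
  fun f g => (2 : ℝ) ^ k * noiseWeight k ε f g

/-- The character `χ_ω(f) = (-1)^⟨ω, f⟩` of `F_2^n`. -/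
def cubeCharacter {k : ℕ} (ω f : KVCube k) : ℝ :=
  (-1 : ℝ) ^ (∑ x, ω x * f x).val

/-! ## Step counting: a real random access machine

One step is charged for each arithmetic operation (including square root) on real numbers, each
comparison, each access to memory and each round of a loop. -/

/-- A computation: its result and the number of steps that it takes. -/
structure Timed (α : Type) where
  val : α
  steps : ℕ

namespace Timed

instance : Monad Timed where
  pure a := ⟨a, 0⟩
  bind x f := ⟨(f x.val).val, x.steps + (f x.val).steps⟩

def add (x y : ℝ) : Timed ℝ := ⟨x + y, 1⟩
def sub (x y : ℝ) : Timed ℝ := ⟨x - y, 1⟩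
def mul (x y : ℝ) : Timed ℝ := ⟨x * y, 1⟩
def div (x y : ℝ) : Timed ℝ := ⟨x / y, 1⟩
def sqrt (x : ℝ) : Timed ℝ := ⟨Real.sqrt x, 1⟩
def lt (x y : ℝ) : Timed Bool := ⟨decide (x < y), 1⟩

/-- Test whether two indices, or two real numbers, are equal. -/
def eq {α : Type} [DecidableEq α] (x y : α) : Timed Bool := ⟨decide (x = y), 1⟩

/-- Conversion of an integer to a real number. -/
def ofInt (a : ℤ) : Timed ℝ := ⟨(a : ℝ), 1⟩

/-- Integer parts, found by counting upwards. -/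
def floor (x : ℝ) : Timed ℕ := ⟨⌊x⌋₊, ⌊x⌋₊ + 1⟩
def ceil (x : ℝ) : Timed ℕ := ⟨⌈x⌉₊, ⌈x⌉₊ + 1⟩

/-- Length of a list. -/
def length {α : Type} (l : List α) : Timed ℕ := ⟨l.length, l.length + 1⟩

/-- Read one cell of an array. -/
def read {ι α : Type} (x : ι → α) (i : ι) : Timed α := ⟨x i, 1⟩

/-- Compute all cells of an array and store them. -/
def table {ι α : Type} [Fintype ι] (f : ι → Timed α) : Timed (ι → α) :=
  ⟨fun i => (f i).val, ∑ i, ((f i).steps + 1)⟩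

/-- Compute the summands one after the other and add them up. -/
def sum {ι : Type} [Fintype ι] (f : ι → Timed ℝ) : Timed ℝ :=
  ⟨∑ i, (f i).val, ∑ i, ((f i).steps + 1)⟩

/-- A loop over a list. -/
def forEach {ι σ : Type} : List ι → σ → (ι → σ → Timed σ) → Timed σ
  | [], s, _ => ⟨s, 0⟩
  | i :: l, s, body => do
      let s' ← (⟨(body i s).val, (body i s).steps + 1⟩ : Timed σ)
      forEach l s' body

end Timed

/-! ## Computation of an eigenbasis: the Jacobi eigenvalue algorithm -/

section Jacobi

open Timed

variable {ι : Type} [Fintype ι] [DecidableEq ι]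

/-- `A * J`, for the plane rotation `J` in the coordinates `p, q` with cosine `c` and sine `s`. -/
def rotateColumns (A : ι → ι → ℝ) (p q : ι) (c s : ℝ) : Timed (ι → ι → ℝ) :=
  table fun i => table fun j => do
    if ← Timed.eq j p then
      sub (← mul c (← read (A i) p)) (← mul s (← read (A i) q))
    else if ← Timed.eq j q then
      add (← mul s (← read (A i) p)) (← mul c (← read (A i) q))
    else read (A i) j

/-- `Jᵀ * A`, for the same `J`. -/
def rotateRows (A : ι → ι → ℝ) (p q : ι) (c s : ℝ) : Timed (ι → ι → ℝ) :=
  table fun i => table fun j => do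
    if ← Timed.eq i p then
      sub (← mul c (← read (A p) j)) (← mul s (← read (A q) j))
    else if ← Timed.eq i q then
      add (← mul s (← read (A p) j)) (← mul c (← read (A q) j))
    else read (A i) j

/-- The position of an off-diagonal entry of largest absolute value. -/
def pivot (idx : List ι) (A : ι → ι → ℝ) : Timed (Option (ι × ι)) :=
  forEach (idx ×ˢ idx) none fun e best => do
    if ← Timed.eq e.1 e.2 then pure best
    else
      match best with
      | none => pure (some e)
      | some b => do
          let x ← read (A e.1) e.2
          let y ← read (A b.1) b.2
          if ← lt (← mul y y) (← mul x x) then pure (some e) else pure best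

/-- One Jacobi rotation: the largest off-diagonal entry of `A` is annihilated, and the rotation is
recorded in `Q`. -/
def jacobiStep (idx : List ι) (S : (ι → ι → ℝ) × (ι → ι → ℝ)) :
    Timed ((ι → ι → ℝ) × (ι → ι → ℝ)) := do
  match ← pivot idx S.1 with
  | none => pure S
  | some (p, q) => do
      let a ← read (S.1 p) q
      if ← Timed.eq a 0 then pure S
      else do
        let θ ← div (← sub (← read (S.1 q) q) (← read (S.1 p) p)) (← mul 2 a)
        let t ← sub (← sqrt (← add (← mul θ θ) 1)) θ
        let c ← div 1 (← sqrt (← add (← mul t t) 1))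
        let s ← mul t c
        let B ← rotateColumns S.1 p q c s
        let A' ← rotateRows B p q c s
        let Q' ← rotateColumns S.2 p q c s
        pure (A', Q')

/-- `rounds` Jacobi rotations, applied to the symmetric matrix `M`.  The result is a pair `(A, Q)`,
`Q` orthogonal and `A = Qᵀ * M * Q` nearly diagonal: the columns of `Q` are the computed
eigenvectors and the diagonal entries of `A` the computed eigenvalues. -/
def jacobi (idx : List ι) (M : ι → ι → ℝ) (rounds : ℕ) :
    Timed ((ι → ι → ℝ) × (ι → ι → ℝ)) := do
  let one ← table fun i => table fun j => do
    if ← Timed.eq i j then pure (1 : ℝ) else pure 0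
  forEach (List.range rounds) (M, one) fun _ S => jacobiStep idx S

end Jacobi

/-! ## The main algorithm -/

section MainAlgorithm

open Timed

variable {v q : ℕ} [NeZero q]

/-- The labeling `L_x` read off from `x`: the vertex `u` gets the index of the largest entry in the
block `x_u` (the first one, if there are several). -/
def readOff (x : Fin v × Fin q → ℝ) : Timed (Fin v → Fin q) :=
  table fun u => forEach (List.finRange q) 0 fun i best => do
    if ← lt (← read x (u, best)) (← read x (u, i)) then pure i else pure best

/-- The weight of the constraints that `L` satisfies, read from the label-extended graph. -/
def evaluate (M : Fin v × Fin q → Fin v × Fin q → ℝ) (L : Fin v → Fin q) : Timed ℝ :=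
  sum fun u => sum fun u' => do
    read (M (u, ← read L u)) (u', ← read L u')

/-- Compare the labeling read off from `x` with the best labeling found so far. -/
def improve (M : Fin v × Fin q → Fin v × Fin q → ℝ) (x : Fin v × Fin q → ℝ)
    (best : Option ((Fin v → Fin q) × ℝ)) : Timed (Option ((Fin v → Fin q) × ℝ)) := do
  let L ← readOff x
  let val ← evaluate M L
  match best with
  | none => pure (some (L, val))
  | some b => if ← lt b.2 val then pure (some (L, val)) else pure best

/-- Exhaustive search through all the test vectors `x + ∑ α_s w_s` with `α_s ∈ h ℤ` and
`norm² + ∑ α_s² ≤ 1`, where `w_s` are the columns of `Q` whose indices are listed and `x` is the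
part of the sum, of squared norm `norm²`, that has already been fixed. -/
def search (M : Fin v × Fin q → Fin v × Fin q → ℝ) (Q : Fin v × Fin q → Fin v × Fin q → ℝ)
    (h : ℝ) (r : ℕ) : List (Fin v × Fin q) → (Fin v × Fin q → ℝ) → ℝ →
      Option ((Fin v → Fin q) × ℝ) → Timed (Option ((Fin v → Fin q) × ℝ))
  | [], x, _, best => improve M x best
  | s :: rest, x, norm2, best =>
      forEach (List.range (2 * r + 1)) best fun j best' => do
        let α ← mul h (← ofInt ((j : ℤ) - (r : ℤ)))
        let norm2' ← add norm2 (← mul α α)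
        if ← lt 1 norm2' then pure best'
        else do
          let x' ← table fun a => do add (← read x a) (← mul α (← read (Q a) s))
          search M Q h r rest x' norm2' best'

/-- The fraction `1 - K (ε / (γ - 8 ε) + ε)` that the algorithm aims at on instances that are
`(1 - ε)`-satisfiable. -/
def targetFraction (K ε γ : ℝ) : ℝ := 1 - K * (ε / (γ - 8 * ε) + ε)

/-- The spectral algorithm for Unique Games.  Its input is the adjacency matrix `M` of the
label-extended graph of a regular instance with `v` vertices and `q` labels, and the parameters
`ε`, `γ` and `K`.

It computes an eigenbasis of `M` up to an off-diagonal error of at most `ε d / 4`, collects the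
basis vectors with computed eigenvalue above `(1 - γ + ε / 4) d` (by the margin `ε d / 4`, there
are at most as many of these as eigenvalues of `M` that are at least `(1 - γ) d`), goes through the
test vectors `∑ α_s w_s`, `α_s ∈ √(2 ε / (γ D)) ℤ`, of norm at most `1` in their span, `D` being
its dimension, reads off a labeling from each of them, and keeps a labeling that satisfies the most
constraints.  It returns this labeling if it satisfies at least the fraction
`targetFraction K ε γ` of the constraints, and otherwise reports `none`: the instance is not
`(1 - ε)`-satisfiable. -/
def mainAlgorithm (M : Fin v × Fin q → Fin v × Fin q → ℝ) (ε γ K : ℝ) :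
    Timed (Option (Fin v → Fin q)) := do
  let idx := List.finRange v ×ˢ List.finRange q
  -- total weight and degree of the constraint graph
  let total ← div (← sum fun a => sum fun b => read (M a) b) (← ofInt q)
  let d ← div total (← ofInt v)
  -- eigenbasis
  let accuracy ← ceil (← div 4 ε)
  let E ← jacobi idx M ((v * q) ^ 2 * (v * q + accuracy))
  let τ ← mul (← add (← sub 1 γ) (← div ε 4)) d
  let basis ← forEach idx [] fun i l => do
    if ← lt τ (← read (E.1 i) i) then pure (i :: l) else pure l
  -- mesh of the net
  let D ← ofInt (← length basis)
  let h ← sqrt (← div (← mul 2 ε) (← mul γ D))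
  let r ← floor (← div 1 h)
  let zero ← table fun _ => pure (0 : ℝ)
  -- exhaustive search
  match ← search M E.2 h r basis zero 0 none with
  | none => pure none
  | some b => do
      let bound ← sub 1 (← mul K (← add (← div ε (← sub γ (← mul 8 ε))) ε))
      if ← lt b.2 (← mul bound total) then pure none else pure (some b.1)

end MainAlgorithm

end

noncomputable section

/-! ### Cost and invariant rules for timed loops -/

namespace Timed

/-! Completeness. A Jacobi rotation at the largest off-diagonal entry of an `m × m` symmetric matrix
removes a fraction of at least `2 / m²` of the squared off-diagonal norm, so `m² (m + ⌈4/ε⌉)` rounds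
push this norm below `ε d / 4` (`jacobi_spec`, `offDiagSq_computedEigenbasis_le`). The normalized
indicator vector `x` of a labeling that satisfies `1 - ε` of the constraints has Rayleigh quotient
at least `(1 - ε) d`, while no quotient exceeds `d`. Hence `x` has squared mass at most `2ε/γ`
outside the collected vectors, and rounding its coefficients to the net costs at most another `2ε/γ`
(`exists_net_point`). A labeling read off from a point within squared distance `4ε/γ` of `x` differs
from the given one on at most a fraction `8ε/γ` of the vertices (`card_disagree_le`). Each of them
loses at most weight `2d`, and this gives `K = 16` in `mainAlgorithm_complete`.

Khot–Vishnoi. A pair (coset, label) is a point of the cube, and translation by a codeword preserves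
the noise, so the label-extended graph is the noisy cube (`khotVishnoi_labelExtended`), which the
characters diagonalize. A labeling picks one point from every coset, a set of density `1/n`. The
satisfied fraction is the noise stability of this set, and the hypercontractive inequality bounds it
by `n ^ (-ε)` (`khotVishnoi_satisfiesAtMost`). This inequality is tensorized from two points.

Running time and verdict. An eigenvalue `n (1 - 2ε)^|ω|` is at least `(1 - C√ε) n` only if `|ω| ≤
C/√ε`, so there are at most `(C/√ε + 1) n ^ (C/√ε)` of them (`card_eigenvalues_le`). This bounds
`dim W`. It also bounds the number `D` of collected vectors, because the threshold leaves a margin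
for the off-diagonal error (`card_le_of_isJacobiState`). The search is exponential only in `D`, up
to a factor polynomial in `D` and `1/√ε` in the exponent. For `k > 1/ε` every labeling satisfies
less than half of the constraints, whereas the target fraction is at least one half, so the
algorithm rejects. -/

@[simp] theorem bind_val {α β : Type} (x : Timed α) (f : α → Timed β) :
    (x >>= f).val = (f x.val).val := rfl

@[simp] theorem bind_steps {α β : Type} (x : Timed α) (f : α → Timed β) :
    (x >>= f).steps = x.steps + (f x.val).steps := rfl

theorem bind_steps_le {α β : Type} {x : Timed α} {f : α → Timed β} {a b : ℕ}
    (hx : x.steps ≤ a) (hf : ∀ y, (f y).steps ≤ b) : (x >>= f).steps ≤ a + b :=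
  Nat.add_le_add hx (hf _)

/-- Keeping `a + b = n` as a separate equation lets a long chain of binds be counted down from a
prescribed total, as in `jacobiStep_steps_le`. -/
theorem bind_steps_le_add {α β : Type} {x : Timed α} {f : α → Timed β} {a n : ℕ}
    (hx : x.steps ≤ a) (b : ℕ) (hf : ∀ y, (f y).steps ≤ b) (h : a + b = n) :
    (x >>= f).steps ≤ n :=
  (bind_steps_le hx hf).trans_eq h

@[simp] theorem pure_val {α : Type} (a : α) : (pure a : Timed α).val = a := rfl

@[simp] theorem pure_steps {α : Type} (a : α) : (pure a : Timed α).steps = 0 := rfl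

@[simp] theorem ite_val {α : Type} (c : Prop) [Decidable c] (x y : Timed α) :
    (if c then x else y).val = if c then x.val else y.val := apply_ite _ _ _ _

@[simp] theorem ite_steps {α : Type} (c : Prop) [Decidable c] (x y : Timed α) :
    (if c then x else y).steps = if c then x.steps else y.steps := apply_ite _ _ _ _

attribute [simp] Timed.add Timed.sub Timed.mul Timed.div Timed.sqrt Timed.lt Timed.eq Timed.ofInt
  Timed.floor Timed.ceil Timed.length Timed.read Timed.table Timed.sum

theorem forEach_val {ι σ : Type} (l : List ι) (s : σ) (body : ι → σ → Timed σ) :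
    (forEach l s body).val = l.foldl (fun s i => (body i s).val) s := by
  induction l generalizing s with
  | nil => rfl
  | cons i l ih => exact ih _

/-- A property of the part of the list that has been processed and the state is proved by
induction. -/
theorem forEach_induction {ι σ : Type} (P : List ι → σ → Prop) (l : List ι) (s : σ)
    (body : ι → σ → Timed σ) (h0 : P [] s)
    (h1 : ∀ l i s, P l s → P (l ++ [i]) (body i s).val) : P l (forEach l s body).val := by
  rw [forEach_val]
  induction l using List.reverseRecOn with
  | nil => exact h0
  | append_singleton l i ih =>
    rw [List.foldl_concat]
    exact h1 _ _ _ ih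

/-- A loop whose rounds take less than `c` steps as long as an invariant holds. -/
theorem forEach_steps_le_of_invariant {ι σ : Type} (P : σ → Prop) (l : List ι) (s : σ)
    (body : ι → σ → Timed σ) (c : ℕ) (hs : P s)
    (hP : ∀ i ∈ l, ∀ s, P s → P (body i s).val)
    (hc : ∀ i ∈ l, ∀ s, P s → (body i s).steps + 1 ≤ c) :
    (forEach l s body).steps ≤ l.length * c := by
  induction l generalizing s with
  | nil => simp [forEach]
  | cons i l ih =>
    have h1 := hc i (by simp) s hs
    have h2 := ih (body i s).val (hP i (by simp) s hs) (fun j hj => hP j (by simp [hj]))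
      (fun j hj => hc j (by simp [hj]))
    simp only [forEach, bind_steps, List.length_cons]
    rw [add_mul, one_mul]
    omega

theorem forEach_steps_le {ι σ : Type} (l : List ι) (s : σ)
    (body : ι → σ → Timed σ) (c : ℕ) (hc : ∀ i ∈ l, ∀ s, (body i s).steps + 1 ≤ c) :
    (forEach l s body).steps ≤ l.length * c :=
  forEach_steps_le_of_invariant (fun _ => True) l s body c trivial (fun _ _ _ _ => trivial)
    (fun i hi s _ => hc i hi s)

theorem table_steps_le {ι α : Type} [Fintype ι] (f : ι → Timed α) (c : ℕ)
    (hc : ∀ i, (f i).steps + 1 ≤ c) : (table f).steps ≤ Fintype.card ι * c := by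
  simpa [Finset.card_univ] using Finset.sum_le_card_nsmul Finset.univ _ c (fun i _ => hc i)

theorem sum_steps_le {ι : Type} [Fintype ι] (f : ι → Timed ℝ) (c : ℕ)
    (hc : ∀ i, (f i).steps + 1 ≤ c) : (sum f).steps ≤ Fintype.card ι * c := by
  simpa [Finset.card_univ] using Finset.sum_le_card_nsmul Finset.univ _ c (fun i _ => hc i)

end Timed

/-! ### Entries, costs and pivots of Jacobi rotations -/

section Jacobi

open Timed

variable {ι : Type} [Fintype ι] [DecidableEq ι]

theorem rotateColumns_val (A : ι → ι → ℝ) (p q : ι) (c s : ℝ) (i j : ι) :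
    (rotateColumns A p q c s).val i j =
      if j = p then c * A i p - s * A i q else if j = q then s * A i p + c * A i q else A i j := by
  simp [rotateColumns]

theorem rotateRows_val (A : ι → ι → ℝ) (p q : ι) (c s : ℝ) (i j : ι) :
    (rotateRows A p q c s).val i j =
      if i = p then c * A p j - s * A q j else if i = q then s * A p j + c * A q j else A i j := by
  simp [rotateRows]

theorem rotateColumns_steps_le (A : ι → ι → ℝ) (p q : ι) (c s : ℝ) :
    (rotateColumns A p q c s).steps ≤ Fintype.card ι * (Fintype.card ι * 8 + 1) := by
  refine table_steps_le _ _ fun i => Nat.succ_le_succ (table_steps_le _ _ fun j => ?_)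
  simp
  split_ifs <;> simp

theorem rotateRows_steps_le (A : ι → ι → ℝ) (p q : ι) (c s : ℝ) :
    (rotateRows A p q c s).steps ≤ Fintype.card ι * (Fintype.card ι * 8 + 1) := by
  refine table_steps_le _ _ fun i => Nat.succ_le_succ (table_steps_le _ _ fun j => ?_)
  simp
  split_ifs <;> simp

theorem pivot_steps_le {ι : Type} [DecidableEq ι] (idx : List ι) (A : ι → ι → ℝ) :
    (pivot idx A).steps ≤ idx.length * idx.length * 7 := by
  rw [← List.length_product]
  refine forEach_steps_le _ _ _ _ fun e _ best => ?_
  by_cases h : e.1 = e.2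
  · simp [h]
  · cases best with
    | none => simp [h]
    | some b => simp [h]

/-- `b` is an off-diagonal position of a largest entry of `A` among the positions in `l`. -/
def IsPivot {ι : Type} (A : ι → ι → ℝ) (l : List (ι × ι)) : Option (ι × ι) → Prop
  | none => ∀ e ∈ l, e.1 = e.2
  | some b => b.1 ≠ b.2 ∧ ∀ e ∈ l, e.1 ≠ e.2 → A e.1 e.2 ^ 2 ≤ A b.1 b.2 ^ 2

/-- The loop invariant is `IsPivot` on the positions already visited. Squares are compared instead
of absolute values because the algorithm does so. -/
theorem isPivot_pivot {ι : Type} [DecidableEq ι] (idx : List ι) (A : ι → ι → ℝ) :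
    IsPivot A (idx ×ˢ idx) (pivot idx A).val := by
  refine forEach_induction (IsPivot A) _ none _ (by simp [IsPivot]) fun l e o h => ?_
  by_cases he : e.1 = e.2
  · cases o with
    | none => simpa [he, IsPivot, or_imp, forall_and] using h
    | some b =>
      simp only [Timed.eq, bind_val, he, decide_true, if_true, pure_val]
      refine ⟨h.1, fun e' he' hne => ?_⟩
      rcases List.mem_append.1 he' with h' | h'
      · exact h.2 e' h' hne
      · rw [List.mem_singleton.1 h'] at hne
        exact absurd he hne
  · cases o with
    | none =>
      simp only [Timed.eq, bind_val, he, decide_false, Bool.false_eq_true, if_false, pure_val]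
      refine ⟨he, fun e' he' hne => ?_⟩
      rcases List.mem_append.1 he' with h' | h'
      · exact absurd (h e' h') hne
      · rw [List.mem_singleton.1 h']
    | some b =>
      by_cases hlt : A b.1 b.2 * A b.1 b.2 < A e.1 e.2 * A e.1 e.2
      · simp only [Timed.eq, bind_val, he, decide_false, Bool.false_eq_true, if_false, Timed.read, Timed.lt, Timed.mul, hlt,
          decide_true, if_true, pure_val]
        refine ⟨he, fun e' he' hne => ?_⟩
        rcases List.mem_append.1 he' with h' | h'
        · have := h.2 e' h' hne
          change _ ≤ A e.1 e.2 ^ 2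
          nlinarith
        · rw [List.mem_singleton.1 h']
      · simp only [Timed.eq, bind_val, he, decide_false, Bool.false_eq_true, if_false, Timed.read, Timed.lt, Timed.mul, hlt,
          pure_val]
        refine ⟨h.1, fun e' he' hne => ?_⟩
        rcases List.mem_append.1 he' with h' | h'
        · exact h.2 e' h' hne
        · rw [List.mem_singleton.1 h', sq, sq]
          exact not_lt.1 hlt

end Jacobi

/-! ### Convergence of the Jacobi algorithm -/

section Jacobi

open Timed Matrix

variable {ι : Type} [Fintype ι] [DecidableEq ι]

/-- The rotation in the plane of the coordinates `p, q` with cosine `c` and sine `s`. -/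
def planeRotation (p q : ι) (c s : ℝ) : Matrix ι ι ℝ := .of fun i j =>
  if j = p then (if i = p then c else if i = q then -s else 0)
  else if j = q then (if i = p then s else if i = q then c else 0)
  else if i = j then 1 else 0

theorem rotateColumns_eq_mul (A : ι → ι → ℝ) {p q : ι} (hpq : p ≠ q) (c s : ℝ) :
    of (rotateColumns A p q c s).val = of A * planeRotation p q c s := by
  ext i j
  rw [of_apply, rotateColumns_val, Matrix.mul_apply]
  simp only [planeRotation, of_apply]
  by_cases hp : j = p
  · have h : ∀ k, A i k * (if k = p then c else if k = q then -s else 0) =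
        (if k = p then c * A i k else 0) - (if k = q then s * A i k else 0) := by
      intro k
      split_ifs with h1 h2
      · exact absurd (h1.symm.trans h2) hpq
      all_goals ring
    simp [hp, h, Finset.sum_sub_distrib]
  · by_cases hq : j = q
    · have h : ∀ k, A i k * (if k = p then s else if k = q then c else 0) =
          (if k = p then s * A i k else 0) + (if k = q then c * A i k else 0) := by
        intro k
        split_ifs with h1 h2
        · exact absurd (h1.symm.trans h2) hpq
        all_goals ring
      simp [hq, hpq.symm, h, Finset.sum_add_distrib]
    · simp [hp, hq]

theorem rotateRows_eq_mul (A : ι → ι → ℝ) {p q : ι} (hpq : p ≠ q) (c s : ℝ) :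
    of (rotateRows A p q c s).val = (planeRotation p q c s)ᵀ * of A := by
  have h : of (rotateRows A p q c s).val = (of (rotateColumns (fun i j => A j i) p q c s).val)ᵀ := by
    ext i j
    rw [of_apply, rotateRows_val, Matrix.transpose_apply, of_apply, rotateColumns_val]
  rw [h, rotateColumns_eq_mul _ hpq, Matrix.transpose_mul]
  rfl

/-- The rotation itself is fed to `rotateRows`, so the product is known entrywise without expanding
any sums. -/
theorem planeRotation_transpose_mul {p q : ι} (hpq : p ≠ q) {c s : ℝ} (hcs : c ^ 2 + s ^ 2 = 1) :
    (planeRotation p q c s)ᵀ * planeRotation p q c s = 1 := by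
  have h := rotateRows_eq_mul (fun i j => planeRotation p q c s i j) hpq c s
  change _ = _ * planeRotation p q c s at h
  rw [← h]
  ext i j
  rw [of_apply, rotateRows_val, Matrix.one_apply]
  simp only [planeRotation, of_apply]
  by_cases hip : i = p
  · subst hip
    by_cases hjp : j = i
    · subst hjp
      simp [hpq.symm]
      linarith
    · by_cases hjq : j = q
      · subst hjq
        simp [hpq, hpq.symm]
        ring
      · simp [hjp, hjq, Ne.symm hjp, Ne.symm hjq]
  · by_cases hiq : i = q
    · subst hiq
      by_cases hjp : j = p
      · subst hjp
        simp [hpq.symm]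
        ring
      · by_cases hjq : j = i
        · subst hjq
          simp [hpq.symm]
          linarith
        · simp [hjp, hjq, hip, Ne.symm hjp, Ne.symm hjq]
    · by_cases hjp : j = p
      · simp [hip, hiq, hjp]
      · by_cases hjq : j = q
        · simp [hip, hiq, hjq]
        · simp [hip, hiq, hjp, hjq]

/-- The sum of the squares of the off-diagonal entries. -/
def offDiagSq (A : Matrix ι ι ℝ) : ℝ := ∑ i, ∑ j, if i = j then 0 else A i j ^ 2

theorem offDiagSq_nonneg (A : Matrix ι ι ℝ) : 0 ≤ offDiagSq A :=
  Finset.sum_nonneg fun i _ => Finset.sum_nonneg fun j _ => by split_ifs <;> positivity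

/-- The Frobenius norm minus the diagonal. The first term is invariant under orthogonal conjugation
(`trace_conj_sq`), so a rotation need only be followed on the diagonal. -/
theorem offDiagSq_eq (A : Matrix ι ι ℝ) :
    offDiagSq A = (Aᵀ * A).trace - ∑ i, A i i ^ 2 := by
  have h1 : (Aᵀ * A).trace = ∑ i, ∑ j, A i j ^ 2 := by
    simp only [Matrix.trace, Matrix.diag, Matrix.mul_apply, Matrix.transpose_apply, sq]
    exact Finset.sum_comm
  rw [h1, offDiagSq, ← Finset.sum_sub_distrib]
  refine Finset.sum_congr rfl fun i _ => ?_
  have h2 : ∀ j, (if i = j then 0 else A i j ^ 2) = A i j ^ 2 - if i = j then A i j ^ 2 else 0 := by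
    intro j; split_ifs <;> simp
  simp [h2, Finset.sum_sub_distrib]

theorem trace_conj_sq (A J : Matrix ι ι ℝ) (hJ : Jᵀ * J = 1) :
    ((Jᵀ * A * J)ᵀ * (Jᵀ * A * J)).trace = (Aᵀ * A).trace := by
  have hJ' : J * Jᵀ = 1 := mul_eq_one_comm.1 hJ
  have : (Jᵀ * A * J)ᵀ * (Jᵀ * A * J) = Jᵀ * (Aᵀ * A * J) := by
    simp only [Matrix.transpose_mul, Matrix.transpose_transpose, Matrix.mul_assoc]
    rw [← Matrix.mul_assoc J Jᵀ, hJ', Matrix.one_mul]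
  rw [this, Matrix.trace_mul_comm, Matrix.mul_assoc, hJ', Matrix.mul_one]

/-- A rotation that annihilates the entry at `(p, q)` decreases the off-diagonal part. -/
theorem offDiagSq_rotate (A : ι → ι → ℝ) {p q : ι} (hpq : p ≠ q) {c s : ℝ}
    (hsymm : A q p = A p q) (hcs : c ^ 2 + s ^ 2 = 1)
    (h0 : c * s * (A p p - A q q) + (c ^ 2 - s ^ 2) * A p q = 0) :
    offDiagSq ((planeRotation p q c s)ᵀ * of A * planeRotation p q c s) =
      offDiagSq (of A) - 2 * A p q ^ 2 := by
  rw [offDiagSq_eq, offDiagSq_eq, trace_conj_sq _ _ (planeRotation_transpose_mul hpq hcs)]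
  have hd : ∀ i, ((planeRotation p q c s)ᵀ * of A * planeRotation p q c s) i i ^ 2 = A i i ^ 2 +
      (if i = p then (c ^ 2 * A p p - 2 * c * s * A p q + s ^ 2 * A q q) ^ 2 - A p p ^ 2 else 0) +
      (if i = q then (s ^ 2 * A p p + 2 * c * s * A p q + c ^ 2 * A q q) ^ 2 - A q q ^ 2
        else 0) := by
    intro i
    rw [← rotateRows_eq_mul _ hpq, ← rotateColumns_eq_mul _ hpq, of_apply, rotateColumns_val,
      rotateRows_val, rotateRows_val, rotateRows_val]
    by_cases hp : i = p
    · subst hp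
      simp only [if_true, hpq, if_false, hsymm]
      ring
    · by_cases hq : i = q
      · subst hq
        simp only [if_true, hp, if_false, hsymm]
        ring
      · simp [hp, hq]
  simp only [hd, of_apply, Finset.sum_add_distrib, Finset.sum_ite_eq', Finset.mem_univ, if_true]
  -- The Frobenius norm of the 2 × 2 block at `p, q` is invariant. The last square is the new entry
  -- at `(p, q)`; as it vanishes, the diagonal gains `2 * A p q ^ 2`.
  have e1 : (c ^ 2 * A p p - 2 * c * s * A p q + s ^ 2 * A q q) ^ 2 +
      (s ^ 2 * A p p + 2 * c * s * A p q + c ^ 2 * A q q) ^ 2 +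
      2 * (c * s * (A p p - A q q) + (c ^ 2 - s ^ 2) * A p q) ^ 2 =
      (c ^ 2 + s ^ 2) ^ 2 * (A p p ^ 2 + A q q ^ 2 + 2 * A p q ^ 2) := by ring
  rw [h0, hcs] at e1
  linarith

/-- `t` is the tangent of the rotation angle, a root of `t² + 2θt - 1 = 0`. Either root annihilates
the entry; the larger or smaller one makes no difference to the decrease of the off-diagonal part.
-/
theorem rotation_parameters (a b x θ t c s : ℝ) (hx : x ≠ 0) (hθ : θ = (b - a) / (2 * x))
    (ht : t = Real.sqrt (θ * θ + 1) - θ) (hc : c = 1 / Real.sqrt (t * t + 1)) (hs : s = t * c) :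
    c ^ 2 + s ^ 2 = 1 ∧ c * s * (a - b) + (c ^ 2 - s ^ 2) * x = 0 := by
  have h1 : c ^ 2 * (t * t + 1) = 1 := by
    have hp : 0 < t * t + 1 := by nlinarith [mul_self_nonneg t]
    rw [hc, div_pow, Real.sq_sqrt hp.le, one_pow, one_div, inv_mul_cancel₀ hp.ne']
  have h2 : (t + θ) ^ 2 = θ * θ + 1 := by
    rw [ht, sub_add_cancel, Real.sq_sqrt (by nlinarith [mul_self_nonneg θ])]
  have h3 : 2 * x * θ = b - a := by rw [hθ]; field_simp
  refine ⟨by rw [hs]; linear_combination h1, ?_⟩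
  rw [hs]
  linear_combination (-c ^ 2 * x) * h2 + (c ^ 2 * t) * h3

/-- The state `(A, Q)` of the Jacobi algorithm: `Q` is orthogonal and `A = Qᵀ * M * Q`. -/
def IsJacobiState (M : Matrix ι ι ℝ) (S : (ι → ι → ℝ) × (ι → ι → ℝ)) : Prop :=
  (of S.2)ᵀ * of S.2 = 1 ∧ of S.1 = (of S.2)ᵀ * M * of S.2

/-- At most `card ι ^ 2` entries are off the diagonal and none exceeds the pivot in absolute value,
so removing the pivot removes at least the fraction `2 / card ι ^ 2`. The factor is written as an
exponential so that rounds add up in the exponent. -/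
theorem jacobiStep_spec {M : Matrix ι ι ℝ} (hM : Mᵀ = M) {idx : List ι} (hidx : ∀ i, i ∈ idx)
    {S : (ι → ι → ℝ) × (ι → ι → ℝ)} (hS : IsJacobiState M S) :
    IsJacobiState M (jacobiStep idx S).val ∧
      offDiagSq (of (jacobiStep idx S).val.1) ≤
        offDiagSq (of S.1) * Real.exp (-(2 / (Fintype.card ι : ℝ) ^ 2)) := by
  obtain ⟨A, Q⟩ := S
  obtain ⟨hQ, hA⟩ := hS
  have hpiv := isPivot_pivot idx A
  have hzero : offDiagSq (of A) = 0 →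
      offDiagSq (of A) ≤ offDiagSq (of A) * Real.exp (-(2 / (Fintype.card ι : ℝ) ^ 2)) := by
    intro h; simp [h]
  have hmem : ∀ i j, (i, j) ∈ idx ×ˢ idx := fun i j => List.mem_product.2 ⟨hidx i, hidx j⟩
  have hsymm : ∀ i j, A i j = A j i := by
    intro i j
    have : (of A)ᵀ = of A := by
      rw [hA]; simp [Matrix.transpose_mul, hM, Matrix.mul_assoc]
    exact (congrFun (congrFun this j) i)
  unfold jacobiStep
  rw [bind_val]
  generalize (pivot idx A).val = o at hpiv
  match o, hpiv with
  | none, h =>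
    refine ⟨⟨hQ, hA⟩, hzero ?_⟩
    refine Finset.sum_eq_zero fun i _ => Finset.sum_eq_zero fun j _ => ?_
    rw [if_pos (h (i, j) (hmem i j))]
  | some (p, q), ⟨hpq, hmax⟩ =>
    simp only at hpq hmax
    have hoff : offDiagSq (of A) ≤ (Fintype.card ι : ℝ) ^ 2 * A p q ^ 2 := by
      have h1 : offDiagSq (of A) ≤ ∑ i : ι, ∑ j : ι, A p q ^ 2 := by
        refine Finset.sum_le_sum fun i _ => Finset.sum_le_sum fun j _ => ?_
        split_ifs with hij
        · positivity
        · exact hmax (i, j) (hmem i j) hij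
      simpa [sq, mul_assoc] using h1
    by_cases ha : A p q = 0
    · simp only [Timed.read, bind_val, Timed.eq, ha, decide_true, if_true, pure_val]
      refine ⟨⟨hQ, hA⟩, hzero (le_antisymm ?_ (offDiagSq_nonneg _))⟩
      simpa [ha] using hoff
    · simp only [Timed.read, bind_val, Timed.eq, ha, decide_false, Bool.false_eq_true, if_false,
        pure_val, Timed.div, Timed.sub, Timed.mul, Timed.sqrt, Timed.add]
      obtain ⟨hcs, h0⟩ := rotation_parameters (A p p) (A q q) (A p q) _ _ _ _ ha rfl rfl rfl rfl
      generalize 1 / Real.sqrt _ = c at hcs h0 ⊢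
      generalize _ * c = s at hcs h0 ⊢
      have eJ := planeRotation_transpose_mul hpq hcs
      refine ⟨⟨?_, ?_⟩, ?_⟩
      · rw [rotateColumns_eq_mul Q hpq, Matrix.transpose_mul, Matrix.mul_assoc,
          ← Matrix.mul_assoc (of Q)ᵀ]
        rw [show (of Q)ᵀ * of Q = 1 from hQ, Matrix.one_mul, eJ]
      · rw [rotateRows_eq_mul _ hpq, rotateColumns_eq_mul A hpq, rotateColumns_eq_mul Q hpq,
          show of A = (of Q)ᵀ * M * of Q from hA]
        simp only [Matrix.transpose_mul, Matrix.mul_assoc]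
      · have h2 := offDiagSq_rotate A hpq (hsymm q p) hcs h0
        rw [rotateRows_eq_mul _ hpq, rotateColumns_eq_mul A hpq, ← Matrix.mul_assoc, h2]
        have h3 := Real.add_one_le_exp (-(2 / (Fintype.card ι : ℝ) ^ 2))
        have h4 : offDiagSq (of A) * (2 / (Fintype.card ι : ℝ) ^ 2) ≤ 2 * A p q ^ 2 := by
          have : Nonempty ι := ⟨p⟩
          have : 0 < (Fintype.card ι : ℝ) ^ 2 := by
            have := Fintype.card_pos (α := ι)
            positivity
          rw [mul_div_assoc', div_le_iff₀ this]
          linarith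
        have h5 := mul_le_mul_of_nonneg_left h3 (offDiagSq_nonneg (of A))
        linarith

theorem jacobi_spec {M : ι → ι → ℝ} (hM : (of M)ᵀ = of M) {idx : List ι} (hidx : ∀ i, i ∈ idx)
    (rounds : ℕ) :
    IsJacobiState (of M) (jacobi idx M rounds).val ∧
      offDiagSq (of (jacobi idx M rounds).val.1) ≤
        offDiagSq (of M) * Real.exp (-(2 / (Fintype.card ι : ℝ) ^ 2) * rounds) := by
  unfold jacobi
  rw [bind_val]
  have hone : (table fun i : ι => table fun j : ι => do
      if ← Timed.eq i j then pure (1 : ℝ) else pure 0).val = fun i j => (1 : Matrix ι ι ℝ) i j := by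
    ext i j
    simp [Matrix.one_apply]
  rw [hone]
  have key := forEach_induction
    (fun l S => IsJacobiState (of M) S ∧ offDiagSq (of S.1) ≤
        offDiagSq (of M) * Real.exp (-(2 / (Fintype.card ι : ℝ) ^ 2) * l.length))
    (List.range rounds) (M, fun i j => (1 : Matrix ι ι ℝ) i j) (fun _ S => jacobiStep idx S) ?_ ?_
  · rwa [List.length_range] at key
  · refine ⟨⟨?_, ?_⟩, ?_⟩
    · exact (by simp : (1 : Matrix ι ι ℝ)ᵀ * 1 = 1)
    · exact (by simp : of M = (1 : Matrix ι ι ℝ)ᵀ * of M * 1)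
    · rw [List.length_nil, Nat.cast_zero, mul_zero, Real.exp_zero, mul_one]
  · rintro l i S ⟨h1, h2⟩
    obtain ⟨h3, h4⟩ := jacobiStep_spec hM hidx h1
    refine ⟨h3, h4.trans ((mul_le_mul_of_nonneg_right h2 (Real.exp_nonneg _)).trans_eq ?_)⟩
    rw [mul_assoc, ← Real.exp_add]
    congr 2
    push_cast [List.length_append, List.length_singleton]
    ring

theorem jacobiStep_steps_le (idx : List ι) (hidx : idx.length = Fintype.card ι)
    (S : (ι → ι → ℝ) × (ι → ι → ℝ)) :
    (jacobiStep idx S).steps ≤ 34 * Fintype.card ι ^ 2 + 17 := by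
  have h0 := pivot_steps_le idx S.1
  rw [hidx] at h0
  unfold jacobiStep
  rw [bind_steps]
  generalize (pivot idx S.1).val = o
  match o with
  | none =>
    simp only [pure_steps]
    nlinarith
  | some (p, q) =>
    have h1 := fun A c s => rotateColumns_steps_le (ι := ι) A p q c s
    have h2 := fun A c s => rotateRows_steps_le (ι := ι) A p q c s
    refine (Nat.add_le_add h0 (bind_steps_le (a := 1) (b := 16 + 3 * (Fintype.card ι *
      (Fintype.card ι * 8 + 1))) le_rfl fun a => ?_)).trans ?_
    · generalize Fintype.card ι * (Fintype.card ι * 8 + 1) = R at h1 h2 ⊢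
      refine bind_steps_le_add (a := 1) le_rfl (15 + 3 * R) (fun e => ?_) (by ring)
      rw [ite_steps]
      split_ifs
      · exact Nat.zero_le _
      · refine le_trans (b := 14 + 3 * R) ?_ (by omega)
        refine bind_steps_le_add (a := 1) le_rfl (13 + 3 * R) (fun _ => ?_) (by ring)
        refine bind_steps_le_add (a := 1) le_rfl (12 + 3 * R) (fun _ => ?_) (by ring)
        refine bind_steps_le_add (a := 1) le_rfl (11 + 3 * R) (fun _ => ?_) (by ring)
        refine bind_steps_le_add (a := 1) le_rfl (10 + 3 * R) (fun _ => ?_) (by ring)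
        refine bind_steps_le_add (a := 1) le_rfl (9 + 3 * R) (fun _ => ?_) (by ring)
        refine bind_steps_le_add (a := 1) le_rfl (8 + 3 * R) (fun _ => ?_) (by ring)
        refine bind_steps_le_add (a := 1) le_rfl (7 + 3 * R) (fun _ => ?_) (by ring)
        refine bind_steps_le_add (a := 1) le_rfl (6 + 3 * R) (fun _ => ?_) (by ring)
        refine bind_steps_le_add (a := 1) le_rfl (5 + 3 * R) (fun _ => ?_) (by ring)
        refine bind_steps_le_add (a := 1) le_rfl (4 + 3 * R) (fun _ => ?_) (by ring)
        refine bind_steps_le_add (a := 1) le_rfl (3 + 3 * R) (fun _ => ?_) (by ring)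
        refine bind_steps_le_add (a := 1) le_rfl (2 + 3 * R) (fun _ => ?_) (by ring)
        refine bind_steps_le_add (a := 1) le_rfl (1 + 3 * R) (fun _ => ?_) (by ring)
        refine bind_steps_le_add (a := 1) le_rfl (0 + 3 * R) (fun _ => ?_) (by ring)
        refine bind_steps_le_add (h1 _ _ _) (2 * R) (fun _ => ?_) (by ring)
        refine bind_steps_le_add (h2 _ _ _) R (fun _ => ?_) (by ring)
        exact bind_steps_le_add (h1 _ _ _) 0 (fun _ => le_rfl) (by ring)
    · nlinarith [Nat.le_self_pow (two_ne_zero) (Fintype.card ι)]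

theorem jacobi_steps_le (idx : List ι) (hidx : idx.length = Fintype.card ι)
    (M : ι → ι → ℝ) (rounds : ℕ) :
    (jacobi idx M rounds).steps ≤
      Fintype.card ι * (Fintype.card ι * 2 + 1) + rounds * (34 * Fintype.card ι ^ 2 + 18) := by
  unfold jacobi
  rw [bind_steps]
  refine Nat.add_le_add (table_steps_le _ _ fun i => Nat.succ_le_succ (table_steps_le _ _
    fun j => by simp)) ?_
  refine (forEach_steps_le _ _ _ _ fun i _ S =>
    Nat.succ_le_succ (jacobiStep_steps_le idx hidx S)).trans ?_
  rw [List.length_range]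

end Jacobi

/-! ### Invariants of loops, once established -/

namespace Timed

/-- A property that one round of a loop establishes and all rounds preserve holds at the end. -/
theorem forEach_of_mem {ι σ : Type} {P : σ → Prop} {l : List ι} {s : σ}
    {body : ι → σ → Timed σ} {i : ι} (hi : i ∈ l) (h0 : ∀ s, P (body i s).val)
    (h1 : ∀ j s, P s → P (body j s).val) : P (forEach l s body).val := by
  have h := forEach_induction (fun l s => i ∈ l → P s) l s body (by simp) fun l j s h hm => ?_
  · exact h hi
  · rcases List.mem_append.1 hm with h' | h'
    · exact h1 _ _ (h h')
    · rw [← List.mem_singleton.1 h']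
      exact h0 s

theorem forEach_preserves {ι σ : Type} {P : σ → Prop} {l : List ι} {s : σ}
    {body : ι → σ → Timed σ} (h0 : P s) (h1 : ∀ j s, P s → P (body j s).val) :
    P (forEach l s body).val :=
  forEach_induction (fun _ s => P s) l s body h0 fun _ _ _ h => h1 _ _ h

end Timed

/-! ### Correctness of the exhaustive search and stages of the algorithm -/

section MainAlgorithm

open Timed

variable {v q : ℕ} [NeZero q]

theorem readOff_spec (x : Fin v × Fin q → ℝ) (u : Fin v) (i : Fin q) :
    x (u, i) ≤ x (u, (readOff x).val u) := by
  have h := forEach_induction (fun l best => ∀ i ∈ l, x (u, i) ≤ x (u, best))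
    (List.finRange q) 0 (fun i best => do
      if ← lt (← read x (u, best)) (← read x (u, i)) then pure i else pure best) (by simp) ?_
  · exact h i (List.mem_finRange i)
  · intro l i best h j hj
    simp only [Timed.lt, Timed.read, bind_val, decide_eq_true_eq, ite_val, pure_val]
    split_ifs with hlt
    · rcases List.mem_append.1 hj with h' | h'
      · exact (h j h').trans hlt.le
      · rw [List.mem_singleton.1 h']
    · rcases List.mem_append.1 hj with h' | h'
      · exact h j h'
      · rw [List.mem_singleton.1 h']
        exact not_lt.1 hlt

theorem evaluate_val {v q : ℕ} (M : Fin v × Fin q → Fin v × Fin q → ℝ) (L : Fin v → Fin q) :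
    (evaluate M L).val = ∑ u, ∑ u', M (u, L u) (u', L u') := rfl

/-- The stored weight is the one of the stored labeling. -/
def IsEvaluated (M : Fin v × Fin q → Fin v × Fin q → ℝ) (o : Option ((Fin v → Fin q) × ℝ)) :
    Prop :=
  ∀ b ∈ o, b.2 = (evaluate M b.1).val

/-- The stored weight is at least `t`. -/
def StoresAtLeast (t : ℝ) (o : Option ((Fin v → Fin q) × ℝ)) : Prop := ∃ b ∈ o, t ≤ b.2

theorem isEvaluated_improve {M : Fin v × Fin q → Fin v × Fin q → ℝ} (x : Fin v × Fin q → ℝ)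
    {o : Option ((Fin v → Fin q) × ℝ)} (h : IsEvaluated M o) :
    IsEvaluated M (improve M x o).val := by
  have h1 : IsEvaluated M (some ((readOff x).val, (evaluate M (readOff x).val).val)) := by
    rintro b hb
    cases hb
    rfl
  match o, h with
  | none, h => exact h1
  | some b, h =>
    simp only [improve, bind_val, Timed.lt, decide_eq_true_eq, ite_val, pure_val]
    split_ifs
    · exact h1
    · exact h

theorem storesAtLeast_improve {M : Fin v × Fin q → Fin v × Fin q → ℝ} (x : Fin v × Fin q → ℝ)
    {o : Option ((Fin v → Fin q) × ℝ)} {t : ℝ}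
    (h : StoresAtLeast t o ∨ t ≤ (evaluate M (readOff x).val).val) :
    StoresAtLeast t (improve M x o).val := by
  match o, h with
  | none, h =>
    rcases h with ⟨b, hb, _⟩ | h
    · cases hb
    · exact ⟨_, rfl, h⟩
  | some b, h =>
    simp only [improve, bind_val, Timed.lt, decide_eq_true_eq, ite_val, pure_val]
    split_ifs with hlt
    · refine ⟨_, rfl, ?_⟩
      rcases h with ⟨b', hb, h⟩ | h
      · cases hb
        exact h.trans hlt.le
      · exact h
    · refine ⟨_, rfl, ?_⟩
      rcases h with ⟨b', hb, h⟩ | h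
      · cases hb
        exact h
      · exact h.trans (not_lt.1 hlt)

/-- The search alters its state only through `improve`. It is applied to `IsEvaluated` and, for
rounds after the good one, to `StoresAtLeast`. -/
theorem search_preserves {P : Option ((Fin v → Fin q) × ℝ) → Prop}
    {M : Fin v × Fin q → Fin v × Fin q → ℝ} (hP : ∀ x o, P o → P (improve M x o).val)
    (Q : Fin v × Fin q → Fin v × Fin q → ℝ) (h : ℝ) (r : ℕ) (l : List (Fin v × Fin q))
    (x : Fin v × Fin q → ℝ) (norm2 : ℝ) (o : Option ((Fin v → Fin q) × ℝ)) (ho : P o) :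
    P (search M Q h r l x norm2 o).val := by
  induction l generalizing x norm2 o with
  | nil => exact hP x o ho
  | cons s l ih =>
    refine forEach_preserves ho fun j o ho => ?_
    simp only [bind_val, ite_val]
    split_ifs
    · exact ho
    · exact ih _ _ _ ho

/-- The loops meet every coefficient vector with entries in `[-r, r]`. Partial squared norms never
exceed the full one, so the test on the norm does not prune the branch that leads to `m`. -/
theorem storesAtLeast_search (M Q : Fin v × Fin q → Fin v × Fin q → ℝ) (h : ℝ) (r : ℕ)
    (m : Fin v × Fin q → ℤ) (l : List (Fin v × Fin q)) (x : Fin v × Fin q → ℝ) (norm2 : ℝ)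
    (o : Option ((Fin v → Fin q) × ℝ)) (hm : ∀ s ∈ l, |m s| ≤ r)
    (hn : norm2 + (l.map fun s => (h * m s) ^ 2).sum ≤ 1) :
    StoresAtLeast
      (evaluate M (readOff fun a => x a + (l.map fun s => h * m s * Q a s).sum).val).val
      (search M Q h r l x norm2 o).val := by
  induction l generalizing x norm2 o with
  | nil => exact storesAtLeast_improve _ (Or.inr (by simp))
  | cons s l ih =>
    have hms := abs_le.1 (hm s (by simp))
    -- The counter `j` stands for the coefficient `j - r`.
    have hj : (m s + r).toNat ∈ List.range (2 * r + 1) := by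
      rw [List.mem_range]; omega
    have hj' : (((m s + r).toNat : ℤ) - (r : ℤ)) = m s := by omega
    refine forEach_of_mem hj (fun o => ?_) fun j o ho => ?_
    · simp only [bind_val, Timed.ofInt, Timed.mul, Timed.add, Timed.lt, hj', ite_val,
        decide_eq_true_eq]
      simp only [List.map_cons, List.sum_cons] at hn
      have hnn : 0 ≤ (l.map fun s => (h * (m s : ℝ)) ^ 2).sum :=
        List.sum_nonneg (by simp only [List.mem_map]; rintro _ ⟨a, _, rfl⟩; positivity)
      rw [if_neg (by nlinarith)]
      convert ih _ _ o (fun s hs => hm s (by simp [hs])) ?_ using 1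
      · refine congrArg (fun y => (evaluate M (readOff y).val).val) (funext fun a => ?_)
        simp only [Timed.table, Timed.read, bind_val, List.map_cons, List.sum_cons]
        ring
      · nlinarith
    · simp only [bind_val, ite_val]
      split_ifs
      · exact ho
      · exact search_preserves (fun x o ho => storesAtLeast_improve x (Or.inl ho)) _ _ _ _ _ _ _ ho

/-- All the positions, in the order in which the algorithm enumerates them. -/
def allPositions (v q : ℕ) : List (Fin v × Fin q) := List.finRange v ×ˢ List.finRange q

theorem mem_allPositions {v q : ℕ} (i : Fin v × Fin q) : i ∈ allPositions v q :=
  List.mem_product.2 ⟨List.mem_finRange _, List.mem_finRange _⟩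

theorem nodup_allPositions {v q : ℕ} : (allPositions v q).Nodup :=
  (List.nodup_finRange v).product (List.nodup_finRange q)

theorem length_allPositions {v q : ℕ} : (allPositions v q).length = Fintype.card (Fin v × Fin q) := by
  rw [allPositions, List.length_product]
  simp

/-- The total weight of the constraints, as it is computed by the algorithm. -/
def computedTotal (M : Fin v × Fin q → Fin v × Fin q → ℝ) : ℝ :=
  (∑ a, ∑ b, M a b) / ((q : ℤ) : ℝ)

/-- The eigenvectors and eigenvalues computed by the algorithm. -/
def computedEigenbasis (M : Fin v × Fin q → Fin v × Fin q → ℝ) (ε : ℝ) :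
    (Fin v × Fin q → Fin v × Fin q → ℝ) × (Fin v × Fin q → Fin v × Fin q → ℝ) :=
  (jacobi (allPositions v q) M ((v * q) ^ 2 * (v * q + ⌈4 / ε⌉₊))).val

/-- The threshold for the computed eigenvalues. -/
def eigenvalueThreshold (M : Fin v × Fin q → Fin v × Fin q → ℝ) (ε γ : ℝ) : ℝ :=
  (1 - γ + ε / 4) * (computedTotal M / ((v : ℤ) : ℝ))

/-- Collect the indices of the diagonal entries above `τ`. -/
def collectAbove {v q : ℕ} (A : Fin v × Fin q → Fin v × Fin q → ℝ) (τ : ℝ)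
    (l : List (Fin v × Fin q)) : Timed (List (Fin v × Fin q)) :=
  forEach l [] fun i l => do
    if ← lt τ (← read (A i) i) then pure (i :: l) else pure l

theorem collectAbove_val {v q : ℕ} (A : Fin v × Fin q → Fin v × Fin q → ℝ) (τ : ℝ)
    (l : List (Fin v × Fin q)) :
    (collectAbove A τ l).val = (l.filter fun i => τ < A i i).reverse := by
  refine forEach_induction (fun l b => b = (l.filter fun i => τ < A i i).reverse) l [] _ rfl ?_
  rintro l i s rfl
  simp only [Timed.lt, Timed.read, bind_val, decide_eq_true_eq, ite_val, pure_val,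
    List.filter_append, List.filter_singleton]
  by_cases h : τ < A i i <;> simp [h]

/-- The indices of the basis vectors that the algorithm collects. -/
def collectedBasis (M : Fin v × Fin q → Fin v × Fin q → ℝ) (ε γ : ℝ) : List (Fin v × Fin q) :=
  (collectAbove (computedEigenbasis M ε).1 (eigenvalueThreshold M ε γ) (allPositions v q)).val

/-- The mesh of the net of test vectors. -/
def netMesh (M : Fin v × Fin q → Fin v × Fin q → ℝ) (ε γ : ℝ) : ℝ :=
  Real.sqrt (2 * ε / (γ * (((collectedBasis M ε γ).length : ℤ) : ℝ)))

/-- The outcome of the exhaustive search. -/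
def searchOutcome (M : Fin v × Fin q → Fin v × Fin q → ℝ) (ε γ : ℝ) :
    Timed (Option ((Fin v → Fin q) × ℝ)) :=
  search M (computedEigenbasis M ε).2 (netMesh M ε γ) ⌊1 / netMesh M ε γ⌋₊
    (collectedBasis M ε γ) (fun _ => 0) 0 none

theorem mainAlgorithm_val (M : Fin v × Fin q → Fin v × Fin q → ℝ) (ε γ K : ℝ) :
    (mainAlgorithm M ε γ K).val = (searchOutcome M ε γ).val.bind fun b =>
      if b.2 < targetFraction K ε γ * computedTotal M then none else some b.1 := by
  unfold mainAlgorithm searchOutcome netMesh collectedBasis eigenvalueThreshold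
    computedEigenbasis computedTotal allPositions collectAbove
  simp only [bind_val, Timed.sum, Timed.read, Timed.div, Timed.ofInt, Timed.ceil, Timed.mul,
    Timed.add, Timed.sub, Timed.length, Timed.sqrt, Timed.floor, Timed.table, pure_val]
  generalize (search (v := v) (q := q) _ _ _ _ _ _ _ _).val = o
  cases o with
  | none => rfl
  | some b =>
    simp only [Timed.lt, bind_val, decide_eq_true_eq, ite_val, pure_val]
    rfl

theorem nodup_collectedBasis {v q : ℕ} (M : Fin v × Fin q → Fin v × Fin q → ℝ) (ε γ : ℝ) :
    (collectedBasis M ε γ).Nodup := by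
  rw [collectedBasis, collectAbove_val, List.nodup_reverse]
  exact nodup_allPositions.filter _

theorem mem_collectedBasis {v q : ℕ} (M : Fin v × Fin q → Fin v × Fin q → ℝ) (ε γ : ℝ)
    (i : Fin v × Fin q) :
    i ∈ collectedBasis M ε γ ↔ eigenvalueThreshold M ε γ < (computedEigenbasis M ε).1 i i := by
  simp [collectedBasis, collectAbove_val, mem_allPositions]

end MainAlgorithm

/-! ### From a large Rayleigh quotient to a nearby net point -/

section SpectralRounding

open Matrix

variable {ι : Type} [Fintype ι] [DecidableEq ι]

/-- A matrix with small off-diagonal part has nearly the quadratic form of its diagonal. -/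
theorem abs_quadraticForm_sub_diag_le (A : Matrix ι ι ℝ) {e : ℝ} (he : 0 ≤ e)
    (hA : offDiagSq A ≤ e ^ 2) (c : ι → ℝ) :
    |c ⬝ᵥ A *ᵥ c - ∑ i, A i i * c i ^ 2| ≤ e * (c ⬝ᵥ c) := by
  have h1 : c ⬝ᵥ A *ᵥ c - ∑ i, A i i * c i ^ 2 =
      ∑ p : ι × ι, (if p.1 = p.2 then 0 else A p.1 p.2) * (c p.1 * c p.2) := by
    rw [Fintype.sum_prod_type, dotProduct, ← Finset.sum_sub_distrib]
    refine Finset.sum_congr rfl fun i _ => ?_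
    have h2 : ∀ j, (if i = j then 0 else A i j) * (c i * c j) =
        c i * (A i j * c j) - if i = j then A i j * (c i * c j) else 0 := by
      intro j; split_ifs <;> ring
    simp only [h2, Finset.sum_sub_distrib, mulVec, dotProduct, Finset.mul_sum,
      Finset.sum_ite_eq, Finset.mem_univ, if_true]
    ring
  -- Cauchy–Schwarz over pairs of indices: the off-diagonal form is at most the off-diagonal
  -- Frobenius norm times the norm of the matrix `c i * c j`.
  have h3 := Finset.sum_mul_sq_le_sq_mul_sq Finset.univ
    (fun p : ι × ι => if p.1 = p.2 then 0 else A p.1 p.2) (fun p => c p.1 * c p.2)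
  have h4 : ∑ p : ι × ι, (if p.1 = p.2 then 0 else A p.1 p.2) ^ 2 = offDiagSq A := by
    rw [Fintype.sum_prod_type, offDiagSq]
    refine Finset.sum_congr rfl fun i _ => Finset.sum_congr rfl fun j _ => ?_
    split_ifs <;> simp
  have h5 : ∑ p : ι × ι, (c p.1 * c p.2) ^ 2 = (c ⬝ᵥ c) ^ 2 := by
    rw [Fintype.sum_prod_type, dotProduct, sq (Finset.sum _ _), Finset.sum_mul_sum]
    refine Finset.sum_congr rfl fun i _ => Finset.sum_congr rfl fun j _ => by ring
  have hcc : 0 ≤ c ⬝ᵥ c := Finset.sum_nonneg fun i _ => mul_self_nonneg _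
  rw [h1]
  refine abs_le_of_sq_le_sq (h3.trans ?_) (mul_nonneg he hcc)
  rw [h4, h5, mul_pow]
  exact mul_le_mul_of_nonneg_right hA (sq_nonneg _)

/-- Apply `2 x_a x_b ≤ x_a² + x_b²` under the nonnegative weights; by symmetry, both squares sum to
`d` times the squared norm. -/
theorem quadraticForm_le_of_rowSum {ι : Type} [Fintype ι] {M : Matrix ι ι ℝ} {d : ℝ} (hM : Mᵀ = M)
    (hnn : ∀ a b, 0 ≤ M a b) (hrow : ∀ a, ∑ b, M a b = d) (x : ι → ℝ) :
    x ⬝ᵥ M *ᵥ x ≤ d * (x ⬝ᵥ x) := by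
  have hs : ∀ a b, M b a = M a b := fun a b => congrFun (congrFun hM a) b
  have h1 : ∑ a, ∑ b, M a b * x a ^ 2 = d * (x ⬝ᵥ x) := by
    simp only [← Finset.sum_mul, hrow, dotProduct, Finset.mul_sum]
    exact Finset.sum_congr rfl fun _ _ => by ring
  have h2 : ∑ a, ∑ b, M a b * x b ^ 2 = d * (x ⬝ᵥ x) := by
    rw [Finset.sum_comm, ← h1]
    exact Finset.sum_congr rfl fun a _ => Finset.sum_congr rfl fun b _ => by rw [hs]
  have h3 : x ⬝ᵥ M *ᵥ x ≤ ∑ a, ∑ b, (M a b * x a ^ 2 + M a b * x b ^ 2) / 2 := by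
    simp only [dotProduct, mulVec, Finset.mul_sum]
    refine Finset.sum_le_sum fun a _ => Finset.sum_le_sum fun b _ => ?_
    nlinarith [mul_nonneg (hnn a b) (sq_nonneg (x a - x b))]
  simp only [← Finset.sum_div, Finset.sum_add_distrib, h1, h2] at h3
  linarith

/-- The sum of squares of a nonnegative row is at most the square of its sum. This is the initial
off-diagonal norm for the Jacobi algorithm. -/
theorem offDiagSq_le_of_rowSum {M : Matrix ι ι ℝ} {d : ℝ}
    (hnn : ∀ a b, 0 ≤ M a b) (hrow : ∀ a, ∑ b, M a b = d) :
    offDiagSq M ≤ Fintype.card ι * d ^ 2 := by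
  have h : ∀ a, (∑ b, if a = b then 0 else M a b ^ 2) ≤ d ^ 2 := by
    intro a
    rw [← hrow a]
    refine le_trans (Finset.sum_le_sum fun b _ => ?_)
      (Finset.sum_sq_le_sq_sum_of_nonneg fun b _ => hnn a b)
    split_ifs
    · exact sq_nonneg _
    · exact le_rfl
  exact (Finset.sum_le_card_nsmul _ _ _ fun a _ => h a).trans_eq (by simp)

theorem dotProduct_mulVec_of_orthogonal {Q : Matrix ι ι ℝ} (hQ : Qᵀ * Q = 1) (c : ι → ℝ) :
    (Q *ᵥ c) ⬝ᵥ (Q *ᵥ c) = c ⬝ᵥ c := by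
  rw [dotProduct_mulVec, ← mulVec_transpose, mulVec_mulVec, hQ, one_mulVec]

theorem quadraticForm_mulVec {ι : Type} [Fintype ι] (M Q : Matrix ι ι ℝ) (c : ι → ℝ) :
    (Q *ᵥ c) ⬝ᵥ M *ᵥ (Q *ᵥ c) = c ⬝ᵥ (Qᵀ * M * Q) *ᵥ c := by
  rw [dotProduct_comm, dotProduct_mulVec, ← mulVec_transpose, mulVec_mulVec, mulVec_mulVec,
    dotProduct_comm, Matrix.mul_assoc]

/-- Rounding towards zero to a multiple of `h`. -/
theorem exists_round {h : ℝ} (hh : 0 < h) (c : ℝ) :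
    ∃ m : ℤ, |h * m| ≤ |c| ∧ |c - h * m| ≤ h := by
  have key : ∀ c : ℝ, 0 ≤ c → ∃ m : ℤ, |h * m| ≤ |c| ∧ |c - h * m| ≤ h := by
    intro c hc
    have h0 : 0 ≤ c / h := by positivity
    have h1 := Int.floor_le (c / h)
    have h2 := Int.lt_floor_add_one (c / h)
    have h3 : (0 : ℝ) ≤ ⌊c / h⌋ := by exact_mod_cast Int.floor_nonneg.2 h0
    rw [le_div_iff₀ hh] at h1
    rw [div_lt_iff₀ hh] at h2
    refine ⟨⌊c / h⌋, ?_, ?_⟩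
    · rw [abs_of_nonneg (by positivity), abs_of_nonneg hc]
      linarith
    · rw [abs_le]
      constructor <;> nlinarith
  rcases le_total 0 c with hc | hc
  · exact key c hc
  · obtain ⟨m, h1, h2⟩ := key (-c) (by linarith)
    refine ⟨-m, ?_, ?_⟩
    · push_cast
      rwa [mul_neg, abs_neg, ← abs_neg c]
    · push_cast
      rw [mul_neg, sub_neg_eq_add, ← abs_neg]
      convert h2 using 2
      ring

/-- A unit vector on which the quadratic form is nearly maximal is close to a point of the net in
the span of the collected vectors. -/
theorem exists_net_point {M : Matrix ι ι ℝ} {d ε γ h : ℝ} {A Q : ι → ι → ℝ} (hd : 0 < d)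
    (hε : 0 < ε) (hγ : 8 * ε < γ) (hM : ∀ x, x ⬝ᵥ M *ᵥ x ≤ d * (x ⬝ᵥ x))
    (hS : IsJacobiState M (A, Q)) (hoff : offDiagSq (of A) ≤ (ε * d / 4) ^ 2) (S : Finset ι)
    (hmem : ∀ i, i ∈ S ↔ (1 - γ + ε / 4) * d < A i i) (hh : S.Nonempty → 0 < h)
    (hcard : S.card * h ^ 2 ≤ 2 * ε / γ) (x : ι → ℝ) (hx : x ⬝ᵥ x = 1)
    (hxM : (1 - ε) * d ≤ x ⬝ᵥ M *ᵥ x) :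
    ∃ m : ι → ℤ, (∀ s ∈ S, |h * m s| ≤ 1) ∧ ∑ s ∈ S, (h * m s) ^ 2 ≤ 1 ∧
      ∑ a, (x a - ∑ s ∈ S, h * m s * Q a s) ^ 2 ≤ 4 * ε / γ := by
  obtain ⟨hQ, hA⟩ := hS
  simp only at hQ hA
  have hγ0 : 0 < γ := by linarith
  have hQ' : of Q * (of Q)ᵀ = 1 := mul_eq_one_comm.1 hQ
  set c := (of Q)ᵀ *ᵥ x with hc
  have hxc : x = of Q *ᵥ c := by rw [hc, mulVec_mulVec, hQ', one_mulVec]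
  have hcc : ∑ s, c s ^ 2 = 1 := by
    rw [← hx, hxc, dotProduct_mulVec_of_orthogonal hQ]
    exact Finset.sum_congr rfl fun _ _ => sq _
  have hcc' : c ⬝ᵥ c = 1 := by
    rw [← hcc]
    exact Finset.sum_congr rfl fun _ _ => (sq _).symm
  -- the part of `x` outside the span
  have hquad := abs_quadraticForm_sub_diag_le (of A) (by positivity) hoff c
  rw [hA, ← quadraticForm_mulVec, ← hxc, ← hA, hcc'] at hquad
  -- A diagonal entry is the Rayleigh quotient of `M` at a column of `Q`.
  have hAd : ∀ i, A i i ≤ d := by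
    intro i
    have h1 := hM (of Q *ᵥ Pi.single i 1)
    rw [quadraticForm_mulVec, dotProduct_mulVec_of_orthogonal hQ, ← hA] at h1
    simpa using h1
  have hdiag : ∑ i, of A i i * c i ^ 2 ≤
      d * 1 - (γ - ε / 4) * d * ∑ i ∈ Sᶜ, c i ^ 2 := by
    rw [← hcc, ← Finset.sum_add_sum_compl S, ← Finset.sum_add_sum_compl S (fun i => c i ^ 2)]
    have h1 : ∑ i ∈ S, of A i i * c i ^ 2 ≤ d * ∑ i ∈ S, c i ^ 2 := by
      rw [Finset.mul_sum]
      exact Finset.sum_le_sum fun i _ => mul_le_mul_of_nonneg_right (hAd i) (sq_nonneg _)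
    have h2 : ∑ i ∈ Sᶜ, of A i i * c i ^ 2 ≤ (1 - γ + ε / 4) * d * ∑ i ∈ Sᶜ, c i ^ 2 := by
      rw [Finset.mul_sum]
      refine Finset.sum_le_sum fun i hi => mul_le_mul_of_nonneg_right ?_ (sq_nonneg _)
      exact not_lt.1 fun h => Finset.mem_compl.1 hi ((hmem i).2 h)
    linarith
  have hβ0 : 0 ≤ ∑ i ∈ Sᶜ, c i ^ 2 := Finset.sum_nonneg fun _ _ => sq_nonneg _
  -- The loss `ε d` in the quotient and the Jacobi error `ε d / 4` give `(γ - ε/4) β ≤ (5/4) ε` for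
  -- the outside mass `β`; since `8ε < γ`, this leaves room for `2ε/γ`.
  have hβ : ∑ i ∈ Sᶜ, c i ^ 2 ≤ 2 * ε / γ := by
    have h1 := (abs_le.1 hquad).2
    have h2 : d * ((γ - ε / 4) * ∑ i ∈ Sᶜ, c i ^ 2) ≤ d * (5 / 4 * ε) := by nlinarith
    have h3 := le_of_mul_le_mul_left h2 hd
    rw [le_div_iff₀ hγ0]
    nlinarith
  -- rounding of the coefficients
  have hround : ∀ s, ∃ m : ℤ, s ∈ S → |h * m| ≤ |c s| ∧ |c s - h * m| ≤ h := by
    intro s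
    by_cases hs : s ∈ S
    · obtain ⟨m, hm⟩ := exists_round (hh ⟨s, hs⟩) (c s)
      exact ⟨m, fun _ => hm⟩
    · exact ⟨0, fun h => absurd h hs⟩
  choose m hm using hround
  have hSc : ∑ s ∈ S, c s ^ 2 ≤ 1 := by
    rw [← hcc]
    exact Finset.sum_le_univ_sum_of_nonneg fun _ => sq_nonneg _
  -- Rounding towards zero keeps the coefficient vector in the unit ball, which the search requires.
  refine ⟨m, fun s hs => (hm s hs).1.trans ?_, ?_, ?_⟩
  · rw [← Real.sqrt_sq_eq_abs, ← Real.sqrt_one]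
    exact Real.sqrt_le_sqrt ((Finset.single_le_sum (fun _ _ => sq_nonneg _) hs).trans hSc)
  · exact (Finset.sum_le_sum fun s hs => sq_le_sq.2 (hm s hs).1).trans hSc
  · set c' : ι → ℝ := fun s => if s ∈ S then h * m s else 0 with hc'
    have h1 : ∀ a, x a - ∑ s ∈ S, h * m s * Q a s = (of Q *ᵥ (c - c')) a := by
      intro a
      rw [mulVec_sub, ← hxc, Pi.sub_apply]
      congr 1
      simp only [mulVec, dotProduct, of_apply, hc', mul_ite, mul_zero, Finset.sum_ite_mem,
        Finset.univ_inter]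
      exact Finset.sum_congr rfl fun _ _ => mul_comm _ _
    have h2 : ∑ a, (x a - ∑ s ∈ S, h * m s * Q a s) ^ 2 = ∑ s, (c s - c' s) ^ 2 := by
      have h3 := dotProduct_mulVec_of_orthogonal hQ (c - c')
      simp only [dotProduct, ← sq] at h3
      simpa only [h1, Pi.sub_apply] using h3
    rw [h2, ← Finset.sum_add_sum_compl S]
    have h4 : ∑ s ∈ S, (c s - c' s) ^ 2 ≤ S.card * h ^ 2 := by
      rw [← nsmul_eq_mul]
      refine Finset.sum_le_card_nsmul _ _ _ fun s hs => ?_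
      simp only [hc', if_pos hs]
      exact sq_le_sq.2 ((hm s hs).2.trans (le_abs_self h))
    have h5 : ∑ s ∈ Sᶜ, (c s - c' s) ^ 2 = ∑ s ∈ Sᶜ, c s ^ 2 := by
      refine Finset.sum_congr rfl fun s hs => ?_
      simp only [hc', if_neg (Finset.mem_compl.1 hs), sub_zero]
    rw [h5]
    have : 4 * ε / γ = 2 * ε / γ + 2 * ε / γ := by ring
    linarith

end SpectralRounding

/-! ### Label-extended graphs and the effect of relabeling -/

namespace UniqueGame

variable {V K : Type} [Fintype V] [Fintype K] [DecidableEq K]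

theorem labelExtended_nonneg {V K : Type} [Fintype K] [DecidableEq K] (U : UniqueGame V K) (a b : V × K) : 0 ≤ U.labelExtended a b :=
  Finset.sum_nonneg fun π _ => by
    split_ifs
    · exact U.nonneg _ _ _
    · exact le_rfl

theorem labelExtended_transpose {V K : Type} [Fintype K] [DecidableEq K] (U : UniqueGame V K) :
    U.labelExtended.transpose = U.labelExtended := by
  ext a b
  rw [Matrix.transpose_apply]
  refine Fintype.sum_equiv (Equiv.inv _) _ _ fun π => ?_
  simp only [Equiv.inv_apply, U.symm, Equiv.Perm.inv_eq_iff_eq]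
  exact if_congr eq_comm rfl rfl

theorem labelExtended_rowSum {U : UniqueGame V K} {d : ℝ} (hU : U.IsRegular d) (a : V × K) :
    ∑ b, U.labelExtended a b = d := by
  rw [← hU a.1, Fintype.sum_prod_type]
  refine Finset.sum_congr rfl fun v _ => ?_
  unfold labelExtended
  rw [Finset.sum_comm]
  simp

theorem totalWeight_eq {U : UniqueGame V K} {d : ℝ} (hU : U.IsRegular d) :
    U.totalWeight = Fintype.card V * d := by
  unfold totalWeight
  simp [hU _]

theorem satisfiedWeight_eq (U : UniqueGame V K) (L : V → K) :
    U.satisfiedWeight L = ∑ u, ∑ u', U.labelExtended (u, L u) (u', L u') := rfl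

theorem satisfiedWeight_nonneg (U : UniqueGame V K) (L : V → K) : 0 ≤ U.satisfiedWeight L := by
  rw [satisfiedWeight_eq]
  exact Finset.sum_nonneg fun _ _ => Finset.sum_nonneg fun _ _ => U.labelExtended_nonneg _ _

theorem columnSum {U : UniqueGame V K} {d : ℝ} (hU : U.IsRegular d) (v : V) :
    ∑ u, ∑ π, U.weight u v π = d := by
  rw [← hU v]
  refine Finset.sum_congr rfl fun u _ => ?_
  exact Fintype.sum_equiv (Equiv.inv _) _ _ fun π => (U.symm u v π).symm

/-- Changing the labels of the vertices in a set `B` costs at most `2 * d` per vertex. -/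
theorem satisfiedWeight_sub_le [DecidableEq V] {U : UniqueGame V K} {d : ℝ} (hU : U.IsRegular d)
    (L L' : V → K) (B : Finset V) (hB : ∀ u ∉ B, L' u = L u) :
    U.satisfiedWeight L - 2 * d * B.card ≤ U.satisfiedWeight L' := by
  have h1 : U.satisfiedWeight L ≤ U.satisfiedWeight L' +
      (∑ u, ∑ v, ∑ π, if u ∈ B then U.weight u v π else 0) +
      ∑ u, ∑ v, ∑ π, if v ∈ B then U.weight u v π else 0 := by
    unfold satisfiedWeight
    simp only [← Finset.sum_add_distrib]
    refine Finset.sum_le_sum fun u _ => Finset.sum_le_sum fun v _ => Finset.sum_le_sum fun π _ => ?_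
    have := U.nonneg u v π
    by_cases hu : u ∈ B
    · simp only [if_pos hu]
      split_ifs <;> linarith
    · by_cases hv : v ∈ B
      · simp only [if_pos hv]
        split_ifs <;> linarith
      · rw [hB u hu, hB v hv]
        simp [hu, hv]
  have h2 : (∑ u, ∑ v, ∑ π, if u ∈ B then U.weight u v π else 0) = d * B.card := by
    have : ∀ u, (∑ v, ∑ π, if u ∈ B then U.weight u v π else 0) = if u ∈ B then d else 0 := by
      intro u
      split_ifs
      · exact hU u
      · simp
    simp only [this, Finset.sum_ite_mem, Finset.univ_inter, Finset.sum_const, nsmul_eq_mul, mul_comm]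
  have h3 : (∑ u, ∑ v, ∑ π, if v ∈ B then U.weight u v π else 0) = d * B.card := by
    have : ∀ v, (∑ u, ∑ π, if v ∈ B then U.weight u v π else 0) = if v ∈ B then d else 0 := by
      intro v
      split_ifs
      · exact columnSum hU v
      · simp
    rw [Finset.sum_comm]
    simp only [this, Finset.sum_ite_mem, Finset.univ_inter, Finset.sum_const, nsmul_eq_mul, mul_comm]
  linarith

/-- A labeling read off from a vector that is close to the normalized indicator vector of `L`
differs from `L` on few vertices only. -/
theorem card_disagree_le [DecidableEq V] (L L' : V → K) (y : V × K → ℝ) (r : ℝ) (hr : 0 ≤ r)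
    (hL' : ∀ u i, y (u, i) ≤ y (u, L' u)) :
    ((Finset.univ.filter fun u => L' u ≠ L u).card : ℝ) * (r ^ 2 / 2) ≤
      ∑ a : V × K, ((if L a.1 = a.2 then r else 0) - y a) ^ 2 := by
  rw [Fintype.sum_prod_type, ← nsmul_eq_mul, ← Finset.sum_const, Finset.sum_filter]
  refine Finset.sum_le_sum fun u _ => ?_
  split_ifs with h
  · rw [← Finset.add_sum_erase _ _ (Finset.mem_univ (L u)),
      ← Finset.add_sum_erase _ _ (Finset.mem_erase.2 ⟨h, Finset.mem_univ (L' u)⟩), if_pos rfl,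
      if_neg (Ne.symm h)]
    have h1 : 0 ≤ ∑ i ∈ (Finset.univ.erase (L u)).erase (L' u),
        ((if L u = i then r else 0) - y (u, i)) ^ 2 := Finset.sum_nonneg fun _ _ => sq_nonneg _
    have h2 := hL' u (L u)
    simp only
    -- With `a = r - y (u, L u)` and `b = y (u, L' u)` one has `a + b ≥ r`, hence `a² + b² ≥ (a +
    -- b)² / 2 ≥ r² / 2`.
    nlinarith [sq_nonneg (r - y (u, L u) - y (u, L' u)),
      mul_nonneg hr (sub_nonneg.2 h2), sq_nonneg (y (u, L' u) - y (u, L u))]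
  · exact Finset.sum_nonneg fun _ _ => sq_nonneg _

end UniqueGame

/-! ### Completeness of the spectral algorithm -/

section Completeness

open Timed Matrix UniqueGame

/-- The accuracy that the Jacobi algorithm reaches within the rounds granted to it. -/
theorem offDiagSq_computedEigenbasis_le {v q : ℕ} {M : Fin v × Fin q → Fin v × Fin q → ℝ}
    {d ε : ℝ} (hε : 0 < ε) (hM : (of M)ᵀ = of M) (hnn : ∀ a b, 0 ≤ M a b)
    (hrow : ∀ a, ∑ b, M a b = d) :
    IsJacobiState (of M) (computedEigenbasis M ε) ∧
      offDiagSq (of (computedEigenbasis M ε).1) ≤ (ε * d / 4) ^ 2 := by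
  obtain ⟨h1, h2⟩ := jacobi_spec hM (mem_allPositions (v := v) (q := q))
    ((v * q) ^ 2 * (v * q + ⌈4 / ε⌉₊))
  refine ⟨h1, h2.trans ?_⟩
  have h3 := offDiagSq_le_of_rowSum (M := of M) hnn hrow
  have hcard : (Fintype.card (Fin v × Fin q) : ℝ) = v * q := by simp
  rw [hcard] at h3 ⊢
  rcases (by positivity : (0 : ℝ) ≤ v * q).eq_or_lt with hm | hm
  · rw [← hm, zero_mul] at h3
    rw [le_antisymm h3 (offDiagSq_nonneg _), zero_mul]
    positivity
  · push_cast
    generalize (v * q : ℝ) = m at *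
    have h4 : 4 / ε ≤ (⌈4 / ε⌉₊ : ℝ) := Nat.le_ceil _
    generalize (⌈4 / ε⌉₊ : ℝ) = acc at *
    have hacc : 0 < acc := lt_of_lt_of_le (by positivity) h4
    -- The rounds yield `exp (-2m) * exp (-2 acc)`: the first factor absorbs the initial `m` in `m *
    -- d ^ 2`, the second supplies `(ε / 4) ^ 2`.
    have h5 : Real.exp (-(2 / m ^ 2) * (m ^ 2 * (m + acc))) =
        (Real.exp m * Real.exp m)⁻¹ * ((Real.exp acc)⁻¹) ^ 2 := by
      rw [← Real.exp_add, ← Real.exp_neg, ← Real.exp_neg, ← Real.exp_nat_mul, ← Real.exp_add]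
      congr 1
      field_simp
      push_cast
      ring
    have h6 : m * (Real.exp m * Real.exp m)⁻¹ ≤ 1 := by
      rw [mul_inv_le_iff₀ (by positivity)]
      nlinarith [Real.add_one_le_exp m]
    have h7 : (Real.exp acc)⁻¹ ≤ ε / 4 := by
      have h8 : 4 / ε ≤ Real.exp acc := by linarith [Real.add_one_le_exp acc]
      rw [inv_le_comm₀ (by positivity) (by positivity)]
      rwa [inv_div]
    have h8 : ((Real.exp acc)⁻¹) ^ 2 ≤ (ε / 4) ^ 2 := by gcongr
    rw [h5]
    calc offDiagSq (of M) * ((Real.exp m * Real.exp m)⁻¹ * ((Real.exp acc)⁻¹) ^ 2)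
        ≤ (m * d ^ 2) * ((Real.exp m * Real.exp m)⁻¹ * ((Real.exp acc)⁻¹) ^ 2) := by gcongr
      _ = (m * (Real.exp m * Real.exp m)⁻¹) * (((Real.exp acc)⁻¹) ^ 2 * d ^ 2) := by ring
      _ ≤ 1 * ((ε / 4) ^ 2 * d ^ 2) := by gcongr
      _ = (ε * d / 4) ^ 2 := by ring

theorem computedTotal_eq {v q : ℕ} [NeZero q] {M : Fin v × Fin q → Fin v × Fin q → ℝ}
    {d : ℝ} (hrow : ∀ a, ∑ b, M a b = d) : computedTotal M = v * d := by
  have hq : (q : ℝ) ≠ 0 := by exact_mod_cast NeZero.ne q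
  rw [computedTotal, Finset.sum_congr rfl fun a _ => hrow a]
  simp only [Finset.sum_const, Finset.card_univ, Fintype.card_prod, Fintype.card_fin,
    nsmul_eq_mul, Int.cast_natCast]
  push_cast
  field_simp

theorem eigenvalueThreshold_eq {v q : ℕ} [NeZero q]
    {M : Fin v × Fin q → Fin v × Fin q → ℝ}
    {d : ℝ} (hrow : ∀ a, ∑ b, M a b = d) (hv : v ≠ 0) (ε γ : ℝ) :
    eigenvalueThreshold M ε γ = (1 - γ + ε / 4) * d := by
  have hv' : (v : ℝ) ≠ 0 := by exact_mod_cast hv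
  rw [eigenvalueThreshold, computedTotal_eq hrow, Int.cast_natCast, mul_div_cancel_left₀ _ hv']

/-- The search finds a labeling at least as good as the one read off from any vector of the net. -/
theorem storesAtLeast_searchOutcome {v q : ℕ} [NeZero q]
    (M : Fin v × Fin q → Fin v × Fin q → ℝ) (ε γ : ℝ) (m : Fin v × Fin q → ℤ)
    (h1 : ∀ s ∈ collectedBasis M ε γ, |m s| ≤ ⌊1 / netMesh M ε γ⌋₊)
    (h2 : ∑ s ∈ (collectedBasis M ε γ).toFinset, (netMesh M ε γ * m s) ^ 2 ≤ 1) :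
    StoresAtLeast (evaluate M (readOff fun a => ∑ s ∈ (collectedBasis M ε γ).toFinset,
      netMesh M ε γ * m s * (computedEigenbasis M ε).2 a s).val).val
      (searchOutcome M ε γ).val := by
  have h := storesAtLeast_search M (computedEigenbasis M ε).2 (netMesh M ε γ)
    ⌊1 / netMesh M ε γ⌋₊ m (collectedBasis M ε γ) (fun _ => 0) 0 none h1
  simp only [zero_add, ← List.sum_toFinset _ (nodup_collectedBasis M ε γ)] at h
  exact h h2

theorem mainAlgorithm_complete {v q : ℕ} [NeZero q] (U : UniqueGame (Fin v) (Fin q))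
    {M : Fin v × Fin q → Fin v × Fin q → ℝ} (hM : of M = U.labelExtended)
    {d ε γ : ℝ} (hU : U.IsRegular d) (hε : 0 < ε) (hγ : 8 * ε < γ)
    (hsat : ∃ L, U.SatisfiesAtLeast L (1 - ε)) :
    ∃ L, (mainAlgorithm M ε γ 16).val = some L ∧
      U.SatisfiesAtLeast L (targetFraction 16 ε γ) := by
  obtain ⟨L, hL⟩ := hsat
  have hMa : ∀ a b, M a b = U.labelExtended a b := fun a b => congrFun (congrFun hM a) b
  have hrow : ∀ a, ∑ b, M a b = d := fun a => by
    rw [← labelExtended_rowSum hU a]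
    exact Finset.sum_congr rfl fun b _ => hMa a b
  have hMt : (of M)ᵀ = of M := by rw [hM, U.labelExtended_transpose]
  have hnn : ∀ a b, 0 ≤ M a b := fun a b => (hMa a b) ▸ U.labelExtended_nonneg a b
  have hsw : ∀ L, (evaluate M L).val = U.satisfiedWeight L := fun L => by
    simp only [evaluate_val, satisfiedWeight_eq, hMa]
  have htot : U.totalWeight = v * d := by rw [totalWeight_eq hU, Fintype.card_fin]
  have hct : computedTotal M = U.totalWeight := by
    rw [computedTotal_eq hrow, htot]
  -- it suffices that the net contains a good vector
  suffices h : StoresAtLeast (targetFraction 16 ε γ * U.totalWeight)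
      (searchOutcome M ε γ).val by
    obtain ⟨b, hb, hle⟩ := h
    have hev : IsEvaluated M (searchOutcome M ε γ).val :=
      search_preserves (fun x o ho => isEvaluated_improve x ho) _ _ _ _ _ _ _ (by
        rintro b hb; cases hb)
    refine ⟨b.1, ?_, ?_⟩
    · rw [mainAlgorithm_val, Option.mem_def.1 hb, Option.bind_some, hct, if_neg (not_lt.2 hle)]
    · exact hle.trans_eq ((hev b hb).trans (hsw _))
  -- Without weight every labeling is good enough, and the zero vector always belongs to the net.
  rcases eq_or_ne (v * d) 0 with h0 | h0
  · rw [htot, h0, mul_zero]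
    obtain ⟨b, hb, hle⟩ := storesAtLeast_searchOutcome M ε γ (fun _ => 0)
      (fun s _ => by simp) (by simp)
    exact ⟨b, hb, ((U.satisfiedWeight_nonneg _).trans_eq (hsw _).symm).trans hle⟩
  · have hv : v ≠ 0 := by rintro rfl; simp at h0
    have hv' : (0 : ℝ) < v := by exact_mod_cast Nat.pos_of_ne_zero hv
    have hd : 0 < d := by
      refine lt_of_le_of_ne ?_ (fun h => h0 (by rw [← h, mul_zero]))
      rw [← hU ⟨0, Nat.pos_of_ne_zero hv⟩]
      exact Finset.sum_nonneg fun _ _ => Finset.sum_nonneg fun _ _ => U.nonneg _ _ _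
    have hγ0 : 0 < γ := by linarith
    obtain ⟨hS, hoff⟩ := offDiagSq_computedEigenbasis_le hε hMt hnn hrow
    set h := netMesh M ε γ with hh
    set S := (collectedBasis M ε γ).toFinset with hSdef
    have hSlen : S.card = (collectedBasis M ε γ).length :=
      List.toFinset_card_of_nodup (nodup_collectedBasis _ _ _)
    set r : ℝ := Real.sqrt (1 / v) with hr
    have hr2 : r ^ 2 = 1 / v := Real.sq_sqrt (by positivity)
    set x : Fin v × Fin q → ℝ := fun a => if L a.1 = a.2 then r else 0 with hx
    have hxx : x ⬝ᵥ x = 1 := by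
      have h1 : ∀ u i, x (u, i) * x (u, i) = if L u = i then 1 / (v : ℝ) else 0 := by
        intro u i
        simp only [hx]
        split_ifs
        · rw [← sq, hr2]
        · rw [mul_zero]
      simp only [dotProduct, Fintype.sum_prod_type, h1, Finset.sum_ite_eq, Finset.mem_univ,
        if_true]
      simp [hv'.ne']
    have hxM : x ⬝ᵥ U.labelExtended *ᵥ x = U.satisfiedWeight L / v := by
      rw [satisfiedWeight_eq, div_eq_mul_one_div, ← hr2]
      simp only [dotProduct, mulVec, Fintype.sum_prod_type, hx, mul_ite, mul_zero, ite_mul,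
        zero_mul, Finset.sum_ite_eq, Finset.mem_univ, if_true, Finset.sum_mul]
      refine Finset.sum_congr rfl fun u _ => ?_
      rw [Finset.mul_sum]
      exact Finset.sum_congr rfl fun _ _ => by ring
    have hh2 : h ^ 2 = 2 * ε / (γ * S.card) := by
      rw [hh, netMesh, hSlen, Int.cast_natCast, Real.sq_sqrt (by positivity)]
    have hpos : S.Nonempty → 0 < h := fun hne => by
      have hc : (0 : ℝ) < S.card := by exact_mod_cast hne.card_pos
      rw [hh, netMesh, Int.cast_natCast, ← hSlen]
      exact Real.sqrt_pos.2 (by positivity)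
    obtain ⟨m, hm1, hm2, hm3⟩ := exists_net_point (M := of M) (h := h)
      (A := (computedEigenbasis M ε).1) (Q := (computedEigenbasis M ε).2) hd hε hγ
      (quadraticForm_le_of_rowSum hMt hnn hrow)
      hS hoff S (fun i => by
        rw [hSdef, List.mem_toFinset, mem_collectedBasis, eigenvalueThreshold_eq hrow hv])
      hpos
      (by
        rw [hh2]
        -- If nothing is collected, the mesh is `√(2ε / 0) = 0` by convention, and the bound holds
        -- trivially.
        rcases Nat.eq_zero_or_pos S.card with h0 | h0
        · rw [h0, Nat.cast_zero, zero_mul]; positivity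
        · have : (0 : ℝ) < S.card := by exact_mod_cast h0
          refine le_of_eq ?_
          field_simp) x hxx
      (by
        rw [hM, hxM, le_div_iff₀ hv']
        have := hL
        rw [SatisfiesAtLeast, htot] at this
        linarith)
    have hmr : ∀ s ∈ collectedBasis M ε γ, |m s| ≤ ⌊1 / netMesh M ε γ⌋₊ := by
      intro s hs
      have hsS : s ∈ S := List.mem_toFinset.2 hs
      have h1 := hm1 s hsS
      have hpos := hpos ⟨s, hsS⟩
      rw [abs_mul, abs_of_pos hpos, mul_comm, ← le_div_iff₀ hpos] at h1
      have h2 : ((m s).natAbs : ℝ) ≤ 1 / h := by rwa [Nat.cast_natAbs, Int.cast_abs]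
      rw [Int.abs_eq_natAbs, Int.ofNat_le]
      exact Nat.le_floor h2
    obtain ⟨b, hb, hle⟩ := storesAtLeast_searchOutcome M ε γ m hmr hm2
    refine ⟨b, hb, le_trans ?_ hle⟩
    rw [hsw]
    set y : Fin v × Fin q → ℝ := fun a => ∑ s ∈ S,
      h * m s * (computedEigenbasis M ε).2 a s with hy
    have hdis := card_disagree_le L (readOff y).val y r (Real.sqrt_nonneg _)
      (readOff_spec y)
    have hsub := satisfiedWeight_sub_le hU L (readOff y).val
      (Finset.univ.filter fun u => (readOff y).val u ≠ L u) (fun u hu => by simpa using hu)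
    have h1 := hdis.trans hm3
    rw [hr2] at h1
    generalize ((Finset.univ.filter fun u => (readOff y).val u ≠ L u).card : ℝ) = B at h1 hsub
    refine le_trans ?_ hsub
    have h2 : B ≤ 8 * ε / γ * v := by
      have : B * (1 / v / 2) = B / v / 2 := by ring
      rw [this, div_le_iff₀ two_pos, div_le_iff₀ hv'] at h1
      linarith [show 4 * ε / γ * 2 * v = 8 * ε / γ * v by ring]
    have h3 : ε / γ ≤ ε / (γ - 8 * ε) :=
      div_le_div_of_nonneg_left hε.le (by linarith) (by linarith)
    have h4 : 8 * ε / γ = 8 * (ε / γ) := by ring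
    rw [SatisfiesAtLeast, htot] at hL
    rw [htot, targetFraction]
    rw [h4] at h2
    -- At most `8 (ε/γ) v` vertices are relabeled at a cost of `2d` each, so the lost fraction is at
    -- most `ε + 16 ε/γ`. This is where 16 comes from; replacing `γ` by `γ - 8ε` only weakens the
    -- bound.
    have hvd : 0 < v * d := by positivity
    nlinarith [mul_le_mul_of_nonneg_left h2 hd.le, mul_le_mul_of_nonneg_left h3 hvd.le,
      mul_pos hε hvd]

end Completeness

/-! ### The two-function hypercontractive inequality -/

section Hypercontractivity

/-- The difference of the sides vanishes at `0` and is increasing, since its derivative is `s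
((1+y)^(s-1) + (1-y)^(s-1) - 2)`. With `s = p - 1` it controls the derivative in
`two_add_le_rpow_add_rpow`. -/
theorem two_mul_le_rpow_sub_rpow {s x : ℝ} (hs0 : 0 ≤ s) (hs1 : s ≤ 1) (hx0 : 0 ≤ x)
    (hx1 : x < 1) : 2 * s * x ≤ (1 + x) ^ s - (1 - x) ^ s := by
  have hd : ∀ y ∈ Set.Ico (0 : ℝ) 1, HasDerivAt (fun y => (1 + y) ^ s - (1 - y) ^ s - 2 * s * y)
      (s * (1 + y) ^ (s - 1) + s * (1 - y) ^ (s - 1) - 2 * s) y := by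
    intro y hy
    have h1 : HasDerivAt (fun y : ℝ => (1 + y) ^ s) (1 * s * (1 + y) ^ (s - 1)) y :=
      ((hasDerivAt_id y).const_add 1).rpow_const (Or.inl (by simp; linarith [hy.1]))
    have h2 : HasDerivAt (fun y : ℝ => (1 - y) ^ s) (-1 * s * (1 - y) ^ (s - 1)) y :=
      ((hasDerivAt_id y).const_sub 1).rpow_const (Or.inl (by simp; linarith [hy.2]))
    have h3 : HasDerivAt (fun y : ℝ => 2 * s * y) (2 * s * 1) y := (hasDerivAt_id y).const_mul _
    exact ((h1.sub h2).sub h3).congr_deriv (by ring)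
  have hmono : MonotoneOn (fun y => (1 + y) ^ s - (1 - y) ^ s - 2 * s * y) (Set.Ico (0 : ℝ) 1) := by
    refine monotoneOn_of_deriv_nonneg (convex_Ico 0 1)
      (fun y hy => (hd y hy).continuousAt.continuousWithinAt)
      (fun y hy => (hd y (interior_subset hy)).differentiableAt.differentiableWithinAt) ?_
    intro y hy
    have hy' := interior_subset hy
    rw [(hd y hy').deriv]
    -- Bernoulli for the exponent `1 - s`, inverted. At `z = ±y` it reduces the claim to `1/(1+a) +
    -- 1/(1-a) ≥ 2`.
    have key : ∀ z : ℝ, -1 < z → (1 + (1 - s) * z)⁻¹ ≤ (1 + z) ^ (s - 1) := by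
      intro z hz
      have h1 := rpow_one_add_le_one_add_mul_self hz.le (by linarith : 0 ≤ 1 - s) (by linarith)
      rw [← neg_sub 1 s, Real.rpow_neg (by linarith)]
      exact inv_anti₀ (Real.rpow_pos_of_pos (by linarith) _) h1
    have h1 := key y (by linarith [hy'.1])
    have h2 := key (-y) (by linarith [hy'.2])
    rw [← sub_eq_add_neg] at h2
    have ha : 0 < 1 + (1 - s) * y := by nlinarith [hy'.1]
    have hb : 0 < 1 + (1 - s) * -y := by nlinarith [hy'.1, hy'.2]
    have h3 : 2 ≤ (1 + (1 - s) * y)⁻¹ + (1 + (1 - s) * -y)⁻¹ := by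
      rw [inv_add_inv ha.ne' hb.ne', le_div_iff₀ (mul_pos ha hb)]
      nlinarith [sq_nonneg ((1 - s) * y)]
    nlinarith
  have h := hmono ⟨le_rfl, one_pos⟩ ⟨hx0, hx1⟩ hx0
  simp at h
  linarith

theorem two_add_le_rpow_add_rpow {p x : ℝ} (hp1 : 1 ≤ p) (hp2 : p ≤ 2) (hx0 : 0 ≤ x)
    (hx1 : x ≤ 1) : 2 + p * (p - 1) * x ^ 2 ≤ (1 + x) ^ p + (1 - x) ^ p := by
  have hd : ∀ y ∈ Set.Ioo (0 : ℝ) 1,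
      HasDerivAt (fun y => (1 + y) ^ p + (1 - y) ^ p - p * (p - 1) * y ^ 2)
      (p * ((1 + y) ^ (p - 1) - (1 - y) ^ (p - 1) - 2 * (p - 1) * y)) y := by
    intro y hy
    have h1 : HasDerivAt (fun y : ℝ => (1 + y) ^ p) (1 * p * (1 + y) ^ (p - 1)) y :=
      ((hasDerivAt_id y).const_add 1).rpow_const (Or.inl (by simp; linarith [hy.1]))
    have h2 : HasDerivAt (fun y : ℝ => (1 - y) ^ p) (-1 * p * (1 - y) ^ (p - 1)) y :=
      ((hasDerivAt_id y).const_sub 1).rpow_const (Or.inl (by simp; linarith [hy.2]))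
    have h3 : HasDerivAt (fun y : ℝ => p * (p - 1) * y ^ 2) (p * (p - 1) * (2 * y)) y := by
      simpa using (hasDerivAt_pow 2 y).const_mul (p * (p - 1))
    exact ((h1.add h2).sub h3).congr_deriv (by ring)
  have hmono : MonotoneOn (fun y => (1 + y) ^ p + (1 - y) ^ p - p * (p - 1) * y ^ 2)
      (Set.Icc (0 : ℝ) 1) := by
    refine monotoneOn_of_deriv_nonneg (convex_Icc 0 1) ?_ ?_ ?_
    · refine Continuous.continuousOn ?_
      refine ((Continuous.rpow_const (by fun_prop) fun _ => Or.inr (by linarith)).add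
        (Continuous.rpow_const (by fun_prop) fun _ => Or.inr (by linarith))).sub (by fun_prop)
    · rw [interior_Icc]
      exact fun y hy => (hd y hy).differentiableAt.differentiableWithinAt
    · rw [interior_Icc]
      intro y hy
      rw [(hd y hy).deriv]
      have := two_mul_le_rpow_sub_rpow (by linarith : 0 ≤ p - 1) (by linarith) hy.1.le hy.2
      exact mul_nonneg (by linarith) (by linarith)
  have h := hmono ⟨le_rfl, zero_le_one⟩ ⟨hx0, hx1⟩ hx0
  simp at h
  linarith

/-- The noise operator on one bit. -/
def bitNoise (ε : ℝ) (a b : ZMod 2) : ℝ := if a = b then 1 - ε else ε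

theorem bitNoise_nonneg {ε : ℝ} (h0 : 0 ≤ ε) (h1 : ε ≤ 1) (a b : ZMod 2) : 0 ≤ bitNoise ε a b := by
  unfold bitNoise
  split_ifs <;> linarith

theorem sum_zmod_two (f : ZMod 2 → ℝ) : ∑ a, f a = f 0 + f 1 := Fin.sum_univ_two f

/-- The Bonami inequality `‖T f‖₂ ≤ ‖f‖_p` on one bit, for the square root `T` of the noise
operator: `p = 2 - 2ε` makes the correlation `1 - 2ε` equal to `p - 1`. The power of 2 converts
counting measure to probability measure. -/
theorem two_point_diagonal {ε : ℝ} (h0 : 0 ≤ ε) (h1 : ε ≤ 1 / 2) {x y : ℝ} (hx : 0 ≤ x)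
    (hy : 0 ≤ y) :
    (1 - ε) * (x ^ 2 + y ^ 2) + 2 * ε * (x * y) ≤
      2 ^ (1 - 2 / (2 - 2 * ε)) * ((x ^ (2 - 2 * ε) + y ^ (2 - 2 * ε)) ^ (1 / (2 - 2 * ε))) ^ 2 := by
  wlog hxy : y ≤ x generalizing x y
  · have := this hy hx (not_le.1 hxy).le
    rw [add_comm (y ^ 2), add_comm (y ^ (2 - 2 * ε)), mul_comm y] at this
    exact this
  set p := 2 - 2 * ε with hp
  have hp1 : 1 ≤ p := by linarith
  have hp2 : p ≤ 2 := by linarith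
  have hpε : ε = (2 - p) / 2 := by rw [hp]; ring
  rcases hx.eq_or_lt with rfl | hx'
  · have : y = 0 := le_antisymm hxy hy
    subst this
    simp
    positivity
  -- With `x = m (1 + δ)` and `y = m (1 - δ)` the left side is `2 m² (1 + (p-1) δ²)`. Its power
  -- `p/2` is bounded by Bernoulli (`e2`), then by the second-order bound `e1`.
  set m := (x + y) / 2 with hm
  have hm0 : 0 < m := by positivity
  set δ := (x - y) / (x + y) with hδ
  have hδ0 : 0 ≤ δ := div_nonneg (by linarith) (by linarith)
  have hδ1 : δ ≤ 1 := (div_le_one (by linarith)).2 (by linarith)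
  have ex : x = m * (1 + δ) := by rw [hm, hδ]; field_simp; ring
  have ey : y = m * (1 - δ) := by rw [hm, hδ]; field_simp; ring
  clear_value m δ
  have e1 := two_add_le_rpow_add_rpow hp1 hp2 hδ0 hδ1
  have e2 : (1 + (p - 1) * δ ^ 2) ^ (p / 2) ≤ 1 + p / 2 * ((p - 1) * δ ^ 2) :=
    rpow_one_add_le_one_add_mul_self (by nlinarith) (by linarith) (by linarith)
  have hb : 0 ≤ 1 + (p - 1) * δ ^ 2 := by nlinarith [sq_nonneg δ]
  have e3 : 2 * (1 + (p - 1) * δ ^ 2) ^ (p / 2) ≤ (1 + δ) ^ p + (1 - δ) ^ p := by linarith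
  have e4 : x ^ p + y ^ p = m ^ p * ((1 + δ) ^ p + (1 - δ) ^ p) := by
    rw [ex, ey, Real.mul_rpow hm0.le (by linarith), Real.mul_rpow hm0.le (by linarith)]
    ring
  have e5 : ∀ z : ℝ, 0 ≤ z → (z ^ (1 / p)) ^ 2 = z ^ (2 / p) := by
    intro z hz
    rw [← Real.rpow_natCast, ← Real.rpow_mul hz]
    congr 1
    push_cast
    ring
  have e6 : (m ^ p * (2 * (1 + (p - 1) * δ ^ 2) ^ (p / 2))) ^ (2 / p) ≤
      (x ^ p + y ^ p) ^ (2 / p) := by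
    rw [e4]
    exact Real.rpow_le_rpow (by positivity) (mul_le_mul_of_nonneg_left e3 (by positivity))
      (by positivity)
  have e7 : (m ^ p * (2 * (1 + (p - 1) * δ ^ 2) ^ (p / 2))) ^ (2 / p) =
      m ^ 2 * (2 ^ (2 / p) * (1 + (p - 1) * δ ^ 2)) := by
    rw [Real.mul_rpow (by positivity) (by positivity),
      Real.mul_rpow (by positivity) (by positivity), ← Real.rpow_mul hm0.le, ← Real.rpow_mul hb]
    rw [show p * (2 / p) = (2 : ℕ) by field_simp; norm_num,
      show p / 2 * (2 / p) = 1 by field_simp, Real.rpow_natCast, Real.rpow_one]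
  have e8 : (2 : ℝ) ^ (1 - 2 / p) * 2 ^ (2 / p) = 2 := by
    rw [← Real.rpow_add two_pos, sub_add_cancel, Real.rpow_one]
  rw [e5 _ (by positivity)]
  refine le_trans (le_of_eq ?_)
    (mul_le_mul_of_nonneg_left (e7 ▸ e6) (by positivity : (0 : ℝ) ≤ 2 ^ (1 - 2 / p)))
  have e9 : (2 : ℝ) ^ (1 - 2 / p) * (m ^ 2 * (2 ^ (2 / p) * (1 + (p - 1) * δ ^ 2))) =
      2 * m ^ 2 * (1 + (p - 1) * δ ^ 2) := by linear_combination (m ^ 2 * (1 + (p - 1) * δ ^ 2)) * e8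
  rw [e9, ex, ey, hpε]
  ring

/-- The two-point hypercontractive inequality, in bilinear form. -/
theorem two_point_inequality {ε : ℝ} (h0 : 0 ≤ ε) (h1 : ε ≤ 1 / 2) {F G : ZMod 2 → ℝ}
    (hF : ∀ a, 0 ≤ F a) (hG : ∀ a, 0 ≤ G a) :
    ∑ a, ∑ b, bitNoise ε a b * (F a * G b) ≤ 2 ^ (1 - 2 / (2 - 2 * ε)) *
      ((∑ a, F a ^ (2 - 2 * ε)) ^ (1 / (2 - 2 * ε)) *
        (∑ a, G a ^ (2 - 2 * ε)) ^ (1 / (2 - 2 * ε))) := by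
  have e1 := two_point_diagonal h0 h1 (hF 0) (hF 1)
  have e2 := two_point_diagonal h0 h1 (hG 0) (hG 1)
  have h01 : (0 : ZMod 2) ≠ 1 := by decide
  have e3 : ∑ a, ∑ b, bitNoise ε a b * (F a * G b) =
      (1 - ε) * (F 0 * G 0 + F 1 * G 1) + ε * (F 0 * G 1 + F 1 * G 0) := by
    simp only [sum_zmod_two, bitNoise, h01, h01.symm, if_true, if_false]
    ring
  rw [e3, sum_zmod_two, sum_zmod_two]
  set P := (F 0 ^ (2 - 2 * ε) + F 1 ^ (2 - 2 * ε)) ^ (1 / (2 - 2 * ε))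
  set R := (G 0 ^ (2 - 2 * ε) + G 1 ^ (2 - 2 * ε)) ^ (1 / (2 - 2 * ε))
  have hP : 0 ≤ P := Real.rpow_nonneg (add_nonneg (Real.rpow_nonneg (hF 0) _)
    (Real.rpow_nonneg (hF 1) _)) _
  have hR : 0 ≤ R := Real.rpow_nonneg (add_nonneg (Real.rpow_nonneg (hG 0) _)
    (Real.rpow_nonneg (hG 1) _)) _
  set c : ℝ := 2 ^ (1 - 2 / (2 - 2 * ε))
  have hc : 0 ≤ c := by positivity
  refine le_of_sq_le_sq ?_ (by positivity)
  have hf : 0 ≤ (1 - ε) * (F 0 ^ 2 + F 1 ^ 2) + 2 * ε * (F 0 * F 1) := by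
    nlinarith [mul_nonneg h0 (mul_nonneg (hF 0) (hF 1)),
      mul_nonneg (by linarith : 0 ≤ 1 - ε) (add_nonneg (sq_nonneg (F 0)) (sq_nonneg (F 1)))]
  have hg : 0 ≤ (1 - ε) * (G 0 ^ 2 + G 1 ^ 2) + 2 * ε * (G 0 * G 1) := by
    nlinarith [mul_nonneg h0 (mul_nonneg (hG 0) (hG 1)),
      mul_nonneg (by linarith : 0 ≤ 1 - ε) (add_nonneg (sq_nonneg (G 0)) (sq_nonneg (G 1)))]
  calc ((1 - ε) * (F 0 * G 0 + F 1 * G 1) + ε * (F 0 * G 1 + F 1 * G 0)) ^ 2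
      ≤ ((1 - ε) * (F 0 ^ 2 + F 1 ^ 2) + 2 * ε * (F 0 * F 1)) *
        ((1 - ε) * (G 0 ^ 2 + G 1 ^ 2) + 2 * ε * (G 0 * G 1)) := by
        -- Cauchy–Schwarz for the positive semidefinite form of the noise; `1 - 2 * ε` is its
        -- determinant.
        have : ((1 - ε) * (F 0 ^ 2 + F 1 ^ 2) + 2 * ε * (F 0 * F 1)) *
          ((1 - ε) * (G 0 ^ 2 + G 1 ^ 2) + 2 * ε * (G 0 * G 1)) -
          ((1 - ε) * (F 0 * G 0 + F 1 * G 1) + ε * (F 0 * G 1 + F 1 * G 0)) ^ 2 =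
          (1 - 2 * ε) * (F 0 * G 1 - F 1 * G 0) ^ 2 := by ring
        nlinarith [mul_nonneg (by linarith : 0 ≤ 1 - 2 * ε) (sq_nonneg (F 0 * G 1 - F 1 * G 0))]
    _ ≤ (c * P ^ 2) * (c * R ^ 2) := mul_le_mul e1 e2 hg (by positivity)
    _ = (c * (P * R)) ^ 2 := by ring

theorem sum_option_cube {α : Type} [Fintype α] [DecidableEq α] [DecidableEq (Option α)]
    (Φ : (Option α → ZMod 2) → ℝ) :
    ∑ f, Φ f = ∑ a, ∑ f : α → ZMod 2, Φ fun o => o.elim a f := by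
  rw [← Fintype.sum_prod_type' fun a (f : α → ZMod 2) => Φ fun o => o.elim a f]
  refine Fintype.sum_equiv (Equiv.piOptionEquivProd (β := fun _ => ZMod 2)) _ _ fun f => ?_
  congr 1
  funext o
  cases o <;> rfl

/-- The hypercontractive inequality on the cube `X → ZMod 2`, in bilinear form. -/
theorem hypercontractive {ε : ℝ} (h0 : 0 ≤ ε) (h1 : ε ≤ 1 / 2) (X : Type) [Fintype X]
    [DecidableEq X] (F G : (X → ZMod 2) → ℝ) (hF : ∀ f, 0 ≤ F f) (hG : ∀ f, 0 ≤ G f) :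
    ∑ f, ∑ g, (∏ x, bitNoise ε (f x) (g x)) * (F f * G g) ≤
      (2 ^ (1 - 2 / (2 - 2 * ε))) ^ Fintype.card X *
      ((∑ f, F f ^ (2 - 2 * ε)) ^ (1 / (2 - 2 * ε)) *
        (∑ f, G f ^ (2 - 2 * ε)) ^ (1 / (2 - 2 * ε))) := by
  have hp : 0 < 2 - 2 * ε := by linarith
  have htwo := fun F G hF hG => two_point_inequality (F := F) (G := G) h0 h1 hF hG
  set p := 2 - 2 * ε with hpdef
  have hpow : ∀ z : ℝ, 0 ≤ z → (z ^ p) ^ (1 / p) = z := fun z hz => by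
    rw [← Real.rpow_mul hz, mul_one_div_cancel hp.ne', Real.rpow_one]
  have hpow' : ∀ z : ℝ, 0 ≤ z → (z ^ (1 / p)) ^ p = z := fun z hz => by
    rw [← Real.rpow_mul hz, one_div_mul_cancel hp.ne', Real.rpow_one]
  refine Fintype.induction_empty_option
    (P := fun X _ => ∀ [DecidableEq X] (F G : (X → ZMod 2) → ℝ), (∀ f, 0 ≤ F f) →
      (∀ f, 0 ≤ G f) → ∑ f, ∑ g, (∏ x, bitNoise ε (f x) (g x)) * (F f * G g) ≤
      (2 ^ (1 - 2 / p)) ^ Fintype.card X *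
      ((∑ f, F f ^ p) ^ (1 / p) * (∑ f, G f ^ p) ^ (1 / p))) ?_ ?_ ?_ X F G hF hG
  · intro α β _ e ih _ F G hF hG
    let _ := Fintype.ofEquiv β e.symm
    classical
    have h := ih (fun f => F (f ∘ e.symm)) (fun f => G (f ∘ e.symm)) (fun f => hF _) fun f => hG _
    have hsum : ∀ Φ : (β → ZMod 2) → ℝ, ∑ f : α → ZMod 2, Φ (f ∘ e.symm) = ∑ f, Φ f := fun Φ =>
      Fintype.sum_equiv (e.arrowCongr (Equiv.refl _)) _ _ fun f => rfl
    have hprod : ∀ f g : α → ZMod 2, ∏ x, bitNoise ε (f x) (g x) =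
        ∏ x, bitNoise ε ((f ∘ e.symm) x) ((g ∘ e.symm) x) := fun f g =>
      Fintype.prod_equiv e _ _ fun x => by simp
    simp only [hprod] at h
    rw [hsum fun f => F f ^ p, hsum fun f => G f ^ p, Fintype.card_congr e] at h
    have h3 := hsum fun f => ∑ g : α → ZMod 2, (∏ x, bitNoise ε (f x) ((g ∘ e.symm) x)) *
      (F f * G (g ∘ e.symm))
    rw [h3] at h
    refine (Finset.sum_congr rfl fun f _ => ?_).trans_le h
    exact (hsum fun g => (∏ x, bitNoise ε (f x) (g x)) * (F f * G g)).symm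
  · intro _ F G hF hG
    simp only [Finset.univ_unique, Finset.sum_singleton, hpow _ (hF _), hpow _ (hG _),
      Fintype.card_eq_zero, pow_zero, one_mul, Finset.univ_eq_empty, Finset.prod_empty]
    exact le_rfl
  · intro α _ ih _ F G hF hG
    classical
    set c : ℝ := 2 ^ (1 - 2 / p)
    have hc : 0 ≤ c := by positivity
    set A : ZMod 2 → ℝ := fun a => (∑ f : α → ZMod 2, F (fun o => o.elim a f) ^ p) ^ (1 / p)
    set B : ZMod 2 → ℝ := fun a => (∑ f : α → ZMod 2, G (fun o => o.elim a f) ^ p) ^ (1 / p)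
    have hA' : ∀ a, 0 ≤ ∑ f : α → ZMod 2, F (fun o => o.elim a f) ^ p := fun a =>
      Finset.sum_nonneg fun f _ => Real.rpow_nonneg (hF _) _
    have hB' : ∀ a, 0 ≤ ∑ f : α → ZMod 2, G (fun o => o.elim a f) ^ p := fun a =>
      Finset.sum_nonneg fun f _ => Real.rpow_nonneg (hG _) _
    have hA : ∀ a, 0 ≤ A a := fun a => Real.rpow_nonneg (hA' a) _
    have hB : ∀ a, 0 ≤ B a := fun a => Real.rpow_nonneg (hB' a) _
    have e1 : ∑ f, F f ^ p = ∑ a, A a ^ p := by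
      rw [sum_option_cube]
      exact Finset.sum_congr rfl fun a _ => (hpow' _ (hA' a)).symm
    have e2 : ∑ f, G f ^ p = ∑ a, B a ^ p := by
      rw [sum_option_cube]
      exact Finset.sum_congr rfl fun a _ => (hpow' _ (hB' a)).symm
    rw [e1, e2, Fintype.card_option, pow_succ, mul_assoc]
    calc ∑ f : Option α → ZMod 2, ∑ g, (∏ x, bitNoise ε (f x) (g x)) * (F f * G g)
        = ∑ a, ∑ b, bitNoise ε a b * ∑ f : α → ZMod 2, ∑ g : α → ZMod 2,
            (∏ x, bitNoise ε (f x) (g x)) *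
              (F (fun o => o.elim a f) * G (fun o => o.elim b g)) := by
          rw [sum_option_cube]
          refine Finset.sum_congr rfl fun a _ => ?_
          simp only [Finset.mul_sum]
          refine Eq.trans (Finset.sum_congr rfl fun f _ => ?_) Finset.sum_comm
          rw [sum_option_cube]
          refine Finset.sum_congr rfl fun b _ => Finset.sum_congr rfl fun g _ => ?_
          rw [Fintype.prod_option]
          simp only [Option.elim]
          ring
      -- Tensorization: the induction hypothesis handles the slices for each pair of values of the
      -- extra bit; the two-point inequality then applies to the slice norms `A`, `B`.
      _ ≤ ∑ a, ∑ b, bitNoise ε a b * (c ^ Fintype.card α * (A a * B b)) :=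
          Finset.sum_le_sum fun a _ => Finset.sum_le_sum fun b _ =>
            mul_le_mul_of_nonneg_left (ih _ _ (fun _ => hF _) fun _ => hG _)
              (bitNoise_nonneg h0 (by linarith) a b)
      _ = c ^ Fintype.card α * ∑ a, ∑ b, bitNoise ε a b * (A a * B b) := by
          simp only [Finset.mul_sum]
          exact Finset.sum_congr rfl fun a _ => Finset.sum_congr rfl fun b _ => by ring
      _ ≤ _ := mul_le_mul_of_nonneg_left (htwo A B hA hB) (by positivity)

end Hypercontractivity

/-! ### Fourier analysis of the noisy cube -/

section NoisyCube

variable {k : ℕ}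

theorem card_kvLabel (k : ℕ) : Fintype.card (KVLabel k) = 2 ^ k := by simp

theorem card_kvCube (k : ℕ) : Fintype.card (KVCube k) = 2 ^ 2 ^ k := by simp

theorem zmod_two_cases (a : ZMod 2) : a = 0 ∨ a = 1 := by
  fin_cases a
  · exact Or.inl rfl
  · exact Or.inr rfl

/-- The product form lets sums over the cube factor into one-bit sums (`sum_prod_cube`) and matches
the kernel in `hypercontractive`. -/
theorem noiseWeight_eq_prod (ε : ℝ) (f g : KVCube k) :
    noiseWeight k ε f g = ∏ x, bitNoise ε (f x) (g x) := by
  unfold noiseWeight bitNoise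
  rw [Finset.prod_ite, Finset.prod_const, Finset.prod_const, mul_comm]
  have h1 : (Finset.univ.filter fun x => ¬f x = g x).card = hammingDist f g := rfl
  have h2 := Finset.card_filter_add_card_filter_not (s := Finset.univ) (fun x => f x = g x)
  rw [h1, Finset.card_univ, card_kvLabel] at h2
  rw [h1, ← h2, Nat.add_sub_cancel]

theorem noiseWeight_add_right (ε : ℝ) (f g h : KVCube k) :
    noiseWeight k ε (f + h) (g + h) = noiseWeight k ε f g := by
  simp [noiseWeight_eq_prod, bitNoise]

theorem sum_prod_cube {X : Type} [Fintype X] [DecidableEq X] (F : X → ZMod 2 → ℝ) :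
    ∑ f : X → ZMod 2, ∏ x, F x (f x) = ∏ x, ∑ a, F x a := by
  rw [Finset.prod_univ_sum, Fintype.piFinset_univ]

theorem sum_noiseWeight (ε : ℝ) (f : KVCube k) : ∑ g, noiseWeight k ε f g = 1 := by
  simp only [noiseWeight_eq_prod]
  rw [sum_prod_cube fun x a => bitNoise ε (f x) a]
  refine Finset.prod_eq_one fun x _ => ?_
  rcases zmod_two_cases (f x) with h | h <;> rw [h, sum_zmod_two] <;> simp [bitNoise]

theorem neg_one_pow_val_add (a b : ZMod 2) :
    (-1 : ℝ) ^ (a + b).val = (-1) ^ a.val * (-1) ^ b.val := by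
  rw [← pow_add, ZMod.val_add, ← neg_one_pow_eq_pow_mod_two]

theorem cubeCharacter_eq_prod (ω f : KVCube k) :
    cubeCharacter ω f = ∏ x, (-1 : ℝ) ^ (ω x * f x).val := by
  unfold cubeCharacter
  induction (Finset.univ : Finset (KVLabel k)) using Finset.induction_on with
  | empty => simp
  | insert x s hx ih => rw [Finset.sum_insert hx, Finset.prod_insert hx, neg_one_pow_val_add, ih]

/-- Both factors are products over coordinates, and a one-bit sum contributes `1 - 2 * ε` where `ω`
is nonzero and `1` elsewhere. -/
theorem noisyCube_mulVec_character (ε : ℝ) (ω : KVCube k) :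
    (noisyCube k ε).mulVec (cubeCharacter ω) =
      ((2 : ℝ) ^ k * (1 - 2 * ε) ^ hammingNorm ω) • cubeCharacter ω := by
  have h01 : (0 : ZMod 2) ≠ 1 := by decide
  funext f
  have h1 : ∑ g, noiseWeight k ε f g * cubeCharacter ω g =
      (1 - 2 * ε) ^ hammingNorm ω * cubeCharacter ω f := by
    simp only [noiseWeight_eq_prod, cubeCharacter_eq_prod, ← Finset.prod_mul_distrib]
    rw [sum_prod_cube fun x a => bitNoise ε (f x) a * (-1) ^ (ω x * a).val]
    have h2 : (1 - 2 * ε) ^ hammingNorm ω = ∏ x, if ω x ≠ 0 then 1 - 2 * ε else 1 := by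
      rw [Finset.prod_ite, Finset.prod_const, Finset.prod_const_one, mul_one]
      rfl
    rw [h2, ← Finset.prod_mul_distrib]
    refine Finset.prod_congr rfl fun x _ => ?_
    rcases zmod_two_cases (f x) with hf | hf <;> rcases zmod_two_cases (ω x) with hω | hω <;>
      rw [hf, hω, sum_zmod_two] <;> simp [bitNoise, ZMod.val_one] <;> ring
  simp only [Matrix.mulVec, dotProduct, noisyCube, Pi.smul_apply, smul_eq_mul, mul_assoc,
    ← Finset.mul_sum, h1]

theorem sum_character_mul_character (ω ω' : KVCube k) :
    ∑ f, cubeCharacter ω f * cubeCharacter ω' f = if ω = ω' then (2 : ℝ) ^ 2 ^ k else 0 := by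
  simp only [cubeCharacter_eq_prod, ← Finset.prod_mul_distrib]
  rw [sum_prod_cube fun x a => (-1 : ℝ) ^ (ω x * a).val * (-1) ^ (ω' x * a).val]
  have h : ∀ x, ∑ a, (-1 : ℝ) ^ (ω x * a).val * (-1) ^ (ω' x * a).val =
      if ω x = ω' x then 2 else 0 := by
    intro x
    rcases zmod_two_cases (ω x) with hf | hf <;> rcases zmod_two_cases (ω' x) with hω | hω <;>
      rw [hf, hω, sum_zmod_two] <;> simp [ZMod.val_one] <;> norm_num
  simp only [h]
  split_ifs with heq
  · subst heq
    simp
  · obtain ⟨x, hx⟩ := Function.ne_iff.1 heq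
    exact Finset.prod_eq_zero (Finset.mem_univ x) (if_neg hx)

/-- The orthogonal matrix whose rows are the normalized characters. -/
def fourierMatrix (k : ℕ) : Matrix (KVCube k) (KVCube k) ℝ :=
  .of fun ω f => cubeCharacter ω f / Real.sqrt (2 ^ 2 ^ k)

theorem fourierMatrix_mul_transpose (k : ℕ) :
    fourierMatrix k * (fourierMatrix k).transpose = 1 := by
  ext ω ω'
  have hs : Real.sqrt (2 ^ 2 ^ k) * Real.sqrt (2 ^ 2 ^ k) = (2 : ℝ) ^ 2 ^ k :=
    Real.mul_self_sqrt (by positivity)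
  simp only [Matrix.mul_apply, Matrix.transpose_apply, fourierMatrix, Matrix.of_apply,
    div_mul_div_comm, ← Finset.sum_div, sum_character_mul_character, hs, Matrix.one_apply]
  split_ifs
  · exact div_self (by positivity)
  · simp

theorem noisyCube_transpose (ε : ℝ) : (noisyCube k ε).transpose = noisyCube k ε := by
  ext f g
  simp only [Matrix.transpose_apply, noisyCube, noiseWeight_comm k ε f g]

theorem fourierMatrix_mul_noisyCube (ε : ℝ) :
    fourierMatrix k * noisyCube k ε =
      Matrix.diagonal (fun ω : KVCube k => (2 : ℝ) ^ k * (1 - 2 * ε) ^ hammingNorm ω) *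
        fourierMatrix k := by
  ext ω f
  have h := congrFun (noisyCube_mulVec_character ε ω) f
  rw [Matrix.diagonal_mul, ← noisyCube_transpose ε]
  simp only [Matrix.mulVec, dotProduct, Pi.smul_apply, smul_eq_mul] at h
  simp only [fourierMatrix, Matrix.of_apply, Matrix.mul_apply, Matrix.transpose_apply,
    ← mul_div_assoc, ← h, Finset.sum_div]
  exact Finset.sum_congr rfl fun g _ => by ring

theorem linearIndependent_character (k : ℕ) :
    LinearIndependent ℝ (fun ω : KVCube k => (cubeCharacter ω : KVCube k → ℝ)) := by
  rw [Fintype.linearIndependent_iff]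
  intro c hc ω
  have h1 : ∑ f, (∑ ω', c ω' • cubeCharacter ω') f * cubeCharacter ω f = c ω * 2 ^ 2 ^ k := by
    simp only [Finset.sum_apply, Pi.smul_apply, smul_eq_mul, Finset.sum_mul]
    rw [Finset.sum_comm]
    simp only [mul_assoc, ← Finset.mul_sum, sum_character_mul_character]
    simp
  rw [hc] at h1
  simpa using h1.symm

theorem span_character (k : ℕ) :
    Submodule.span ℝ (Set.range fun ω : KVCube k => (cubeCharacter ω : KVCube k → ℝ)) = ⊤ :=
  (linearIndependent_character k).span_eq_top_of_card_eq_finrank' (by simp)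

end NoisyCube

/-! ### The Khot–Vishnoi instance: structure and unsatisfiability -/

section KhotVishnoi

variable {k : ℕ}

theorem hadamardCode_injective (k : ℕ) : Function.Injective (hadamardCode k) := by
  intro a b h
  funext i
  have := congrFun h (Pi.single i 1)
  simpa [hadamardCode, Pi.single_apply] using this

theorem kvPoint_bijective {rep : KVVertex k → KVCube k}
    (hrep : ∀ x : KVVertex k, (QuotientAddGroup.mk (rep x) : KVVertex k) = x) :
    Function.Bijective (kvPoint rep) := by
  constructor
  · rintro ⟨x, S⟩ ⟨y, T⟩ h
    simp only [kvPoint] at h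
    have hxy : x = y := by
      rw [← hrep x, ← hrep y, QuotientAddGroup.eq]
      refine ⟨S - T, ?_⟩
      rw [map_sub, eq_neg_add_iff_add_eq, add_sub_assoc', h, add_sub_cancel_right]
    subst hxy
    rw [hadamardCode_injective k (add_left_cancel h)]
  · intro g
    have h : (QuotientAddGroup.mk (rep (QuotientAddGroup.mk g : KVVertex k)) : KVVertex k) =
      QuotientAddGroup.mk g := hrep _
    rw [QuotientAddGroup.eq] at h
    obtain ⟨S, hS⟩ := h
    refine ⟨(QuotientAddGroup.mk g, S), ?_⟩
    simp only [kvPoint]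
    rw [hS, add_neg_cancel_left]

theorem kvLabel_add_self (S : KVLabel k) : S + S = 0 := by
  funext i
  exact CharTwo.add_self_eq_zero (S i)

theorem khotVishnoi_isRegular {ε : ℝ} (hε : ε ∈ Set.Icc (0 : ℝ) 1) {rep : KVVertex k → KVCube k}
    (hrep : ∀ x : KVVertex k, (QuotientAddGroup.mk (rep x) : KVVertex k) = x) :
    (khotVishnoi k ε hε rep).IsRegular ((2 : ℝ) ^ k) := by
  intro x
  have h1 : ∀ y, ∑ π, (khotVishnoi k ε hε rep).weight x y π =
      ∑ S : KVLabel k, ∑ T : KVLabel k, noiseWeight k ε (kvPoint rep (x, S)) (kvPoint rep (y, T)) := by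
    intro y
    simp only [khotVishnoi]
    rw [Finset.sum_comm]
    refine Finset.sum_congr rfl fun S _ => ?_
    rw [Finset.sum_comm]
    refine Finset.sum_congr rfl fun T _ => ?_
    rw [Finset.sum_ite_eq' Finset.univ, if_pos (Finset.mem_univ _)]
    rfl
  simp only [h1]
  rw [Finset.sum_comm]
  have h2 : ∀ S : KVLabel k, ∑ y, ∑ T : KVLabel k,
      noiseWeight k ε (kvPoint rep (x, S)) (kvPoint rep (y, T)) = 1 := by
    intro S
    rw [← sum_noiseWeight ε (kvPoint rep (x, S)), ← (kvPoint_bijective hrep).sum_comp,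
      Fintype.sum_prod_type]
  simp [h2]

/-- In characteristic 2, the translation by `S + T` maps `i` to `j` exactly for `T = S + i + j`.
Adding `h_(S+i)` to both endpoints turns each such edge into the one for `(i, j)`, so the `2 ^ k`
choices of `S` contribute equally. -/
theorem khotVishnoi_labelExtended {ε : ℝ} (hε : ε ∈ Set.Icc (0 : ℝ) 1)
    (rep : KVVertex k → KVCube k) :
    (khotVishnoi k ε hε rep).labelExtended =
      (noisyCube k ε).submatrix (kvPoint rep) (kvPoint rep) := by
  ext ⟨x, i⟩ ⟨y, j⟩
  have h1 : ∀ S T : KVLabel k, (∑ π : Equiv.Perm (KVLabel k), if π i = j then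
      (if π = Equiv.addRight (S + T) then
        noiseWeight k ε (rep x + hadamardCode k S) (rep y + hadamardCode k T) else 0) else 0) =
      if T = S + i + j then
        noiseWeight k ε (rep x + hadamardCode k i) (rep y + hadamardCode k j) else 0 := by
    intro S T
    have h2 : ∀ π : Equiv.Perm (KVLabel k), (if π i = j then
      (if π = Equiv.addRight (S + T) then
        noiseWeight k ε (rep x + hadamardCode k S) (rep y + hadamardCode k T) else 0) else 0) =
        if π = Equiv.addRight (S + T) then (if i + (S + T) = j then
          noiseWeight k ε (rep x + hadamardCode k S) (rep y + hadamardCode k T) else 0) else 0 := by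
      intro π
      by_cases hπ : π = Equiv.addRight (S + T)
      · subst hπ
        simp only [if_true, Equiv.coe_addRight]
      · simp only [if_neg hπ, ite_self]
    rw [Finset.sum_congr rfl fun π _ => h2 π, Finset.sum_ite_eq' Finset.univ,
      if_pos (Finset.mem_univ _)]
    have h3 : i + (S + T) = j ↔ T = S + i + j := by
      constructor
      · rintro rfl
        have : S + i + (i + (S + T)) = (S + S) + ((i + i) + T) := by abel
        rw [this, kvLabel_add_self, kvLabel_add_self, zero_add, zero_add]
      · rintro rfl
        have : i + (S + (S + i + j)) = (S + S) + ((i + i) + j) := by abel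
        rw [this, kvLabel_add_self, kvLabel_add_self, zero_add, zero_add]
    by_cases hT : T = S + i + j
    · rw [if_pos (h3.2 hT), if_pos hT, ← noiseWeight_add_right ε _ _ (hadamardCode k (S + i)),
        hT]
      congr 1
      · rw [add_assoc, ← map_add, ← add_assoc, kvLabel_add_self, zero_add]
      · rw [add_assoc, ← map_add]
        congr 2
        rw [add_comm, ← add_assoc, kvLabel_add_self, zero_add]
    · rw [if_neg (fun h => hT (h3.1 h)), if_neg hT]
  calc (khotVishnoi k ε hε rep).labelExtended (x, i) (y, j)
      = ∑ S : KVLabel k, ∑ T : KVLabel k, ∑ π : Equiv.Perm (KVLabel k), if π i = j then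
          (if π = Equiv.addRight (S + T) then
            noiseWeight k ε (rep x + hadamardCode k S) (rep y + hadamardCode k T) else 0)
          else 0 := by
        rw [Finset.sum_congr rfl fun S _ => Finset.sum_comm, Finset.sum_comm]
        refine Finset.sum_congr rfl fun π _ => ?_
        simp only [khotVishnoi]
        split_ifs <;> simp
    _ = _ := by
        simp only [h1, Finset.sum_ite_eq', Finset.mem_univ, if_true]
        simp [noisyCube, kvPoint]

/-- The Khot–Vishnoi instance is highly unsatisfiable: a labeling picks one point in every coset,
and the noise stability of this set is small. -/
theorem khotVishnoi_satisfiesAtMost {ε : ℝ} (hε : ε ∈ Set.Icc (0 : ℝ) 1) (hε' : ε ≤ 1 / 2)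
    {rep : KVVertex k → KVCube k}
    (hrep : ∀ x : KVVertex k, (QuotientAddGroup.mk (rep x) : KVVertex k) = x)
    (L : KVVertex k → KVLabel k) :
    (khotVishnoi k ε hε rep).SatisfiesAtMost L (((2 : ℝ) ^ k) ^ (-ε)) := by
  have hinj : Function.Injective fun x => kvPoint rep (x, L x) := fun x y h =>
    congrArg Prod.fst ((kvPoint_bijective hrep).1 h)
  set A : Finset (KVCube k) := Finset.univ.map ⟨_, hinj⟩ with hA
  have hAcard : A.card = Fintype.card (KVVertex k) := by simp [hA, Finset.card_univ]
  have hV : (Fintype.card (KVVertex k) : ℝ) * 2 ^ k = 2 ^ 2 ^ k := by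
    have h := Fintype.card_of_bijective (kvPoint_bijective hrep)
    rw [Fintype.card_prod, card_kvLabel, card_kvCube] at h
    exact_mod_cast h
  have hreg := khotVishnoi_isRegular hε hrep
  set n : ℝ := 2 ^ k with hn
  have hn1 : 1 ≤ n := one_le_pow₀ one_le_two
  set m : ℝ := (Fintype.card (KVVertex k) : ℝ) with hm
  have hm0 : 0 < m := by
    have : 0 < m * n := by rw [hV]; positivity
    exact pos_of_mul_pos_left this (by linarith)
  have h1 : (khotVishnoi k ε hε rep).satisfiedWeight L =
      n * ∑ f, ∑ g, (∏ x, bitNoise ε (f x) (g x)) *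
        ((if f ∈ A then 1 else 0) * (if g ∈ A then 1 else 0)) := by
    have : ∀ f g : KVCube k, (∏ x, bitNoise ε (f x) (g x)) *
        ((if f ∈ A then 1 else 0) * (if g ∈ A then 1 else 0)) =
        if f ∈ A then (if g ∈ A then noiseWeight k ε f g else 0) else 0 := by
      intro f g
      rw [noiseWeight_eq_prod]
      split_ifs <;> simp
    simp only [this]
    have h2 : ∀ f, (∑ g, if f ∈ A then (if g ∈ A then noiseWeight k ε f g else 0) else 0) =
        if f ∈ A then ∑ g ∈ A, noiseWeight k ε f g else 0 := by
      intro f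
      split_ifs <;> simp
    simp only [h2, Finset.sum_ite_mem, Finset.univ_inter]
    rw [hA]
    simp only [Finset.sum_map, Function.Embedding.coeFn_mk, Finset.mul_sum]
    change (∑ u, ∑ u', (khotVishnoi k ε hε rep).labelExtended (u, L u) (u', L u')) = _
    simp only [khotVishnoi_labelExtended, Matrix.submatrix_apply, noisyCube, hn]
  have h2 := hypercontractive hε.1 hε' (KVLabel k) (fun f => if f ∈ A then 1 else 0)
    (fun f => if f ∈ A then 1 else 0) (fun f => by positivity) (fun f => by positivity)
  have hp : 0 < 2 - 2 * ε := by linarith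
  have h3 : ∑ f : KVCube k, (if f ∈ A then (1 : ℝ) else 0) ^ (2 - 2 * ε) = m := by
    have : ∀ f : KVCube k, (if f ∈ A then (1 : ℝ) else 0) ^ (2 - 2 * ε) =
        if f ∈ A then 1 else 0 := by
      intro f
      split_ifs
      · exact Real.one_rpow _
      · exact Real.zero_rpow hp.ne'
    simp [this, hAcard, hm]
  rw [h3, card_kvLabel, ← Real.rpow_natCast, ← Real.rpow_mul two_pos.le,
    ← Real.rpow_add hm0] at h2
  unfold UniqueGame.SatisfiesAtMost
  have htot : (khotVishnoi k ε hε rep).totalWeight = m * n := by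
    unfold UniqueGame.totalWeight
    rw [Finset.sum_congr rfl fun u _ => hreg u]
    simp [hm]
  rw [h1, htot]
  refine (mul_le_mul_of_nonneg_left h2 (by linarith)).trans ?_
  set q : ℝ := 2 / (2 - 2 * ε) with hq
  -- `q = 1 / (1 - ε)`, so the final exponent `1 - q` is at most `-ε`.
  have hq1 : 1 + ε ≤ q := by
    rw [hq, le_div_iff₀ hp]
    nlinarith [sq_nonneg ε]
  -- The cube has `m * n` points; then the powers of `m` combine and only `n ^ (1 - q)` is left
  -- besides the total weight.
  have e1 : (2 : ℝ) ^ ((1 - q) * (2 ^ k : ℕ)) = (m * n) ^ (1 - q) := by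
    rw [hV, ← Real.rpow_natCast, ← Real.rpow_mul two_pos.le]
    congr 1
    push_cast
    ring
  have e2 : 1 / (2 - 2 * ε) + 1 / (2 - 2 * ε) = q := by rw [hq]; ring
  rw [e1, e2, Real.mul_rpow hm0.le (by linarith)]
  have e3 : n * (m ^ (1 - q) * n ^ (1 - q) * m ^ q) = m * n * n ^ (1 - q) := by
    have : m ^ (1 - q) * m ^ q = m := by
      rw [← Real.rpow_add hm0, sub_add_cancel, Real.rpow_one]
    linear_combination (n * n ^ (1 - q)) * this
  rw [e3, mul_comm (n ^ (-ε))]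
  exact mul_le_mul_of_nonneg_left (Real.rpow_le_rpow_of_exponent_le hn1 (by linarith))
    (by positivity)

end KhotVishnoi

/-! ### Counting exact and computed eigenvalues -/

section SpectralCount

open Matrix

variable {ι Ω : Type} [Fintype ι] [DecidableEq ι] [Fintype Ω] [DecidableEq Ω]

/-- Eigenspaces for large eigenvalues are controlled by the number of large eigenvalues in an
orthogonal diagonalization. -/
theorem finrank_largeEigenspace_le {M : Matrix ι ι ℝ} {P : Matrix Ω ι ℝ} {lam : Ω → ℝ}
    (hP : Pᵀ * P = 1) (hPM : P * M = diagonal lam * P) (t : ℝ) :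
    Module.finrank ℝ (largeEigenspace M t) ≤ Fintype.card {ω // t ≤ lam ω} := by
  -- An eigenvector for `μ ≥ t` has no component along a row of `P` with a different eigenvalue.
  have hker : ∀ ω, lam ω < t →
      largeEigenspace M t ≤ LinearMap.ker ((LinearMap.proj ω).comp P.mulVecLin) := by
    intro ω hω
    refine iSup₂_le fun μ hμ f hf => ?_
    rw [Module.End.mem_eigenspace_iff, mulVecLin_apply] at hf
    have h1 : lam ω * (P *ᵥ f) ω = μ * (P *ᵥ f) ω := by
      have h2 : (P * M) *ᵥ f = (diagonal lam * P) *ᵥ f := by rw [hPM]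
      rw [← mulVec_mulVec, ← mulVec_mulVec, hf, mulVec_smul] at h2
      have h3 := congrFun h2 ω
      rw [mulVec_diagonal] at h3
      simpa using h3.symm
    have h4 : (lam ω - μ) * (P *ᵥ f) ω = 0 := by rw [sub_mul, h1, sub_self]
    rcases mul_eq_zero.1 h4 with h | h
    · linarith
    · simpa using h
  let φ : largeEigenspace M t →ₗ[ℝ] ({ω // t ≤ lam ω} → ℝ) :=
    (LinearMap.pi fun ω : {ω // t ≤ lam ω} => (LinearMap.proj (ω : Ω)).comp P.mulVecLin).comp
      (largeEigenspace M t).subtype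
  have hφ : Function.Injective φ := by
    rw [injective_iff_map_eq_zero]
    rintro ⟨f, hf⟩ h
    have h0 : P *ᵥ f = 0 := by
      funext ω
      by_cases hω : t ≤ lam ω
      · exact congrFun h ⟨ω, hω⟩
      · simpa using hker ω (not_le.1 hω) hf
    have h1 : f = 0 := by rw [← one_mulVec f, ← hP, ← mulVec_mulVec, h0, mulVec_zero]
    exact Subtype.ext h1
  have h := LinearMap.finrank_le_finrank_of_injective hφ
  rwa [Module.finrank_fintype_fun_eq_card] at h

/-- The number of computed eigenvalues above `t`, by a margin for the off-diagonal part, is at most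
the number of eigenvalues that are at least `t`. -/
theorem card_le_of_isJacobiState {M : Matrix ι ι ℝ} {P : Matrix Ω ι ℝ} {lam : Ω → ℝ}
    (hP : Pᵀ * P = 1) (hPM : P * M = diagonal lam * P) {t e : ℝ} (he : 0 ≤ e)
    {A Q : ι → ι → ℝ} (hS : IsJacobiState M (A, Q)) (hoff : offDiagSq (of A) ≤ e ^ 2)
    (S : Finset ι) (hSA : ∀ s ∈ S, t + e < A s s) :
    S.card ≤ Fintype.card {ω // t ≤ lam ω} := by
  obtain ⟨hQ, hA⟩ := hS
  simp only at hQ hA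
  let ext : (S → ℝ) →ₗ[ℝ] (ι → ℝ) := LinearMap.pi fun i =>
    if h : i ∈ S then LinearMap.proj (⟨i, h⟩ : S) else 0
  have hext : ∀ c (s : S), ext c s = c s := fun c s => by simp [ext]
  have hext' : ∀ c, ∀ i ∉ S, ext c i = 0 := fun c i hi => by simp [ext, hi]
  let φ : (S → ℝ) →ₗ[ℝ] ({ω // t ≤ lam ω} → ℝ) :=
    (LinearMap.pi fun ω : {ω // t ≤ lam ω} => (LinearMap.proj (ω : Ω)).comp P.mulVecLin).comp
      ((of Q).mulVecLin.comp ext)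
  -- A kernel vector yields `x` in the span of the selected columns, orthogonal to all eigenvectors
  -- for eigenvalues at least `t`. Its Rayleigh quotient would be at most `t` by the latter but
  -- above `t` by the former, unless `x = 0`.
  have hφ : Function.Injective φ := by
    rw [injective_iff_map_eq_zero]
    intro c hc
    set c' := ext c with hc'
    set x := of Q *ᵥ c' with hx
    have hPx : ∀ ω, t ≤ lam ω → (P *ᵥ x) ω = 0 := fun ω hω => congrFun hc ⟨ω, hω⟩
    have h1 : x ⬝ᵥ M *ᵥ x = ∑ ω, lam ω * (P *ᵥ x) ω ^ 2 := by
      have h2 : M = Pᵀ * (diagonal lam * P) := by rw [← hPM, ← Matrix.mul_assoc, hP, Matrix.one_mul]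
      rw [h2, ← mulVec_mulVec, dotProduct_mulVec, vecMul_transpose, ← mulVec_mulVec, dotProduct]
      refine Finset.sum_congr rfl fun ω _ => ?_
      rw [mulVec_diagonal]
      ring
    have h2 : x ⬝ᵥ x = ∑ ω, (P *ᵥ x) ω ^ 2 := by
      have h3 : (P *ᵥ x) ⬝ᵥ (P *ᵥ x) = x ⬝ᵥ x := by
        rw [dotProduct_mulVec, ← mulVec_transpose, mulVec_mulVec, hP, one_mulVec]
      rw [← h3]
      exact Finset.sum_congr rfl fun _ _ => (sq _).symm
    have h3 : x ⬝ᵥ M *ᵥ x ≤ t * (x ⬝ᵥ x) := by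
      rw [h1, h2, Finset.mul_sum]
      refine Finset.sum_le_sum fun ω _ => ?_
      rcases le_or_gt t (lam ω) with h | h
      · simp [hPx ω h]
      · exact mul_le_mul_of_nonneg_right h.le (sq_nonneg _)
    have hquad := (abs_le.1 (abs_quadraticForm_sub_diag_le (of A) he hoff c')).1
    rw [hA, ← quadraticForm_mulVec, ← hx, ← hA] at hquad
    rw [hx, dotProduct_mulVec_of_orthogonal hQ, ← hx] at h3
    have h4 : ∑ i, (A i i - (t + e)) * c' i ^ 2 ≤ 0 := by
      have h5 : ∑ i, (A i i - (t + e)) * c' i ^ 2 =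
          ∑ i, of A i i * c' i ^ 2 - (t + e) * (c' ⬝ᵥ c') := by
        simp only [sub_mul, Finset.sum_sub_distrib, ← Finset.mul_sum, dotProduct, sq, of_apply]
      rw [h5]
      linarith
    have hnn : ∀ i ∈ Finset.univ, 0 ≤ (A i i - (t + e)) * c' i ^ 2 := by
      intro i _
      by_cases hi : i ∈ S
      · exact mul_nonneg (by linarith [hSA i hi]) (sq_nonneg _)
      · simp [hc', hext' c i hi]
    have h6 := (Finset.sum_eq_zero_iff_of_nonneg hnn).1
      (le_antisymm h4 (Finset.sum_nonneg hnn))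
    funext s
    have h7 := h6 s (Finset.mem_univ _)
    rw [hc', hext] at h7
    rcases mul_eq_zero.1 h7 with h | h
    · linarith [hSA s s.2]
    · exact pow_eq_zero_iff two_ne_zero |>.1 h
  have h := LinearMap.finrank_le_finrank_of_injective hφ
  rwa [Module.finrank_fintype_fun_eq_card, Module.finrank_fintype_fun_eq_card,
    Fintype.card_coe] at h

end SpectralCount

/-! ### Counting characters of low weight -/

section LowDegree

variable {k : ℕ}

/-- The number of points of low weight. -/
theorem card_hammingNorm_le (k w : ℕ) :
    Fintype.card {ω : KVCube k // hammingNorm ω ≤ w} ≤ (w + 1) * (2 ^ k) ^ w := by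
  classical
  have h1 : Fintype.card {ω : KVCube k // hammingNorm ω ≤ w} ≤
      ((Finset.range (w + 1)).biUnion fun i =>
        Finset.powersetCard i (Finset.univ : Finset (KVLabel k))).card := by
    rw [Fintype.card_subtype]
    refine Finset.card_le_card_of_injOn (fun ω => Finset.univ.filter fun x => ω x ≠ 0) ?_ ?_
    · intro ω hω
      have hω' : hammingNorm ω ≤ w := by simpa using hω
      simp only [Finset.coe_biUnion, Set.mem_iUnion, Finset.mem_coe, Finset.mem_powersetCard,
        Finset.mem_range]
      exact ⟨hammingNorm ω, by omega, Finset.subset_univ _, rfl⟩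
    · intro ω _ ω' _ h
      funext x
      have hx := Finset.ext_iff.1 h x
      simp only [Finset.mem_filter, Finset.mem_univ, true_and] at hx
      rcases zmod_two_cases (ω x) with h1 | h1 <;> rcases zmod_two_cases (ω' x) with h2 | h2 <;>
        simp_all
  refine h1.trans (Finset.card_biUnion_le.trans ?_)
  have h2 : ∀ i ∈ Finset.range (w + 1),
      (Finset.powersetCard i (Finset.univ : Finset (KVLabel k))).card ≤ (2 ^ k) ^ w := by
    intro i hi
    rw [Finset.card_powersetCard, Finset.card_univ, card_kvLabel]
    exact (Nat.choose_le_pow _ _).trans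
      (Nat.pow_le_pow_right (by positivity) (Nat.lt_succ_iff.1 (Finset.mem_range.1 hi)))
  simpa using Finset.sum_le_card_nsmul _ _ _ h2

/-- Large eigenvalues of the noisy cube belong to characters of low weight. -/
theorem le_div_of_pow_ge {ε γ : ℝ} (hε : 0 < ε) (hε' : ε ≤ 1 / 2) (hγ' : γ ≤ 1 / 2)
    {j : ℕ} (h : 1 - γ ≤ (1 - 2 * ε) ^ j) : (j : ℝ) ≤ γ / ε := by
  have h1 : (1 - 2 * ε) ^ j ≤ Real.exp (-(2 * ε * j)) := by
    have h2 : 1 - 2 * ε ≤ Real.exp (-(2 * ε)) := by linarith [Real.add_one_le_exp (-(2 * ε))]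
    refine (pow_le_pow_left₀ (by linarith) h2 j).trans_eq ?_
    rw [← Real.exp_nat_mul]
    congr 1
    ring
  -- Hence `2εj ≤ γ / (1 - γ) ≤ 2γ`, the last step by `γ ≤ 1/2`.
  have h3 : (1 - γ) * (1 + 2 * ε * j) ≤ 1 := by
    have h4 : 1 + 2 * ε * j ≤ Real.exp (2 * ε * j) := by linarith [Real.add_one_le_exp (2 * ε * j)]
    have h5 : Real.exp (-(2 * ε * j)) * Real.exp (2 * ε * j) = 1 := by
      rw [← Real.exp_add, neg_add_cancel, Real.exp_zero]
    exact (mul_le_mul (h.trans h1) h4 (by positivity) (Real.exp_nonneg _)).trans_eq h5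
  rw [le_div_iff₀ hε]
  have : 0 ≤ ε * j := by positivity
  nlinarith

/-- The number of eigenvalues of the noisy cube that are at least `(1 - C * √ε) * n`. -/
theorem card_eigenvalues_le (k : ℕ) {C ε : ℝ} (hC : 0 < C) (hε : 0 < ε) (hε' : ε ≤ 1 / 2)
    (hγ : C * Real.sqrt ε ≤ 1 / 2) :
    (Fintype.card {ω : KVCube k // (1 - C * Real.sqrt ε) * 2 ^ k ≤
      (2 : ℝ) ^ k * (1 - 2 * ε) ^ hammingNorm ω} : ℝ) ≤
      (C / Real.sqrt ε + 1) * ((2 : ℝ) ^ k) ^ (C / Real.sqrt ε) := by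
  classical
  have hs : 0 < Real.sqrt ε := Real.sqrt_pos.2 hε
  have h1 : ∀ ω : KVCube k, (1 - C * Real.sqrt ε) * 2 ^ k ≤
      (2 : ℝ) ^ k * (1 - 2 * ε) ^ hammingNorm ω → hammingNorm ω ≤ ⌊C / Real.sqrt ε⌋₊ := by
    intro ω h
    rw [mul_comm] at h
    have h2 := le_div_of_pow_ge hε hε' hγ (le_of_mul_le_mul_left h (by positivity))
    refine Nat.le_floor (h2.trans_eq ?_)
    rw [div_eq_div_iff hε.ne' hs.ne', mul_assoc, Real.mul_self_sqrt hε.le]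
  have h2 := (Fintype.card_subtype_mono _ _ h1).trans (card_hammingNorm_le k ⌊C / Real.sqrt ε⌋₊)
  have h3 : (⌊C / Real.sqrt ε⌋₊ : ℝ) ≤ C / Real.sqrt ε := Nat.floor_le (by positivity)
  have h4 : (1 : ℝ) ≤ 2 ^ k := one_le_pow₀ one_le_two
  calc _ ≤ (((⌊C / Real.sqrt ε⌋₊ + 1) * (2 ^ k) ^ ⌊C / Real.sqrt ε⌋₊ : ℕ) : ℝ) := by
        exact_mod_cast h2
    _ = (⌊C / Real.sqrt ε⌋₊ + 1) * ((2 : ℝ) ^ k) ^ (⌊C / Real.sqrt ε⌋₊ : ℝ) := by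
        push_cast
        rw [Real.rpow_natCast]
    _ ≤ _ := by gcongr

end LowDegree

/-! ### Step counts -/

section RunningTime

open Timed

variable {v q : ℕ} [NeZero q]

theorem readOff_steps_le (x : Fin v × Fin q → ℝ) : (readOff x).steps ≤ v * (q * 4 + 1) := by
  refine (table_steps_le _ (q * 4 + 1) fun u => Nat.succ_le_succ ?_).trans_eq (by simp)
  refine (forEach_steps_le _ _ _ 4 fun i _ s => ?_).trans_eq (by simp)
  simp

theorem evaluate_steps_le {v q : ℕ} (M : Fin v × Fin q → Fin v × Fin q → ℝ) (L : Fin v → Fin q) :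
    (evaluate M L).steps ≤ v * (v * 4 + 1) := by
  refine (sum_steps_le _ (v * 4 + 1) fun u => Nat.succ_le_succ ?_).trans_eq (by simp)
  exact (sum_steps_le _ 4 fun i => by simp).trans_eq (by simp)

theorem improve_steps_le (M : Fin v × Fin q → Fin v × Fin q → ℝ) (x : Fin v × Fin q → ℝ)
    (o : Option ((Fin v → Fin q) × ℝ)) :
    (improve M x o).steps ≤ v * (q * 4 + 1) + (v * (v * 4 + 1) + 1) := by
  unfold improve
  refine bind_steps_le (readOff_steps_le x) fun L => bind_steps_le (evaluate_steps_le M L)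
    fun val => ?_
  cases o with
  | none => simp
  | some b => simp

/-- `X` dominates the work at a leaf and the overhead of a round. The summand `X` on the left makes
the induction close: it pays for that overhead, and the factor 2 per level restores it. -/
theorem search_steps_le (M Q : Fin v × Fin q → Fin v × Fin q → ℝ) (h : ℝ) (r X : ℕ)
    (hX1 : v * (q * 4 + 1) + (v * (v * 4 + 1) + 1) ≤ X) (hX2 : v * q * 5 + 6 ≤ X)
    (l : List (Fin v × Fin q)) (x : Fin v × Fin q → ℝ) (norm2 : ℝ)
    (o : Option ((Fin v → Fin q) × ℝ)) :
    (search M Q h r l x norm2 o).steps + X ≤ X * (2 * (2 * (2 * r + 1)) ^ l.length) := by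
  induction l generalizing x norm2 o with
  | nil =>
    have := (improve_steps_le M x o).trans hX1
    simp only [search, List.length_nil, pow_zero]
    omega
  | cons s l ih =>
    have h1 : (search M Q h r (s :: l) x norm2 o).steps ≤
        (2 * r + 1) * (X * (2 * (2 * (2 * r + 1)) ^ l.length)) := by
      refine (forEach_steps_le _ _ _ _ fun j _ o => ?_).trans_eq (by rw [List.length_range])
      have key : ∀ x norm2, (search M Q h r l x norm2 o).steps + (v * q * 5 + 6) ≤
          X * (2 * (2 * (2 * r + 1)) ^ l.length) := fun x norm2 => by
        have := ih x norm2 o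
        omega
      rw [bind_steps, bind_steps, bind_steps, bind_steps, bind_steps, ite_steps, bind_steps]
      generalize hT : (search (v := v) (q := q) _ _ _ _ _ _ _ _).steps = T
      generalize ht : (Timed.table (ι := Fin v × Fin q) (α := ℝ) _).steps = t
      have hT' : T + (v * q * 5 + 6) ≤ X * (2 * (2 * (2 * r + 1)) ^ l.length) := by
        rw [← hT]
        exact key _ _
      have ht' : t ≤ v * q * 5 := by
        rw [← ht]
        exact (table_steps_le _ 5 fun i => by simp).trans_eq (by simp)
      have hlt : ∀ x y, (Timed.lt x y).steps = 1 := fun _ _ => rfl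
      rw [hlt]
      generalize (Timed.lt _ _).val = b
      simp only [Timed.ofInt, Timed.mul, Timed.add, pure_steps]
      cases b <;> simp <;> omega
    have h3 : 1 ≤ (2 * r + 1) * (2 * (2 * (2 * r + 1)) ^ l.length) := Nat.succ_le_of_lt (by positivity)
    have h4 := Nat.mul_le_mul_left X h3
    rw [List.length_cons, pow_succ]
    nlinarith

theorem collectAbove_steps_le {v q : ℕ} (A : Fin v × Fin q → Fin v × Fin q → ℝ) (τ : ℝ)
    (l : List (Fin v × Fin q)) : (collectAbove A τ l).steps ≤ l.length * 3 :=
  forEach_steps_le _ _ _ _ fun i _ s => by simp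

theorem mainAlgorithm_steps_le (M : Fin v × Fin q → Fin v × Fin q → ℝ) (ε γ K : ℝ) :
    (mainAlgorithm M ε γ K).steps ≤
      v * q * (v * q * 2 + 1) + (⌈4 / ε⌉₊ + 1) +
      (v * q * (v * q * 2 + 1) + ((v * q) ^ 2 * (v * q + ⌈4 / ε⌉₊)) * (34 * (v * q) ^ 2 + 18)) +
      v * q * 3 + ((collectedBasis M ε γ).length + 1) + (⌊1 / netMesh M ε γ⌋₊ + 1) + v * q +
      (4 * (v * q) ^ 2 + 6 * (v * q) + 6) *
        (2 * (2 * (2 * ⌊1 / netMesh M ε γ⌋₊ + 1)) ^ (collectedBasis M ε γ).length) + 40 := by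
  have hq : q ≠ 0 := NeZero.ne q
  have hcard : Fintype.card (Fin v × Fin q) = v * q := by simp
  have h1 : (Timed.sum fun a => Timed.sum fun b => read (M a) b).steps ≤
      v * q * (v * q * 2 + 1) := by
    rw [← hcard]
    exact sum_steps_le _ _ fun a => Nat.succ_le_succ (sum_steps_le _ _ fun b => by simp)
  have h2 := jacobi_steps_le (allPositions v q) length_allPositions M
    ((v * q) ^ 2 * (v * q + ⌈4 / ε⌉₊))
  rw [hcard] at h2
  have h3 := collectAbove_steps_le (computedEigenbasis M ε).1 (eigenvalueThreshold M ε γ)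
    (allPositions v q)
  rw [length_allPositions, hcard] at h3
  have h4 : (Timed.table fun _ : Fin v × Fin q => (pure 0 : Timed ℝ)).steps ≤ v * q * 1 := by
    rw [← hcard]
    exact table_steps_le _ _ fun a => by simp
  have hvm : v ≤ v * q := Nat.le_mul_of_pos_right v (Nat.pos_of_ne_zero hq)
  have h5 := search_steps_le M (computedEigenbasis M ε).2 (netMesh M ε γ) ⌊1 / netMesh M ε γ⌋₊
    (4 * (v * q) ^ 2 + 6 * (v * q) + 6) (by nlinarith) (by nlinarith) (collectedBasis M ε γ)
    (fun _ => 0) 0 none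
  unfold mainAlgorithm
  unfold netMesh collectedBasis eigenvalueThreshold
    computedEigenbasis computedTotal allPositions collectAbove at *
  have hs : (Timed.sum fun a => Timed.sum fun b => (⟨M a b, 1⟩ : Timed ℝ)).val =
    ∑ a, ∑ b, M a b := rfl
  simp only [bind_steps, Timed.read, Timed.div, Timed.ofInt, Timed.ceil, Timed.mul,
    Timed.add, Timed.sub, Timed.length, Timed.sqrt, Timed.floor, hs] at *
  generalize (jacobi (ι := Fin v × Fin q) _ _ _).steps = sJ at *
  generalize (jacobi (ι := Fin v × Fin q) _ _ _).val = E at *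
  generalize (forEach (σ := List (Fin v × Fin q)) _ _ _).steps = sC at *
  generalize (forEach (σ := List (Fin v × Fin q)) _ _ _).val = l at *
  generalize ⌊(_ : ℝ)⌋₊ = r at *
  have h4' : (Timed.table fun _ : Fin v × Fin q => (pure 0 : Timed ℝ)).val = fun _ => 0 := rfl
  rw [h4']
  generalize (search (v := v) (q := q) _ _ _ _ _ _ _ _).steps = sS at *
  generalize (search (v := v) (q := q) _ _ _ _ _ _ _ _).val = o at *
  generalize (Timed.sum (ι := Fin v × Fin q) _).steps = sT at *
  generalize (Timed.table (ι := Fin v × Fin q) (α := ℝ) _).steps = sZ at *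
  generalize ⌈4 / ε⌉₊ = acc at *
  generalize (2 * (2 * r + 1)) ^ l.length = P at *
  generalize l.length = D at *
  generalize hmatch : Timed.steps _ = sM
  have hsM : sM ≤ 8 := by
    rw [← hmatch]
    cases o with
    | none => simp
    | some b => simp only [Timed.lt, bind_steps, ite_steps, pure_steps, ite_self]; omega
  linarith

/-- The running time, with all the polynomial factors collected. -/
theorem mainAlgorithm_steps_le_mul (hv : v ≠ 0) (M : Fin v × Fin q → Fin v × Fin q → ℝ)
    (ε γ K : ℝ) :
    (mainAlgorithm M ε γ K).steps ≤ 256 * ((v * q) ^ 5 * (⌈4 / ε⌉₊ + 1) *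
      (2 * (2 * ⌊1 / netMesh M ε γ⌋₊ + 1)) ^ (collectedBasis M ε γ).length) := by
  refine (mainAlgorithm_steps_le M ε γ K).trans ?_
  have hq : q ≠ 0 := NeZero.ne q
  have hm : 1 ≤ v * q := Nat.one_le_iff_ne_zero.2 (mul_ne_zero hv hq)
  have hD : (collectedBasis M ε γ).length ≤ v * q := by
    have h := (nodup_collectedBasis M ε γ).length_le_card
    rwa [Fintype.card_prod, Fintype.card_fin, Fintype.card_fin] at h
  have hr : ⌊1 / netMesh M ε γ⌋₊ ≤
      (2 * (2 * ⌊1 / netMesh M ε γ⌋₊ + 1)) ^ (collectedBasis M ε γ).length := by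
    -- For an empty basis the mesh is `0`, and so is `⌊1 / 0⌋₊` by convention.
    rcases Nat.eq_zero_or_pos (collectedBasis M ε γ).length with h0 | h0
    · simp [netMesh, h0]
    · exact le_trans (by omega) (Nat.le_self_pow h0.ne' _)
  have hP : 1 ≤ (2 * (2 * ⌊1 / netMesh M ε γ⌋₊ + 1)) ^ (collectedBasis M ε γ).length :=
    Nat.one_le_pow _ _ (by omega)
  generalize (2 * (2 * ⌊1 / netMesh M ε γ⌋₊ + 1)) ^ (collectedBasis M ε γ).length = P at *
  generalize ⌊1 / netMesh M ε γ⌋₊ = r at *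
  generalize (collectedBasis M ε γ).length = D at *
  generalize ⌈4 / ε⌉₊ = acc at *
  generalize v * q = m at *
  have hT : ∀ i, i ≤ 5 → m ^ i ≤ m ^ 5 := fun i hi => Nat.pow_le_pow_right hm hi
  have hbig : ∀ a b c : ℕ, a ≤ m ^ 5 → b ≤ acc + 1 → c ≤ P →
      a * b * c ≤ m ^ 5 * (acc + 1) * P := fun a b c ha hb hc =>
    Nat.mul_le_mul (Nat.mul_le_mul ha hb) hc
  have h0 := hbig 1 1 1 (Nat.one_le_pow _ _ hm) (by omega) hP
  have h1 := hbig (m ^ 1) 1 1 (hT 1 (by omega)) (by omega) hP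
  have h2 := hbig (m ^ 2) 1 1 (hT 2 (by omega)) (by omega) hP
  have h3 := hbig 1 (acc + 1) 1 (Nat.one_le_pow _ _ hm) le_rfl hP
  have h4 := hbig (m ^ 5) (acc + 1) 1 le_rfl le_rfl hP
  have h5 := hbig 1 1 P (Nat.one_le_pow _ _ hm) (by omega) le_rfl
  have h6 := hbig (m ^ 2) 1 P (hT 2 (by omega)) (by omega) le_rfl
  have h7 := hbig (m ^ 1) 1 P (hT 1 (by omega)) (by omega) le_rfl
  have h8 : m ^ 2 * (m + acc) * (34 * m ^ 2 + 18) ≤ 52 * (m ^ 5 * (acc + 1)) := by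
    have e1 : m + acc ≤ m * (acc + 1) := by nlinarith
    have e2 : 34 * m ^ 2 + 18 ≤ 52 * m ^ 2 := by nlinarith
    calc m ^ 2 * (m + acc) * (34 * m ^ 2 + 18)
        ≤ m ^ 2 * (m * (acc + 1)) * (52 * m ^ 2) :=
          Nat.mul_le_mul (Nat.mul_le_mul_left _ e1) e2
      _ = 52 * (m ^ 5 * (acc + 1)) := by ring
  generalize m ^ 5 * (acc + 1) * P = T at *
  nlinarith

end RunningTime

/-! ### Quantitative bounds on the Khot–Vishnoi instances -/

section Main

open Matrix Timed

theorem collectedBasis_length_le {v q : ℕ} [NeZero q] {Ω : Type} [Fintype Ω] [DecidableEq Ω]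
    {M : Fin v × Fin q → Fin v × Fin q → ℝ} {d ε γ : ℝ} (hv : v ≠ 0) (hd : 0 ≤ d) (hε : 0 < ε)
    (hM : (of M)ᵀ = of M) (hnn : ∀ a b, 0 ≤ M a b) (hrow : ∀ a, ∑ b, M a b = d)
    {P : Matrix Ω (Fin v × Fin q) ℝ} {lam : Ω → ℝ} (hP : Pᵀ * P = 1)
    (hPM : P * of M = diagonal lam * P) :
    (collectedBasis M ε γ).length ≤ Fintype.card {ω // (1 - γ) * d ≤ lam ω} := by
  obtain ⟨hS, hoff⟩ := offDiagSq_computedEigenbasis_le hε hM hnn hrow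
  rw [← List.toFinset_card_of_nodup (nodup_collectedBasis M ε γ)]
  refine card_le_of_isJacobiState (A := (computedEigenbasis M ε).1)
    (Q := (computedEigenbasis M ε).2) hP hPM (by positivity) hS hoff _ fun s hs => ?_
  rw [List.mem_toFinset, mem_collectedBasis, eigenvalueThreshold_eq hrow hv] at hs
  linarith

/-- The parameters of the running time analysis, with `u = 1 / √ε` and `E` a power of `n`. -/
theorem exponent_le {C u E D r : ℝ} (hC : 0 < C) (hu : 1 ≤ u) (hE : 1 ≤ E) (hD0 : 0 ≤ D)
    (hD : D ≤ (C + 1) * u * E) (hr : r ≤ (C * D + u) / 2) :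
    2 * (2 * r + 1) * D ≤ (2 * C * (C + 1) ^ 2 + 4 * (C + 1)) * (u ^ 2 * E ^ 2) := by
  have h1 : 2 * (2 * r + 1) * D ≤ 2 * C * (D * D) + 4 * u * D := by nlinarith
  have h2 : D * D ≤ ((C + 1) * u * E) * ((C + 1) * u * E) := mul_le_mul hD hD hD0 (by positivity)
  have h3 : u * D ≤ u * ((C + 1) * u * E) := mul_le_mul_of_nonneg_left hD (by linarith)
  have h4 : u ^ 2 * E ≤ u ^ 2 * E ^ 2 :=
    mul_le_mul_of_nonneg_left (le_self_pow₀ hE two_ne_zero) (sq_nonneg u)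
  nlinarith [mul_le_mul_of_nonneg_left h2 hC.le, mul_le_mul_of_nonneg_left h4
    (by linarith : 0 ≤ C + 1)]

theorem natCast_le_two_rpow (a : ℕ) : (a : ℝ) ≤ 2 ^ (a : ℝ) := by
  rw [Real.rpow_natCast]
  exact_mod_cast Nat.lt_two_pow_self.le

/-- For `γ = C√ε`, `1/h` is the root of `C D (1/√ε) / 2`; the mean inequality makes it linear in
`D`. -/
theorem inv_netMesh_le {v q : ℕ} [NeZero q] (M : Fin v × Fin q → Fin v × Fin q → ℝ) {C ε : ℝ}
    (hC : 0 < C) (hε : 0 < ε) :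
    (⌊1 / netMesh M ε (C * Real.sqrt ε)⌋₊ : ℝ) ≤
      (C * (collectedBasis M ε (C * Real.sqrt ε)).length + 1 / Real.sqrt ε) / 2 := by
  have hs : 0 < Real.sqrt ε := Real.sqrt_pos.2 hε
  refine (Nat.floor_le (by unfold netMesh; positivity)).trans ?_
  rw [netMesh, Int.cast_natCast, one_div, ← Real.sqrt_inv, inv_div]
  have hD : (0 : ℝ) ≤ (collectedBasis M ε (C * Real.sqrt ε)).length := Nat.cast_nonneg _
  generalize ((collectedBasis M ε (C * Real.sqrt ε)).length : ℝ) = D at hD ⊢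
  refine Real.sqrt_le_iff.2 ⟨by positivity, ?_⟩
  have h1 : C * Real.sqrt ε * D / (2 * ε) = C * D * (1 / Real.sqrt ε) / 2 := by
    rw [div_eq_div_iff (by positivity) two_ne_zero]
    field_simp
    rw [Real.sq_sqrt hε.le]
    ring
  rw [h1]
  have h2 : 0 ≤ C * D * (1 / Real.sqrt ε) := by positivity
  nlinarith [sq_nonneg (C * D - 1 / Real.sqrt ε)]

theorem two_rpow_bound {m acc D r k : ℕ} {C ε : ℝ} (hC : 0 < C) (hε : 0 < ε) (hε1 : ε ≤ 1)
    (hm : m = 2 ^ 2 ^ k) (hacc : (acc : ℝ) ≤ 4 / ε + 1)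
    (hD : (D : ℝ) ≤ (C / Real.sqrt ε + 1) * ((2 : ℝ) ^ k) ^ (C / Real.sqrt ε))
    (hr : (r : ℝ) ≤ (C * D + 1 / Real.sqrt ε) / 2) :
    ((256 * (m ^ 5 * (acc + 1) * (2 * (2 * r + 1)) ^ D) : ℕ) : ℝ) ≤
      2 ^ ((2 : ℝ) ^ k * ((19 + 2 * C * (C + 1) ^ 2 + 4 * (C + 1) + 2 * C) / ε *
        ((2 : ℝ) ^ k) ^ ((19 + 2 * C * (C + 1) ^ 2 + 4 * (C + 1) + 2 * C) / ε))) := by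
  have hs : 0 < Real.sqrt ε := Real.sqrt_pos.2 hε
  have hs1 : Real.sqrt ε ≤ 1 := Real.sqrt_le_one.2 hε1
  set u := 1 / Real.sqrt ε with hu
  have hu1 : 1 ≤ u := by rw [hu, le_div_iff₀ hs]; linarith
  have hu2 : 1 / ε = u ^ 2 := by rw [hu, div_pow, Real.sq_sqrt hε.le, one_pow]
  set n : ℝ := 2 ^ k with hn
  have hn1 : 1 ≤ n := one_le_pow₀ one_le_two
  -- Raising the exponent from `C u` to `C u²` brings it to the form constant over `ε`, as `u² = 1 /
  -- ε`.
  set E : ℝ := n ^ (C * u ^ 2) with hE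
  have hE1 : 1 ≤ E := Real.one_le_rpow hn1 (by positivity)
  have hD' : (D : ℝ) ≤ (C + 1) * u * E := by
    refine hD.trans (mul_le_mul ?_ ?_ (by positivity) (by positivity))
    · rw [div_eq_mul_one_div, ← hu]
      nlinarith
    · refine Real.rpow_le_rpow_of_exponent_le hn1 ?_
      rw [div_eq_mul_one_div, ← hu]
      nlinarith [mul_nonneg hC.le (mul_nonneg (by linarith : 0 ≤ u) (by linarith : 0 ≤ u - 1))]
  have hexp := exponent_le hC hu1 hE1 (Nat.cast_nonneg D) hD' hr
  -- `19 = 8 + 5 + 4 + 2` collects the exponents of `256`, `m ^ 5` and `acc + 1`; the middle terms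
  -- come from `exponent_le`, and `2 * C` ensures `E ^ 2 ≤ n ^ (B / ε)`.
  set B := 19 + 2 * C * (C + 1) ^ 2 + 4 * (C + 1) + 2 * C with hB
  have hB0 : 0 < B := by positivity
  -- the factors as powers of two
  have f1 : (m : ℝ) ^ 5 = 2 ^ (5 * n) := by
    rw [hm, hn]
    push_cast
    rw [← pow_mul, ← Real.rpow_natCast]
    congr 1
    push_cast
    ring
  have f2 : ((acc + 1 : ℕ) : ℝ) ≤ 2 ^ (4 * u ^ 2 + 2) := by
    refine (natCast_le_two_rpow _).trans (Real.rpow_le_rpow_of_exponent_le one_le_two ?_)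
    push_cast
    rw [← hu2]
    linarith [show 4 * (1 / ε) = 4 / ε by ring]
  -- The crude bound `a ≤ 2 ^ a` on the base suffices, since the exponent may be any polynomial in
  -- `n` for fixed `ε`.
  have f3 : (((2 * (2 * r + 1)) ^ D : ℕ) : ℝ) ≤ 2 ^ (2 * (2 * r + 1) * D : ℝ) := by
    rw [Real.rpow_mul two_pos.le, Real.rpow_natCast]
    push_cast
    refine pow_le_pow_left₀ (by positivity) ?_ _
    have := natCast_le_two_rpow (2 * (2 * r + 1))
    push_cast at this
    exact this
  calc ((256 * (m ^ 5 * (acc + 1) * (2 * (2 * r + 1)) ^ D) : ℕ) : ℝ)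
      = 2 ^ (8 : ℝ) * ((m : ℝ) ^ 5 * ((acc + 1 : ℕ) : ℝ) * (((2 * (2 * r + 1)) ^ D : ℕ) : ℝ)) := by
        rw [Nat.cast_mul, Nat.cast_mul, Nat.cast_mul, Nat.cast_pow]
        norm_num
    _ ≤ 2 ^ (8 : ℝ) * (2 ^ (5 * n) * 2 ^ (4 * u ^ 2 + 2) * 2 ^ (2 * (2 * r + 1) * D : ℝ)) := by
        rw [f1]
        gcongr
    _ = 2 ^ (8 + (5 * n + (4 * u ^ 2 + 2) + 2 * (2 * r + 1) * D)) := by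
        simp only [Real.rpow_add two_pos]
    _ ≤ _ := by
        refine Real.rpow_le_rpow_of_exponent_le one_le_two ?_
        have g1 : E ^ 2 ≤ n ^ (B / ε) := by
          rw [hE, ← Real.rpow_natCast, ← Real.rpow_mul (by linarith)]
          refine Real.rpow_le_rpow_of_exponent_le hn1 ?_
          rw [div_eq_mul_one_div, hu2]
          push_cast
          have : 2 * C ≤ B := by rw [hB]; nlinarith [mul_pos hC (sq_pos_of_pos (by linarith : 0 < C + 1))]
          nlinarith [sq_nonneg u]
        have g2 : n * (B / ε * E ^ 2) ≤ n * (B / ε * n ^ (B / ε)) := by gcongr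
        refine le_trans ?_ g2
        rw [div_eq_mul_one_div, hu2]
        have hE2 : 1 ≤ E ^ 2 := one_le_pow₀ hE1
        have hu3 : 1 ≤ u ^ 2 := one_le_pow₀ hu1
        have h1 : u ^ 2 ≤ u ^ 2 * E ^ 2 := le_mul_of_one_le_right (by positivity) hE2
        have h2 : u ^ 2 * E ^ 2 ≤ n * (u ^ 2 * E ^ 2) := le_mul_of_one_le_left (by positivity) hn1
        have h3 : n ≤ n * (u ^ 2 * E ^ 2) := le_mul_of_one_le_right (by linarith) (by linarith)
        have h4 : n * (B * u ^ 2 * E ^ 2) = B * (n * (u ^ 2 * E ^ 2)) := by ring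
        rw [h4]
        have h5 : 2 * (2 * (r : ℝ) + 1) * D ≤
            (2 * C * (C + 1) ^ 2 + 4 * (C + 1)) * (n * (u ^ 2 * E ^ 2)) :=
          hexp.trans (mul_le_mul_of_nonneg_left h2 (by positivity))
        have h6 : 0 ≤ 2 * C * (n * (u ^ 2 * E ^ 2)) := by positivity
        rw [hB]
        nlinarith

/-- The orthogonal diagonalization of the label-extended graph, for a numbering of its vertices. -/
theorem fourierMatrix_submatrix {k : ℕ} {ι : Type} [Fintype ι] [DecidableEq ι]
    (e : ι ≃ KVCube k) :
    ((fourierMatrix k).submatrix id e)ᵀ * (fourierMatrix k).submatrix id e = 1 := by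
  have h : (fourierMatrix k)ᵀ * fourierMatrix k = 1 :=
    mul_eq_one_comm.1 (fourierMatrix_mul_transpose k)
  rw [transpose_submatrix, ← submatrix_mul _ _ e id e Function.bijective_id, h,
    submatrix_one_equiv]

theorem fourierMatrix_submatrix_mul {k : ℕ} {ι : Type} [Fintype ι] [DecidableEq ι]
    (e : ι ≃ KVCube k) (ε : ℝ) :
    (fourierMatrix k).submatrix id e * (noisyCube k ε).submatrix e e =
      diagonal (fun ω : KVCube k => (2 : ℝ) ^ k * (1 - 2 * ε) ^ hammingNorm ω) *
        (fourierMatrix k).submatrix id e := by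
  rw [submatrix_mul_equiv _ _ id e e, fourierMatrix_mul_noisyCube]
  ext ω a
  simp [diagonal_mul]

theorem finrank_khotVishnoi_le {k : ℕ} {C ε : ℝ} (hε : ε ∈ Set.Icc (0 : ℝ) 1)
    {rep : KVVertex k → KVCube k}
    (hrep : ∀ x : KVVertex k, (QuotientAddGroup.mk (rep x) : KVVertex k) = x)
    (hC : 0 < C) (hε0 : 0 < ε) (hε' : ε ≤ 1 / 2) (hγ : C * Real.sqrt ε ≤ 1 / 2) :
    (Module.finrank ℝ (largeEigenspace (khotVishnoi k ε hε rep).labelExtended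
      ((1 - C * Real.sqrt ε) * (2 : ℝ) ^ k)) : ℝ) ≤
      (C / Real.sqrt ε + 1) * ((2 : ℝ) ^ k) ^ (C / Real.sqrt ε) := by
  classical
  let e := Equiv.ofBijective _ (kvPoint_bijective hrep)
  refine le_trans ?_ (card_eigenvalues_le k hC hε0 hε' hγ)
  rw [khotVishnoi_labelExtended hε rep]
  exact Nat.cast_le.2 (finrank_largeEigenspace_le (fourierMatrix_submatrix e)
    (fourierMatrix_submatrix_mul e ε) _)

/-- The run of the algorithm on a numbered Khot–Vishnoi instance. -/
theorem mainAlgorithm_khotVishnoi {k : ℕ} {C ε : ℝ} (hε : ε ∈ Set.Icc (0 : ℝ) 1)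
    {rep : KVVertex k → KVCube k}
    (hrep : ∀ x : KVVertex k, (QuotientAddGroup.mk (rep x) : KVVertex k) = x)
    (hC : 0 < C) (hε0 : 0 < ε) (hε' : ε ≤ 1 / 2) (hγ : C * Real.sqrt ε ≤ 1 / 2)
    {v q : ℕ} [NeZero q] (eV : KVVertex k ≃ Fin v) (eK : KVLabel k ≃ Fin q) (K : ℝ)
    {M : Fin v × Fin q → Fin v × Fin q → ℝ}
    (hM : of M = (khotVishnoi k ε hε rep).labelExtended.reindex
      (eV.prodCongr eK) (eV.prodCongr eK)) :
    ((mainAlgorithm M ε (C * Real.sqrt ε) K).steps : ℝ) ≤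
      2 ^ ((2 : ℝ) ^ k * ((19 + 2 * C * (C + 1) ^ 2 + 4 * (C + 1) + 2 * C) / ε *
        ((2 : ℝ) ^ k) ^ ((19 + 2 * C * (C + 1) ^ 2 + 4 * (C + 1) + 2 * C) / ε))) ∧
    (((2 : ℝ) ^ k) ^ (-ε) < targetFraction K ε (C * Real.sqrt ε) →
      (mainAlgorithm M ε (C * Real.sqrt ε) K).val = none) := by
  classical
  set U := khotVishnoi k ε hε rep with hU
  have hreg : U.IsRegular (2 ^ k) := khotVishnoi_isRegular hε hrep
  have hMa : ∀ a b, M a b = U.labelExtended ((eV.prodCongr eK).symm a)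
      ((eV.prodCongr eK).symm b) := fun a b => congrFun (congrFun hM a) b
  have hrow : ∀ a, ∑ b, M a b = 2 ^ k := fun a => by
    simp only [hMa]
    rw [(eV.prodCongr eK).symm.sum_comp fun b => U.labelExtended _ b]
    exact U.labelExtended_rowSum hreg _
  have hMt : (of M)ᵀ = of M := by
    rw [hM, transpose_reindex, U.labelExtended_transpose]
  have hnn : ∀ a b, 0 ≤ M a b := fun a b => (hMa a b) ▸ U.labelExtended_nonneg _ _
  have hcardV : Fintype.card (KVVertex k) = v := by
    rw [Fintype.card_congr eV, Fintype.card_fin]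
  have hv : v ≠ 0 := by
    rw [← hcardV]
    exact Fintype.card_ne_zero
  have hm : v * q = 2 ^ 2 ^ k := by
    have h := Fintype.card_of_bijective (kvPoint_bijective hrep)
    rwa [Fintype.card_prod, card_kvCube, hcardV, Fintype.card_congr eK, Fintype.card_fin] at h
  constructor
  · let e := (eV.prodCongr eK).symm.trans (Equiv.ofBijective _ (kvPoint_bijective hrep))
    have hMe : of M = (noisyCube k ε).submatrix e e := by
      rw [hM, hU, khotVishnoi_labelExtended hε rep]
      rfl
    have hD := collectedBasis_length_le (γ := C * Real.sqrt ε) hv (by positivity) hε0 hMt hnn hrow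
      (fourierMatrix_submatrix e) (hMe ▸ fourierMatrix_submatrix_mul e ε)
    have hD' : ((collectedBasis M ε (C * Real.sqrt ε)).length : ℝ) ≤
        (C / Real.sqrt ε + 1) * ((2 : ℝ) ^ k) ^ (C / Real.sqrt ε) :=
      (by exact_mod_cast hD : ((collectedBasis M ε (C * Real.sqrt ε)).length : ℝ) ≤ _).trans
        (card_eigenvalues_le k hC hε0 hε' hγ)
    refine (Nat.cast_le.2 (mainAlgorithm_steps_le_mul hv M ε (C * Real.sqrt ε) K)).trans ?_
    exact two_rpow_bound hC hε0 hε.2 hm (Nat.ceil_lt_add_one (by positivity)).le hD'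
      (inv_netMesh_le M hC hε0)
  · intro htarget
    have hev : IsEvaluated M (searchOutcome M ε (C * Real.sqrt ε)).val :=
      search_preserves (fun x o ho => isEvaluated_improve x ho) _ _ _ _ _ _ _ (by
        rintro b hb; cases hb)
    rw [mainAlgorithm_val]
    cases ho : (searchOutcome M ε (C * Real.sqrt ε)).val with
    | none => rfl
    | some b =>
      rw [Option.bind_some, if_pos]
      have htot : U.totalWeight = v * 2 ^ k := by rw [U.totalWeight_eq hreg, hcardV]
      -- The numbered labeling is pulled back along `eV` and `eK`, so the soundness bound applies to
      -- it.
      have hb : b.2 = U.satisfiedWeight fun x => eK.symm (b.1 (eV x)) := by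
        rw [hev b ho, evaluate_val, U.satisfiedWeight_eq, ← eV.symm.sum_comp]
        refine Finset.sum_congr rfl fun u _ => ?_
        rw [← eV.symm.sum_comp]
        refine Finset.sum_congr rfl fun u' _ => ?_
        rw [hMa]
        simp
      have hsat := khotVishnoi_satisfiesAtMost hε hε' hrep fun x => eK.symm (b.1 (eV x))
      rw [UniqueGame.SatisfiesAtMost, ← hU, ← hb, htot] at hsat
      rw [computedTotal_eq hrow]
      refine hsat.trans_lt (mul_lt_mul_of_pos_right htarget ?_)
      have : (0 : ℝ) < v := by exact_mod_cast Nat.pos_of_ne_zero hv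
      positivity

/-- The target fraction stays bounded away from `0` for small noise. -/
theorem half_le_targetFraction {C ε : ℝ} (hC : 0 < C) (hε : 0 < ε)
    (hs : Real.sqrt ε < C / (200 * (C + 1) ^ 2)) :
    1 / 2 ≤ targetFraction 16 ε (C * Real.sqrt ε) := by
  have hs0 : 0 < Real.sqrt ε := Real.sqrt_pos.2 hε
  have hsq := Real.mul_self_sqrt hε.le
  rw [lt_div_iff₀ (by positivity)] at hs
  rw [targetFraction]
  generalize Real.sqrt ε = s at *
  subst hsq
  have h1 : 200 * s < C := by nlinarith [mul_pos hs0 hC, mul_pos hs0 (mul_pos hC hC)]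
  have h2 : 200 * s < 1 := by nlinarith [mul_pos hs0 hC, mul_pos hs0 (mul_pos hC hC)]
  have h3 : s * s / (C * s - 8 * (s * s)) ≤ 1 / 100 := by
    rw [div_le_div_iff₀ (by nlinarith) (by norm_num)]
    nlinarith
  nlinarith

end Main

end

/-! ### Choice of the constants -/

theorem mainTheorem5 :
    ∃ K : ℝ, 0 < K ∧
      -- the algorithm never rejects an instance that is `(1 - ε)`-satisfiable
      (∀ (v q : ℕ) [NeZero q] (U : UniqueGame (Fin v) (Fin q)) (d ε γ : ℝ),
        U.IsRegular d → 0 < ε → 8 * ε < γ →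
        (∃ L, U.SatisfiesAtLeast L (1 - ε)) →
        ∃ L, (mainAlgorithm U.labelExtended ε γ K).val = some L ∧
          U.SatisfiesAtLeast L (targetFraction K ε γ)) ∧
      -- its run on the Khot–Vishnoi instances
      ∀ C : ℝ, 0 < C → ∃ ε₀ B : ℝ, 0 < ε₀ ∧ 0 < B ∧
        ∀ (ε : ℝ) (hε : ε ∈ Set.Icc (0 : ℝ) 1), 0 < ε → ε < ε₀ →
          8 * ε < C * Real.sqrt ε ∧
          ∃ k₀ : ℕ, ∀ (k : ℕ) (rep : KVVertex k → KVCube k),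
            (∀ x : KVVertex k, (QuotientAddGroup.mk (rep x) : KVVertex k) = x) →
            -- the label-extended graph is the noisy cube
            (khotVishnoi k ε hε rep).IsRegular ((2 : ℝ) ^ k) ∧
            Function.Bijective (kvPoint rep) ∧
            (khotVishnoi k ε hε rep).labelExtended =
              (noisyCube k ε).submatrix (kvPoint rep) (kvPoint rep) ∧
            -- its spectrum
            (∀ ω : KVCube k, (noisyCube k ε).mulVec (cubeCharacter ω) =
              ((2 : ℝ) ^ k * (1 - 2 * ε) ^ hammingNorm ω) • cubeCharacter ω) ∧
            LinearIndependent ℝ (fun ω : KVCube k => (cubeCharacter ω : KVCube k → ℝ)) ∧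
            Submodule.span ℝ
              (Set.range fun ω : KVCube k => (cubeCharacter ω : KVCube k → ℝ)) = ⊤ ∧
            -- the dimension of `W`
            (Module.finrank ℝ (largeEigenspace (khotVishnoi k ε hε rep).labelExtended
                ((1 - C * Real.sqrt ε) * (2 : ℝ) ^ k)) : ℝ) ≤
              1 / ε * ((2 : ℝ) ^ k) ^ (B / ε) ∧
            -- the instance is highly unsatisfiable
            (∀ L : KVVertex k → KVLabel k,
              (khotVishnoi k ε hε rep).SatisfiesAtMost L (((2 : ℝ) ^ k) ^ (-ε))) ∧
            -- running time and verdict, for every numbering of the vertices and the labels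
            ∀ (v q : ℕ) [NeZero q] (eV : KVVertex k ≃ Fin v) (eK : KVLabel k ≃ Fin q) (N : ℝ),
              N = 2 ^ (2 ^ k) →
              ((mainAlgorithm ((khotVishnoi k ε hε rep).labelExtended.reindex
                  (eV.prodCongr eK) (eV.prodCongr eK)) ε (C * Real.sqrt ε) K).steps : ℝ) ≤
                N ^ (B / ε * Real.logb 2 N ^ (B / ε)) ∧
              (k₀ ≤ k →
                (mainAlgorithm ((khotVishnoi k ε hε rep).labelExtended.reindex
                  (eV.prodCongr eK) (eV.prodCongr eK)) ε (C * Real.sqrt ε) K).val = none) := by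
  -- The choice of `ε₀` says `200 (C+1)² √ε < C`, which makes `√ε` small against `C`, `1` and `1 /
  -- (C + 1)` at once.
  refine ⟨16, by norm_num, fun v q _ U d ε γ hU hε hγ hsat =>
    mainAlgorithm_complete U rfl hU hε hγ hsat, fun C hC =>
    ⟨(C / (200 * (C + 1) ^ 2)) ^ 2, 19 + 2 * C * (C + 1) ^ 2 + 4 * (C + 1) + 2 * C,
      by positivity, by positivity, fun ε hε hε0 hεlt => ?_⟩⟩
  have hs0 : 0 < Real.sqrt ε := Real.sqrt_pos.2 hε0
  have hs : Real.sqrt ε < C / (200 * (C + 1) ^ 2) := (Real.sqrt_lt' (by positivity)).2 hεlt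
  have hsq := Real.mul_self_sqrt hε0.le
  have hs' := hs
  rw [lt_div_iff₀ (by positivity)] at hs'
  have hs1 : 200 * Real.sqrt ε < C := by
    nlinarith [mul_pos hs0 hC, mul_pos hs0 (mul_pos hC hC)]
  have hs2 : 200 * ((C + 1) * Real.sqrt ε) < 1 := by
    nlinarith [mul_pos hs0 hC, mul_pos hs0 (mul_pos hC hC)]
  have hs3 : Real.sqrt ε < 1 / 200 := by nlinarith [mul_pos hs0 hC]
  have hγ : C * Real.sqrt ε ≤ 1 / 2 := by nlinarith
  have hε' : ε ≤ 1 / 2 := by nlinarith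
  -- This `k₀` forces `k > 1/ε`, so that `n ^ (-ε) = 2 ^ (-kε) < 1/2`.
  refine ⟨by nlinarith, ⌈1 / ε⌉₊ + 1, fun k rep hrep =>
    ⟨khotVishnoi_isRegular hε hrep, kvPoint_bijective hrep, khotVishnoi_labelExtended hε rep,
      noisyCube_mulVec_character ε, linearIndependent_character k, span_character k, ?_,
      khotVishnoi_satisfiesAtMost hε hε' hrep, ?_⟩⟩
  · refine (finrank_khotVishnoi_le hε hrep hC hε0 hε' hγ).trans ?_
    have hC0 : C / Real.sqrt ε + 1 ≤ 1 / ε := by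
      rw [div_add_one hs0.ne', div_le_div_iff₀ hs0 hε0]
      nlinarith
    have hC1 : C / Real.sqrt ε ≤ (19 + 2 * C * (C + 1) ^ 2 + 4 * (C + 1) + 2 * C) / ε := by
      rw [div_le_div_iff₀ hs0 hε0]
      have h1 : C ≤ 19 + 2 * C * (C + 1) ^ 2 + 4 * (C + 1) + 2 * C := by
        have : 0 < 2 * C * (C + 1) ^ 2 := by positivity
        linarith
      exact mul_le_mul h1 (by nlinarith) hε0.le (by positivity)
    exact mul_le_mul hC0 (Real.rpow_le_rpow_of_exponent_le (one_le_pow₀ one_le_two) hC1)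
      (by positivity) (by positivity)
  · intro v q _ eV eK N hN
    obtain ⟨h1, h2⟩ := mainAlgorithm_khotVishnoi hε hrep hC hε0 hε' hγ eV eK 16 rfl
    refine ⟨h1.trans_eq ?_, fun hk => h2 (lt_of_lt_of_le ?_ (half_le_targetFraction hC hε0 hs))⟩
    · have hlog : Real.logb 2 N = 2 ^ k := by
        rw [hN, ← Real.rpow_natCast, Real.logb_rpow two_pos (by norm_num)]
        push_cast
        rfl
      rw [hlog, hN, ← Real.rpow_natCast 2 (2 ^ k), ← Real.rpow_mul two_pos.le]
      push_cast
      rfl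
    · rw [← Real.rpow_natCast, ← Real.rpow_mul two_pos.le, one_div, ← Real.rpow_neg_one]
      refine Real.rpow_lt_rpow_of_exponent_lt one_lt_two ?_
      have h3 : 1 / ε < k :=
        (Nat.le_ceil _).trans_lt (by exact_mod_cast Nat.lt_of_succ_le hk)
      rw [div_lt_iff₀ hε0] at h3
      linarith
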